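/- Let $n\ge 1$. A cube is a cube in $\mathbb R^n$ with edges parallel to the axes and finite positive edge length (open, closed or neither); $Q_0:=[-e,e]^n$; $\fint_Q f:=\frac1{|Q|}\int_Q f$. A scalar weight is a measurable function $w:\mathbb R^n\to[0,\infty)$ that is positive almost everywhere, and $W(E):=\int_E W(x)\,dx$. Let $\mathcal P_0$ (resp. $\mathcal P$) be the set of measurable $p:\mathbb R^n\to(0,\infty]$ with $p_->0$ (resp. $p:\mathbb R^n\to[1,\infty]$), where $p_-:=\operatorname{ess\,inf}p$ and $p_+:=\operatorname{ess\,sup}p$. A real-valued $p(\cdot)$ is globally log-Hölder continuous, $p(\cdot)\in LH$, if there are positive constants $C_0,p_\infty,C_\infty$ such that $$|p(x)-p(y)|\le -\frac{C_0}{\log|x-y|}\ \text{ whenever } 0<|x-y|<\tfrac12,\qquad |p(x)-p_\infty|\le\frac{C_\infty}{\log(e+|x|)}\ \text{ for all }x.$$ A constant depends only on $p(\cdot)$ if it depends only on $p_-,p_+,p_\infty,C_0,C_\infty$. Let $$\|f\|_{L^{p(\cdot)}}:=\inf\Big\{\lambda>0:\int_{\mathbb R^n}\Big|\frac{f(x)}\lambda\Big|^{p(x)}dx\le1\Big\}\quad(\inf\emptyset:=\infty),$$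 $$[w]_{\mathcal A_{p(\cdot),\infty}}:=\sup_Q\frac{\|w\mathbf 1_Q\|_{L^{p(\cdot)}}}{\|\mathbf 1_Q\|_{L^{p(\cdot)}}}\exp\Big(\fint_Q\log(w^{-1})\Big),\qquad [w]_{A_\infty}:=\sup_Q\fint_Q w\;\exp\Big(\fint_Q\log (w^{-1})\Big),$$ where the suprema are over all cubes and the expression for $Q$ is read as $\infty$ if $\log w$ is not integrable on $Q$. A scalar weight $w$ belongs to $\mathcal A_{p(\cdot),\infty}$ (resp. $A_\infty$) if $[w]_{\mathcal A_{p(\cdot),\infty}}<\infty$ (resp. $[w]_{A_\infty}<\infty$). **Theorem.** (i) Let $p(\cdot)\in\mathcal P_0$ with $p(\cdot)\in LH$, and let $w$ be a scalar weight. Then $w\in\mathcal A_{p(\cdot),\infty}$ if and only if $\mathbb W:=[w(\cdot)]^{p(\cdot)}\in A_\infty$. (ii) There is a constant $\tau_n>0$, depending only on $n$, such that for every $p(\cdot)\in\mathcal P$ with $p(\cdot)\in LH$ there are positive constants $C_{p(\cdot),n}$, $C$ and $A$, depending only on $p(\cdot)$ and $n$, with the following property. Let $w\in\mathcal A_{p(\cdot),\infty}$,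 $\mathbb W:=[w(\cdot)]^{p(\cdot)}$, $\delta:=1+\frac1{\tau_nC_{p(\cdot),n}[w]_{\mathcal A_{p(\cdot),\infty}}}$ and $\alpha\in(0,2^{-\frac{\delta}{\delta-1}})$. Then, for every cube $Q$ and every measurable set $E\subset Q$ with $|E|>(1-\alpha)|Q|$, $$\mathbb W(Q)<C\big(1-2\alpha^{1-\frac1\delta}\big)^{-p_+}[w]_{\mathcal A_{p(\cdot),\infty}}^{A}\,L_w\,\mathbb W(E),\qquad L_w:=\max\Big\{\|w\mathbf 1_{Q_0}\|_{L^{p(\cdot)}}^{p_--p_+},\ \|w\mathbf 1_{Q_0}\|_{L^{p(\cdot)}}^{p_+-p_-}\Big\}.$$ (iii) For every $p(\cdot)\in\mathcal P$ with $p(\cdot)\in LH$ there are positive constants $C$ and $A$, depending only on $p(\cdot)$ and $n$, such that for every $\mathbb W\in A_\infty$ the weight $w:=[\mathbb W(\cdot)]^{1/p(\cdot)}$ satisfies $$[w]_{\mathcal A_{p(\cdot),\infty}}\le C\,\widetilde{L_w}\,[\mathbb W]_{A_\infty}^{A},\qquad \widetilde{L_w}:=\max\Big\{\mathbb W(Q_0)^{\frac1{p_-}-\frac1{p_+}},\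 \mathbb W(Q_0)^{\frac1{p_+}-\frac1{p_-}}\Big\}.$$ -/

import Mathlib

open MeasureTheory
open scoped ENNReal

noncomputable section

namespace VariableWeight

/-- The closed cube in `ℝⁿ` with centre `x`, edge length `l` and edges parallel to the axes. -/
def closedCube {n : ℕ} (x : EuclideanSpace ℝ (Fin n)) (l : ℝ) : Set (EuclideanSpace ℝ (Fin n)) :=
  {y | ∀ i, |y i - x i| ≤ l / 2}

/-- The open cube in `ℝⁿ` with centre `x`, edge length `l` and edges parallel to the axes. -/
def openCube {n : ℕ} (x : EuclideanSpace ℝ (Fin n)) (l : ℝ) : Set (EuclideanSpace ℝ (Fin n)) :=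
  {y | ∀ i, |y i - x i| < l / 2}

/-- A cube with edges parallel to the axes and finite positive edge length; it need be neither
open nor closed, that is, it may contain any part of its boundary. -/
def IsCube {n : ℕ} (Q : Set (EuclideanSpace ℝ (Fin n))) : Prop :=
  ∃ (x : EuclideanSpace ℝ (Fin n)) (l : ℝ), 0 < l ∧ openCube x l ⊆ Q ∧ Q ⊆ closedCube x l

/-- The cube `Q₀ = Q(0, 2e)`. -/
def unitScaleCube (n : ℕ) : Set (EuclideanSpace ℝ (Fin n)) :=
  closedCube 0 (2 * Real.exp 1)

/-- `p₋`, the essential infimum of the exponent. -/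
def pMinus {n : ℕ} (p : EuclideanSpace ℝ (Fin n) → ℝ) : ℝ := essInf p volume

/-- `p₊`, the essential supremum of the exponent. -/
def pPlus {n : ℕ} (p : EuclideanSpace ℝ (Fin n) → ℝ) : ℝ := essSup p volume

/-- Finite-valued exponents in the class `𝒫₀`: measurable, `p : ℝⁿ → (0, ∞)`, with `p₋ > 0`.
(Log-Hölder continuity, assumed throughout, is a property of real-valued functions.) -/
def IsExponentP0 {n : ℕ} (p : EuclideanSpace ℝ (Fin n) → ℝ) : Prop :=
  Measurable p ∧ (∀ x, 0 < p x) ∧ 0 < pMinus p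

/-- Finite-valued exponents in the class `𝒫`: measurable, `p : ℝⁿ → [1, ∞)`. -/
def IsExponentP {n : ℕ} (p : EuclideanSpace ℝ (Fin n) → ℝ) : Prop :=
  Measurable p ∧ ∀ x, 1 ≤ p x

/-- Local log-Hölder continuity with constant `C₀`.
For `x = y` both sides vanish, since `Real.log 0 = 0` and `C₀ / 0 = 0`. -/
def LocalLogHolderWith {n : ℕ} (C₀ : ℝ) (r : EuclideanSpace ℝ (Fin n) → ℝ) : Prop :=
  ∀ x y, ‖x - y‖ < 1 / 2 → |r x - r y| ≤ -(C₀ / Real.log ‖x - y‖)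

/-- Log-Hölder continuity at infinity with limit `rInf` and constant `CInf`. -/
def LogHolderAtInftyWith {n : ℕ} (rInf CInf : ℝ) (r : EuclideanSpace ℝ (Fin n) → ℝ) : Prop :=
  ∀ x, |r x - rInf| ≤ CInf / Real.log (Real.exp 1 + ‖x‖)

/-- The class `LH` of globally log-Hölder continuous functions. -/
def IsLogHolder {n : ℕ} (r : EuclideanSpace ℝ (Fin n) → ℝ) : Prop :=
  (∃ C₀ : ℝ, 0 < C₀ ∧ LocalLogHolderWith C₀ r) ∧
  (∃ rInf CInf : ℝ, 0 < rInf ∧ 0 < CInf ∧ LogHolderAtInftyWith rInf CInf r)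

/-- `p` is an exponent in `𝒫 ∩ LH` with the given values of `p₋`, `p₊`, `p_∞`, `C₀`, `C_∞`.
A constant that depends on these numbers alone is said to depend only on `p(·)`. -/
def HasParameters {n : ℕ} (pm pp pInf C₀ CInf : ℝ) (p : EuclideanSpace ℝ (Fin n) → ℝ) : Prop :=
  IsExponentP p ∧ pMinus p = pm ∧ pPlus p = pp ∧
  0 < C₀ ∧ LocalLogHolderWith C₀ p ∧
  0 < pInf ∧ 0 < CInf ∧ LogHolderAtInftyWith pInf CInf p

/-- The modular `ρ(f) = ∫ |f(x)|^{p(x)} dx`. -/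
def modular {n : ℕ} (p f : EuclideanSpace ℝ (Fin n) → ℝ) : ℝ≥0∞ :=
  ∫⁻ x, ENNReal.ofReal (|f x| ^ p x)

/-- The (quasi-)norm `‖f‖_{L^{p(·)}} = inf {t > 0 : ρ(f / t) ≤ 1}`, with `inf ∅ = ∞`. -/
def varNorm {n : ℕ} (p f : EuclideanSpace ℝ (Fin n) → ℝ) : ℝ≥0∞ :=
  ⨅ (t : ℝ) (_ : 0 < t) (_ : modular p (fun x => f x / t) ≤ 1), ENNReal.ofReal t

/-- A scalar weight: a (Lebesgue) measurable non-negative function, positive almost everywhere. -/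
def IsWeight {n : ℕ} (w : EuclideanSpace ℝ (Fin n) → ℝ) : Prop :=
  AEMeasurable w volume ∧ (∀ x, 0 ≤ w x) ∧ ∀ᵐ x, 0 < w x

/-- `exp (⨍_Q log (w⁻¹))`. It is `∞` if `log (w⁻¹)` is not integrable on `Q`: for the `w` and `Q`
in question this happens only if `∫_Q log₊ (w⁻¹) = ∞`, or if `w` is so large that the factor
multiplying it below is infinite anyway. -/
def expAvgLogInv {n : ℕ} (w : EuclideanSpace ℝ (Fin n) → ℝ)
    (Q : Set (EuclideanSpace ℝ (Fin n))) : ℝ≥0∞ :=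
  open Classical in
  if IntegrableOn (fun y => Real.log (w y)⁻¹) Q volume then
    ENNReal.ofReal (Real.exp (⨍ y in Q, Real.log (w y)⁻¹))
  else ⊤

/-- The constant `[w]_{𝒜_{p(·),∞}}`. -/
def apInftyConst {n : ℕ} (p w : EuclideanSpace ℝ (Fin n) → ℝ) : ℝ≥0∞ :=
  ⨆ (Q : Set (EuclideanSpace ℝ (Fin n))) (_ : IsCube Q),
    varNorm p (Q.indicator w) / varNorm p (Q.indicator (fun _ => 1)) * expAvgLogInv w Q

/-- The class `𝒜_{p(·),∞}`. -/
def IsApInfty {n : ℕ} (p w : EuclideanSpace ℝ (Fin n) → ℝ) : Prop :=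
  IsWeight w ∧ apInftyConst p w < ⊤

/-- `W(E) = ∫_E W(x) dx`. -/
def wMass {n : ℕ} (W : EuclideanSpace ℝ (Fin n) → ℝ) (E : Set (EuclideanSpace ℝ (Fin n))) :
    ℝ≥0∞ :=
  ∫⁻ x in E, ENNReal.ofReal (W x)

/-- The constant `[W]_{A_∞}` of the classical Muckenhoupt class. -/
def aInftyConst {n : ℕ} (W : EuclideanSpace ℝ (Fin n) → ℝ) : ℝ≥0∞ :=
  ⨆ (Q : Set (EuclideanSpace ℝ (Fin n))) (_ : IsCube Q),
    wMass W Q / volume Q * expAvgLogInv W Q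

/-- The classical Muckenhoupt class `A_∞`. -/
def IsAInfty {n : ℕ} (W : EuclideanSpace ℝ (Fin n) → ℝ) : Prop :=
  IsWeight W ∧ aInftyConst W < ⊤

/-- The normalisation factor
`L_w = max {‖w 1_{Q₀}‖^{p₋ - p₊}, ‖w 1_{Q₀}‖^{p₊ - p₋}}`. -/
def normFactor {n : ℕ} (p w : EuclideanSpace ℝ (Fin n) → ℝ) : ℝ≥0∞ :=
  max (varNorm p ((unitScaleCube n).indicator w) ^ (pMinus p - pPlus p))
    (varNorm p ((unitScaleCube n).indicator w) ^ (pPlus p - pMinus p))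

/-- The normalisation factor
`max {W(Q₀)^{1/p₋ - 1/p₊}, W(Q₀)^{1/p₊ - 1/p₋}}`. -/
def massNormFactor {n : ℕ} (p W : EuclideanSpace ℝ (Fin n) → ℝ) : ℝ≥0∞ :=
  max (wMass W (unitScaleCube n) ^ (1 / pMinus p - 1 / pPlus p))
    (wMass W (unitScaleCube n) ^ (1 / pPlus p - 1 / pMinus p))

end VariableWeight

end

/-! Everything is done with logarithms. For a cube `Q` with centre `z` and length `l`, let τ(Q) and
σ(Q) be the logarithms of the norms of `w 1_Q` and `1_Q`. The class `𝒜_{p(·),∞}` bounds τ - σ minus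
the mean of `log w` by the logarithm of its constant; let κ ≥ 0 be the positive part of that
logarithm. The inequality `1 + y ≤ exp y` bounds the mean of the positive part of `log w - (τ - σ)`
by a constant of the exponent alone. So on every cube `log w` is within O(1 + κ) of τ - σ in mean.
Comparing a cube with its double gives a doubling estimate; iterating it to and from `Q₀`, where τ
is normalised to 0, gives logarithmic growth: |τ(Q)| ≤ B log(e + |z| + l + 1/l) with B linear in 1 +
κ (`CubeData.lower_growth`, `CubeData.upper_growth`).

Log-Hölder continuity supplies exactly the decay that cancels this growth. On `Q` the exponent
differs from a reference value q (its value at the centre for l < 1, its limit at infinity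
otherwise) by O(1/log(e + |x| + 1/l)) pointwise and by O(1/log(e + |z| + l + 1/l)) in mean.
Pointwise, exp(-p(x)τ) and exp(-qτ) may be exchanged up to a tail that is integrable against any
measure of polynomial growth (`exp_neg_mul_le_of_abs_sub_mul_le`, `lintegral_exp_neg_tailExp_le`);
this turns a modular equal to 1 into `𝕎`(Q) ≤ exp(qτ + O(1 + κ)). In mean, the average of `p log w`
is at least q(τ - σ) - O(1 + κ) (`CubeData.le_average_mul`). Since qσ = log |Q| + O(1), by the
exchange for Lebesgue measure, the two bounds combine to the `A_∞` inequality for `𝕎`. The converse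
runs the same machine on masses: τ is log `𝕎`(Q), σ is n log l, and 1/p replaces p in the mean
estimate.

All losses are linear in 1 + κ, so they exponentiate to powers of the weight constants. Undoing the
normalisation on `Q₀` by λ = τ(Q₀) costs |λ| times the oscillation of p, respectively of 1/p; these
are the factors `normFactor` and `massNormFactor`. The mass comparison in (ii) needs no reverse
Hölder inequality: the range of α forces |E| > |Q|/2, and the `A_∞` inequality with Jensen's
inequality on E bounds `𝕎`(Q)/`𝕎`(E). The factor containing α and δ is at least 1 and is only a
gain. -/

namespace VariableWeight

variable {n : ℕ}

/-! ### Cubes and their volumes. -/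

theorem abs_apply_le_norm (x : EuclideanSpace ℝ (Fin n)) (i : Fin n) : |x i| ≤ ‖x‖ := by
  simpa using PiLp.norm_apply_le x i

theorem closedCube_eq_preimage (x : EuclideanSpace ℝ (Fin n)) (l : ℝ) :
    closedCube x l = (MeasurableEquiv.toLp 2 (Fin n → ℝ)).symm ⁻¹'
      Set.Icc (fun i => x i - l / 2) (fun i => x i + l / 2) := by
  ext y
  simp only [closedCube, Set.mem_ofPred_eq, Set.mem_preimage, Set.mem_Icc, Pi.le_def, abs_le,
    ← forall_and]
  refine forall_congr' fun i => ?_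
  simp only [MeasurableEquiv.coe_toLp_symm]
  constructor <;> rintro ⟨h1, h2⟩ <;> constructor <;> linarith

theorem openCube_eq_preimage (x : EuclideanSpace ℝ (Fin n)) (l : ℝ) :
    openCube x l = (MeasurableEquiv.toLp 2 (Fin n → ℝ)).symm ⁻¹'
      Set.univ.pi (fun i => Set.Ioo (x i - l / 2) (x i + l / 2)) := by
  ext y
  simp only [openCube, Set.mem_ofPred_eq, Set.mem_preimage, Set.mem_pi, Set.mem_univ, true_imp_iff,
    Set.mem_Ioo, abs_lt]
  refine forall_congr' fun i => ?_
  simp only [MeasurableEquiv.coe_toLp_symm]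
  constructor <;> rintro ⟨h1, h2⟩ <;> constructor <;> linarith

theorem measurableSet_closedCube (x : EuclideanSpace ℝ (Fin n)) (l : ℝ) :
    MeasurableSet (closedCube x l) := by
  rw [closedCube_eq_preimage]
  exact (MeasurableEquiv.measurable _) measurableSet_Icc

theorem measurableSet_openCube (x : EuclideanSpace ℝ (Fin n)) (l : ℝ) :
    MeasurableSet (openCube x l) := by
  rw [openCube_eq_preimage]
  exact (MeasurableEquiv.measurable _) (MeasurableSet.univ_pi fun _ => measurableSet_Ioo)

theorem volume_closedCube (x : EuclideanSpace ℝ (Fin n)) {l : ℝ} (hl : 0 < l) :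
    volume (closedCube x l) = ENNReal.ofReal (l ^ n) := by
  rw [closedCube_eq_preimage,
    (EuclideanSpace.volume_preserving_symm_measurableEquiv_toLp (Fin n)).measure_preimage
      measurableSet_Icc.nullMeasurableSet, Real.volume_Icc_pi]
  simp [ENNReal.ofReal_pow hl.le]

theorem volume_openCube (x : EuclideanSpace ℝ (Fin n)) {l : ℝ} (hl : 0 < l) :
    volume (openCube x l) = ENNReal.ofReal (l ^ n) := by
  rw [openCube_eq_preimage,
    (EuclideanSpace.volume_preserving_symm_measurableEquiv_toLp (Fin n)).measure_preimage
      (MeasurableSet.univ_pi fun _ => measurableSet_Ioo).nullMeasurableSet, Real.volume_pi_Ioo]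
  simp [ENNReal.ofReal_pow hl.le]

theorem volume_closedCube_lt_top (x : EuclideanSpace ℝ (Fin n)) {l : ℝ} (hl : 0 < l) :
    volume (closedCube x l) < ∞ := by
  rw [volume_closedCube x hl]; exact ENNReal.ofReal_lt_top

theorem measureReal_closedCube (x : EuclideanSpace ℝ (Fin n)) {l : ℝ} (hl : 0 < l) :
    volume.real (closedCube x l) = l ^ n := by
  rw [measureReal_def, volume_closedCube x hl, ENNReal.toReal_ofReal (by positivity)]

theorem openCube_ae_eq (x : EuclideanSpace ℝ (Fin n)) {l : ℝ} (hl : 0 < l) :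
    openCube x l =ᵐ[volume] closedCube x l := by
  refine ae_eq_of_subset_of_measure_ge (fun y hy i => (hy i).le) ?_
    (measurableSet_openCube x l).nullMeasurableSet (volume_closedCube_lt_top x hl).ne
  rw [volume_closedCube x hl, volume_openCube x hl]

/-- The boundary of a cube is null and integrals ignore null sets, so all later work may be done on
closed cubes. -/
theorem IsCube.exists_ae_eq {Q : Set (EuclideanSpace ℝ (Fin n))} (hQ : IsCube Q) :
    ∃ x l, 0 < l ∧ Q =ᵐ[volume] closedCube x l := by
  obtain ⟨x, l, hl, h1, h2⟩ := hQ
  refine ⟨x, l, hl, ?_⟩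
  refine Filter.EventuallyLE.antisymm h2.eventuallyLE ?_
  exact (openCube_ae_eq x hl).symm.le.trans h1.eventuallyLE

theorem isCube_closedCube (x : EuclideanSpace ℝ (Fin n)) {l : ℝ} (hl : 0 < l) :
    IsCube (closedCube x l) :=
  ⟨x, l, hl, fun _ hy i => (hy i).le, subset_rfl⟩

theorem self_mem_closedCube (x : EuclideanSpace ℝ (Fin n)) {l : ℝ} (hl : 0 < l) :
    x ∈ closedCube x l := by
  intro i; simp; positivity

theorem norm_sub_le_of_mem_closedCube {x y : EuclideanSpace ℝ (Fin n)} {l : ℝ} (hl : 0 < l)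
    (hy : y ∈ closedCube x l) : ‖y - x‖ ≤ n * l := by
  refine abs_le_of_sq_le_sq' ?_ (by positivity) |>.2
  rw [EuclideanSpace.norm_sq_eq]
  have h1 : ∀ i ∈ (Finset.univ : Finset (Fin n)), ‖(y - x) i‖ ^ 2 ≤ l ^ 2 := by
    intro i _
    have := hy i
    have h2 : ‖(y - x) i‖ ≤ l := by
      simp only [PiLp.sub_apply, Real.norm_eq_abs]; linarith
    gcongr
  refine (Finset.sum_le_sum h1).trans ?_
  simp only [Finset.sum_const, Finset.card_univ, Fintype.card_fin, nsmul_eq_mul]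
  rw [mul_pow]
  gcongr
  rcases Nat.eq_zero_or_pos n with h | h
  · subst h; simp
  · have : (1 : ℝ) ≤ n := by exact_mod_cast h
    nlinarith

theorem closedCube_subset_closedCube {x y : EuclideanSpace ℝ (Fin n)} {l r : ℝ}
    (h : ‖x - y‖ + l / 2 ≤ r / 2) : closedCube x l ⊆ closedCube y r := by
  intro z hz i
  have h1 := hz i
  have h2 := abs_apply_le_norm (x - y) i
  simp only [PiLp.sub_apply] at h2
  calc |z i - y i| ≤ |z i - x i| + |x i - y i| := abs_sub_le _ _ _
    _ ≤ r / 2 := by linarith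

theorem mem_closedCube_zero_of_norm_le {x : EuclideanSpace ℝ (Fin n)} {r : ℝ} (h : ‖x‖ ≤ r) :
    x ∈ closedCube 0 (2 * r) := by
  intro i
  have := abs_apply_le_norm x i
  simp; linarith

/-! ### Logarithmic scales of points and cubes. -/

/-- The scale function `log (e + |x| + 1 / l)`. -/
noncomputable def pointScale (x : EuclideanSpace ℝ (Fin n)) (l : ℝ) : ℝ :=
  Real.log (Real.exp 1 + ‖x‖ + 1 / l)

/-- The scale function `log (e + |z| + l + 1 / l)` of the cube with centre `z` and length `l`. -/
noncomputable def cubeScale (z : EuclideanSpace ℝ (Fin n)) (l : ℝ) : ℝ :=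
  Real.log (Real.exp 1 + ‖z‖ + l + 1 / l)

theorem one_le_log_of_exp_le {y : ℝ} (h : Real.exp 1 ≤ y) : 1 ≤ Real.log y := by
  rw [Real.le_log_iff_exp_le ((Real.exp_pos 1).trans_le h)]; exact h

theorem one_le_pointScale (x : EuclideanSpace ℝ (Fin n)) {l : ℝ} (hl : 0 < l) :
    1 ≤ pointScale x l :=
  one_le_log_of_exp_le (by have : 0 < 1 / l := by positivity
                           linarith [norm_nonneg x])

theorem one_le_cubeScale (x : EuclideanSpace ℝ (Fin n)) {l : ℝ} (hl : 0 < l) :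
    1 ≤ cubeScale x l :=
  one_le_log_of_exp_le (by have : 0 < 1 / l := by positivity
                           linarith [norm_nonneg x])

theorem log_mul_le {c y : ℝ} (hc : 1 ≤ c) (hy : Real.exp 1 ≤ y) :
    Real.log (c * y) ≤ (1 + Real.log c) * Real.log y := by
  have h1 := one_le_log_of_exp_le hy
  have hy0 : 0 < y := (Real.exp_pos 1).trans_le hy
  rw [Real.log_mul (by positivity) hy0.ne']
  nlinarith [Real.log_nonneg hc]

end VariableWeight

/-! ### Oscillation of a log-Hölder exponent on a cube. -/

namespace VariableWeight

variable {n : ℕ}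

/-- Log-Hölder continuous exponents with values, and value at infinity, in `[a, b]`. -/
structure LHExponent (a b pInf C₀ CInf : ℝ) (p : EuclideanSpace ℝ (Fin n) → ℝ) : Prop where
  meas : Measurable p
  a_pos : 0 < a
  a_le : ∀ x, a ≤ p x
  le_b : ∀ x, p x ≤ b
  a_le_inf : a ≤ pInf
  inf_le_b : pInf ≤ b
  C₀_pos : 0 < C₀
  CInf_pos : 0 < CInf
  loc : LocalLogHolderWith C₀ p
  atInf : LogHolderAtInftyWith pInf CInf p

/-- The reference value of the exponent on the cube with centre `z` and length `l`. -/
noncomputable def refExp (p : EuclideanSpace ℝ (Fin n) → ℝ) (pInf : ℝ)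
    (z : EuclideanSpace ℝ (Fin n)) (l : ℝ) : ℝ :=
  open Classical in if l < 1 then p z else pInf

section LHExponent

variable {a b pInf C₀ CInf : ℝ} {p : EuclideanSpace ℝ (Fin n) → ℝ}

theorem LHExponent.a_le_refExp (h : LHExponent a b pInf C₀ CInf p)
    (z : EuclideanSpace ℝ (Fin n)) (l : ℝ) : a ≤ refExp p pInf z l := by
  unfold refExp; split_ifs
  exacts [h.a_le z, h.a_le_inf]

theorem LHExponent.refExp_le_b (h : LHExponent a b pInf C₀ CInf p)
    (z : EuclideanSpace ℝ (Fin n)) (l : ℝ) : refExp p pInf z l ≤ b := by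
  unfold refExp; split_ifs
  exacts [h.le_b z, h.inf_le_b]

theorem LHExponent.b_pos (h : LHExponent a b pInf C₀ CInf p) : 0 < b :=
  h.a_pos.trans_le (h.a_le_inf.trans h.inf_le_b)

theorem LHExponent.abs_sub_pInf_mul_le (h : LHExponent a b pInf C₀ CInf p)
    (x : EuclideanSpace ℝ (Fin n)) :
    |p x - pInf| * Real.log (Real.exp 1 + ‖x‖) ≤ CInf := by
  have h1 : 1 ≤ Real.log (Real.exp 1 + ‖x‖) :=
    one_le_log_of_exp_le (by linarith [norm_nonneg x])
  have := h.atInf x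
  rwa [le_div_iff₀ (by linarith)] at this

/-- The bound for the oscillation of the exponent on a cube. -/
noncomputable def oscConst (n : ℕ) (b C₀ CInf : ℝ) : ℝ :=
  2 * CInf + CInf + CInf * (1 + Real.log (1 + n)) +
    (2 * C₀ + b * Real.log (Real.exp 1 + 4 * (n : ℝ) ^ 2))

/-- If l ≤ 1/(4n²), then |x - z| ≤ √l / 2, so log(1/|x - z|) is at least half of log(e + 1/l) and
the local condition applies. For larger l the logarithm is bounded and |p x - p z| ≤ b suffices. -/
theorem LHExponent.abs_sub_mul_log_inv_le (h : LHExponent a b pInf C₀ CInf p)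
    {x z : EuclideanSpace ℝ (Fin n)} {l : ℝ} (hl : 0 < l) (hl1 : l < 1) (hn : 0 < n)
    (hx : ‖x - z‖ ≤ n * l) :
    |p x - p z| * Real.log (Real.exp 1 + 1 / l) ≤
      2 * C₀ + b * Real.log (Real.exp 1 + 4 * (n : ℝ) ^ 2) := by
  have hn1 : (1 : ℝ) ≤ n := by exact_mod_cast hn
  have hpos := Real.exp_pos 1
  have hlog : 1 ≤ Real.log (Real.exp 1 + 1 / l) :=
    one_le_log_of_exp_le (by have : 0 < 1 / l := by positivity
                             linarith)
  have hlog2 : 1 ≤ Real.log (Real.exp 1 + 4 * (n : ℝ) ^ 2) :=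
    one_le_log_of_exp_le (by nlinarith)
  by_cases hsmall : 4 * (n : ℝ) ^ 2 ≤ 1 / l
  · have hb0 : 0 ≤ b * Real.log (Real.exp 1 + 4 * (n : ℝ) ^ 2) :=
      mul_nonneg h.b_pos.le (by linarith)
    rcases eq_or_ne x z with rfl | hxz
    · simp; linarith [h.C₀_pos]
    have hr : 0 < ‖x - z‖ := norm_pos_iff.2 (sub_ne_zero.2 hxz)
    have hl4 : 4 * (n : ℝ) ^ 2 * l ≤ 1 := by rwa [le_div_iff₀ hl] at hsmall
    have hr2 : (2 * ‖x - z‖) ^ 2 ≤ l := by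
      have : (2 * ‖x - z‖) ^ 2 ≤ (2 * (n * l)) ^ 2 := by gcongr
      nlinarith
    have hrhalf : ‖x - z‖ < 1 / 2 := by nlinarith
    have h1 := h.loc x z hrhalf
    have h2 : Real.log (Real.exp 1 + 1 / l) ≤ 2 * (-Real.log ‖x - z‖) := by
      have h3 : Real.exp 1 + 1 / l ≤ 4 * (1 / l) := by
        have : 1 ≤ 1 / l := by rw [le_div_iff₀ hl]; linarith
        linarith [Real.exp_one_lt_d9]
      have h4 : 4 * (1 / l) ≤ (‖x - z‖ ^ 2)⁻¹ := by
        rw [mul_one_div, le_inv_comm₀ (by positivity) (by positivity), inv_div,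
          le_div_iff₀ (by norm_num)]
        nlinarith
      have h5 := Real.log_le_log (by positivity) (h3.trans h4)
      rw [Real.log_inv, Real.log_pow] at h5
      push_cast at h5
      linarith
    have hneg : 0 < -Real.log ‖x - z‖ := by
      have := Real.log_neg hr (by linarith); linarith
    rw [← div_neg, le_div_iff₀ hneg] at h1
    calc |p x - p z| * Real.log (Real.exp 1 + 1 / l)
        ≤ |p x - p z| * (2 * (-Real.log ‖x - z‖)) := by gcongr
      _ ≤ _ := by linarith
  · push Not at hsmall
    have h1 : |p x - p z| ≤ b := by
      rw [abs_le]; constructor <;> linarith [h.a_le x, h.le_b x, h.a_le z, h.le_b z, h.a_pos]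
    have h2 : Real.log (Real.exp 1 + 1 / l) ≤ Real.log (Real.exp 1 + 4 * (n : ℝ) ^ 2) :=
      Real.log_le_log (by positivity) (by linarith)
    have := mul_le_mul h1 h2 (by linarith) h.b_pos.le
    linarith [h.C₀_pos]

theorem LHExponent.oscConst_pos (h : LHExponent a b pInf C₀ CInf p) : 0 < oscConst n b C₀ CInf := by
  have hlog2 : 1 ≤ Real.log (Real.exp 1 + 4 * (n : ℝ) ^ 2) :=
    one_le_log_of_exp_le (by nlinarith)
  have := Real.log_nonneg (show (1 : ℝ) ≤ 1 + n by simp)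
  have h1 := h.b_pos
  have h2 := h.C₀_pos
  have h3 := h.CInf_pos
  unfold oscConst
  positivity

/-- On a small cube the scale is at most log(e + |x|) + log(e + 1/l). The first summand is absorbed
by the decay of p towards its limit, used at x and at z (their logarithms are comparable because l <
1), the second by local continuity. On a large cube 1/l ≤ 1, so decay at infinity alone is enough.
-/
theorem LHExponent.abs_sub_refExp_mul_le (h : LHExponent a b pInf C₀ CInf p) (hn : 0 < n)
    {x z : EuclideanSpace ℝ (Fin n)} {l : ℝ} (hl : 0 < l) (hx : x ∈ closedCube z l) :
    |p x - refExp p pInf z l| * pointScale x l ≤ oscConst n b C₀ CInf := by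
  have hn1 : (1 : ℝ) ≤ n := by exact_mod_cast hn
  have hpos := Real.exp_pos 1
  have hxn := norm_nonneg x
  have hzn := norm_nonneg z
  have hlog2 : 1 ≤ Real.log (Real.exp 1 + 4 * (n : ℝ) ^ 2) :=
    one_le_log_of_exp_le (by nlinarith)
  have hlogn := Real.log_nonneg (show (1 : ℝ) ≤ 1 + n by simp)
  have hA := h.abs_sub_pInf_mul_le x
  have hD0 := one_le_pointScale x hl
  have hb0 := h.b_pos
  have hC0 := h.C₀_pos
  have hCI := h.CInf_pos
  have t1 : 0 ≤ CInf * (1 + Real.log (1 + n)) := by positivity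
  have t2 : 0 ≤ b * Real.log (Real.exp 1 + 4 * (n : ℝ) ^ 2) := by positivity
  unfold refExp oscConst
  split_ifs with hl1
  · have hd := norm_sub_le_of_mem_closedCube hl hx
    have hD : pointScale x l ≤ Real.log (Real.exp 1 + ‖x‖) + Real.log (Real.exp 1 + 1 / l) := by
      rw [← Real.log_mul (by positivity) (by positivity)]
      refine Real.log_le_log (by positivity) ?_
      have : 0 < 1 / l := by positivity
      have he : 1 ≤ Real.exp 1 := Real.one_le_exp (by norm_num)
      nlinarith [mul_nonneg (sub_nonneg.2 he) hxn, mul_nonneg hxn this.le]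
    have hB := h.abs_sub_pInf_mul_le z
    have h1 : Real.log (Real.exp 1 + ‖x‖) ≤
        (1 + Real.log (1 + n)) * Real.log (Real.exp 1 + ‖z‖) := by
      refine le_trans (Real.log_le_log (by positivity) ?_) (log_mul_le (by linarith) (by linarith))
      have : ‖x‖ ≤ ‖z‖ + ‖x - z‖ := norm_le_insert' x z
      have he : 1 ≤ Real.exp 1 := Real.one_le_exp (by norm_num)
      nlinarith
    have h2 : |p z - pInf| * Real.log (Real.exp 1 + ‖x‖) ≤ CInf * (1 + Real.log (1 + n)) := by
      calc _ ≤ |p z - pInf| * ((1 + Real.log (1 + n)) * Real.log (Real.exp 1 + ‖z‖)) := by gcongr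
        _ = (|p z - pInf| * Real.log (Real.exp 1 + ‖z‖)) * (1 + Real.log (1 + n)) := by ring
        _ ≤ _ := by gcongr
    have h3 := h.abs_sub_mul_log_inv_le hl hl1 hn hd
    have h4 : |p x - p z| ≤ |p x - pInf| + |p z - pInf| := by
      rw [abs_sub_comm (p z)]; exact abs_sub_le _ _ _
    have hlx : 0 ≤ Real.log (Real.exp 1 + ‖x‖) := by
      linarith [one_le_log_of_exp_le (show Real.exp 1 ≤ Real.exp 1 + ‖x‖ by linarith)]
    calc |p x - p z| * pointScale x l
        ≤ |p x - p z| * (Real.log (Real.exp 1 + ‖x‖) + Real.log (Real.exp 1 + 1 / l)) := by gcongr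
      _ = |p x - p z| * Real.log (Real.exp 1 + ‖x‖) +
          |p x - p z| * Real.log (Real.exp 1 + 1 / l) := by ring
      _ ≤ (|p x - pInf| + |p z - pInf|) * Real.log (Real.exp 1 + ‖x‖) +
          |p x - p z| * Real.log (Real.exp 1 + 1 / l) := by gcongr
      _ ≤ _ := by linarith
  · push Not at hl1
    have hD : pointScale x l ≤ 2 * Real.log (Real.exp 1 + ‖x‖) := by
      have : pointScale x l ≤ (1 + Real.log 2) * Real.log (Real.exp 1 + ‖x‖) := by
        refine le_trans (Real.log_le_log (by positivity) ?_)
          (log_mul_le (by norm_num) (by linarith))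
        have : 1 / l ≤ 1 := by rw [div_le_one hl]; exact hl1
        have he : 1 ≤ Real.exp 1 := Real.one_le_exp (by norm_num)
        linarith
      have h1 := one_le_log_of_exp_le (show Real.exp 1 ≤ Real.exp 1 + ‖x‖ by linarith)
      have h2 : Real.log 2 ≤ 1 := by linarith [Real.log_two_lt_d9]
      nlinarith
    calc |p x - pInf| * pointScale x l
        ≤ |p x - pInf| * (2 * Real.log (Real.exp 1 + ‖x‖)) := by gcongr
      _ ≤ _ := by linarith

theorem measurable_pointScale (l : ℝ) :
    Measurable fun x : EuclideanSpace ℝ (Fin n) => pointScale x l := by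
  unfold pointScale
  exact Real.measurable_log.comp
    (f := fun x : EuclideanSpace ℝ (Fin n) => Real.exp 1 + ‖x‖ + 1 / l) (by fun_prop)

theorem integrableOn_closedCube_of_bounded {f : EuclideanSpace ℝ (Fin n) → ℝ}
    (hf : AEMeasurable f volume) {C : ℝ} (hC : ∀ x, |f x| ≤ C)
    (z : EuclideanSpace ℝ (Fin n)) {l : ℝ} (hl : 0 < l) :
    IntegrableOn f (closedCube z l) volume := by
  refine Measure.integrableOn_of_bounded (M := C) (volume_closedCube_lt_top z hl).ne
    hf.aestronglyMeasurable ?_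
  exact Filter.Eventually.of_forall fun x => by simpa using hC x

theorem integrableOn_one_div_pointScale (z : EuclideanSpace ℝ (Fin n)) {l : ℝ} (hl : 0 < l) :
    IntegrableOn (fun x => 1 / pointScale x l) (closedCube z l) volume := by
  refine integrableOn_closedCube_of_bounded (f := fun x => 1 / pointScale x l)
    ((measurable_const.div (measurable_pointScale l)).aemeasurable) (C := 1) (fun x => ?_) z hl
  have hD := one_le_pointScale x hl
  rw [abs_of_nonneg (by positivity), div_le_one (by linarith)]; exact hD

/-- The pointwise scale ignores the size of a large cube, but its mean does not: with L the argument
of the logarithm in `cubeScale`, the points where the argument of `pointScale` is below √L fill only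
a small fraction of the cube. Elsewhere the logarithm is at least half of `cubeScale`. -/
theorem integral_inv_pointScale_le (hn : 0 < n) (z : EuclideanSpace ℝ (Fin n)) {l : ℝ}
    (hl : 0 < l) :
    ∫ x in closedCube z l, 1 / pointScale x l ≤
      (10 + 8 * n : ℝ) / cubeScale z l * l ^ n := by
  have hn1 : (1 : ℝ) ≤ n := by exact_mod_cast hn
  set L := Real.exp 1 + ‖z‖ + l + 1 / l with hLdef
  have hzn := norm_nonneg z
  have he : 2.7 < Real.exp 1 := by linarith [Real.exp_one_gt_d9]
  have he' : Real.exp 1 < 2.8 := by linarith [Real.exp_one_lt_d9]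
  have hil : 0 < 1 / l := by positivity
  have hL : 2.7 < L := by linarith
  have hsq : √L ^ 2 = L := Real.sq_sqrt (by linarith)
  have hs1 : 1 < √L := by
    rw [Real.lt_sqrt] <;> linarith
  have hΛ : cubeScale z l = Real.log L := rfl
  have hΛ1 := one_le_cubeScale z hl
  have hΛ2 : cubeScale z l = 2 * Real.log (√L) := by
    rw [hΛ, Real.log_sqrt (by linarith)]; ring
  have hΛ3 : cubeScale z l ≤ 2 * √L := by
    rw [hΛ2]; linarith [Real.log_le_sub_one_of_pos (show 0 < √L by linarith)]
  set S := {x ∈ closedCube z l | Real.exp 1 + ‖x‖ + 1 / l < √L} with hS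
  have hSm : MeasurableSet S :=
    (measurableSet_closedCube z l).inter
      (measurableSet_lt (f := fun x : EuclideanSpace ℝ (Fin n) => Real.exp 1 + ‖x‖ + 1 / l)
        (by fun_prop) measurable_const)
  have hpt : ∀ x ∈ closedCube z l, 1 / pointScale x l ≤
      2 / cubeScale z l + S.indicator (fun _ => (1 : ℝ)) x := by
    intro x hx
    have hD := one_le_pointScale x hl
    by_cases hxS : Real.exp 1 + ‖x‖ + 1 / l < √L
    · rw [Set.indicator_of_mem (show x ∈ S from ⟨hx, hxS⟩)]
      have : 1 / pointScale x l ≤ 1 := by rw [div_le_one (by linarith)]; exact hD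
      have : 0 ≤ 2 / cubeScale z l := by positivity
      linarith
    · rw [Set.indicator_of_notMem (fun h => hxS h.2), add_zero,
        div_le_div_iff₀ (by linarith) (by linarith), hΛ2]
      have : Real.log √L ≤ pointScale x l := Real.log_le_log (by linarith) (not_lt.1 hxS)
      linarith
  have hvol : volume.real S ≤ (8 + 8 * n : ℝ) / cubeScale z l * l ^ n := by
    have hle : volume.real S ≤ l ^ n := by
      rw [← measureReal_closedCube z hl]
      exact measureReal_mono (fun x hx => hx.1) (volume_closedCube_lt_top z hl).ne
    by_cases hbig : cubeScale z l ≤ 8 + 8 * n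
    · refine hle.trans (le_mul_of_one_le_left (by positivity) ?_)
      rwa [one_le_div (by linarith)]
    push Not at hbig
    -- A single point of S makes |z| at most √L + n l, hence l comparable to L; as S lies in a cube
    -- of length 2√L about the origin, its fraction is O(1/√L), which beats 1/log L.
    rcases S.eq_empty_or_nonempty with h0 | ⟨y, hy1, hy2⟩
    · rw [h0]; simp; positivity
    have hyn := norm_nonneg y
    have hd := norm_sub_le_of_mem_closedCube hl hy1
    have hz : ‖z‖ ≤ ‖y‖ + ‖y - z‖ := by
      rw [norm_sub_rev]; exact norm_le_insert' z y
    have hsL : 4 + 4 * n < √L := by linarith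
    have hl1 : L ≤ 2 * (1 + n) * l := by nlinarith
    have hl2 : 2 * √L ≤ l := by
      have : 2 * (1 + n) * (2 * √L) ≤ 2 * (1 + n) * l := by nlinarith
      nlinarith
    have hsub : S ⊆ closedCube 0 (2 * √L) := fun x hx =>
      mem_closedCube_zero_of_norm_le (by have := hx.2; linarith)
    have h1 : volume.real S ≤ (2 * √L) ^ n := by
      rw [← measureReal_closedCube (0 : EuclideanSpace ℝ (Fin n)) (show 0 < 2 * √L by linarith)]
      exact measureReal_mono hsub (volume_closedCube_lt_top _ (by linarith)).ne
    have h2 : (2 * √L) ^ n ≤ 2 * √L / l * l ^ n := by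
      obtain ⟨k, rfl⟩ := Nat.exists_eq_succ_of_ne_zero hn.ne'
      rw [pow_succ, pow_succ]
      have : 2 * √L / l * (l ^ k * l) = l ^ k * (2 * √L) := by field_simp
      rw [this]
      have := pow_le_pow_left₀ (by linarith) hl2 k
      nlinarith
    refine (h1.trans h2).trans ?_
    gcongr ?_ * _
    rw [div_le_div_iff₀ hl (by linarith)]
    nlinarith
  have hint1 := integrableOn_one_div_pointScale z hl
  have hfin := volume_closedCube_lt_top z hl
  have hint2 : IntegrableOn (S.indicator (fun _ => (1 : ℝ))) (closedCube z l) volume :=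
    (integrableOn_const hfin.ne).indicator hSm
  have hint3 : IntegrableOn (fun _ : EuclideanSpace ℝ (Fin n) => 2 / cubeScale z l)
    (closedCube z l) volume := integrableOn_const hfin.ne
  calc ∫ x in closedCube z l, 1 / pointScale x l
      ≤ ∫ x in closedCube z l, (2 / cubeScale z l + S.indicator (fun _ => (1 : ℝ)) x) :=
        setIntegral_mono_on hint1 (hint3.add hint2) (measurableSet_closedCube z l) hpt
    _ = 2 / cubeScale z l * l ^ n + volume.real S := by
        rw [integral_add hint3 hint2, setIntegral_const, measureReal_closedCube z hl,
          setIntegral_indicator hSm, setIntegral_const,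
          Set.inter_eq_right.2 (fun x hx => hx.1)]
        simp [mul_comm]
    _ ≤ _ := by
        have : (10 + 8 * n : ℝ) / cubeScale z l * l ^ n =
          2 / cubeScale z l * l ^ n + (8 + 8 * n : ℝ) / cubeScale z l * l ^ n := by ring
        linarith

theorem LHExponent.integrableOn (h : LHExponent a b pInf C₀ CInf p)
    (z : EuclideanSpace ℝ (Fin n)) {l : ℝ} (hl : 0 < l) :
    IntegrableOn p (closedCube z l) volume :=
  integrableOn_closedCube_of_bounded h.meas.aemeasurable (C := b)
    (fun x => by rw [abs_of_pos (h.a_pos.trans_le (h.a_le x))]; exact h.le_b x) z hl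

theorem LHExponent.integral_abs_sub_refExp_le (h : LHExponent a b pInf C₀ CInf p) (hn : 0 < n)
    (z : EuclideanSpace ℝ (Fin n)) {l : ℝ} (hl : 0 < l) :
    ∫ x in closedCube z l, |p x - refExp p pInf z l| ≤
      oscConst n b C₀ CInf * (10 + 8 * n : ℝ) / cubeScale z l * l ^ n := by
  have hint1 := integrableOn_one_div_pointScale z hl
  calc ∫ x in closedCube z l, |p x - refExp p pInf z l|
      ≤ ∫ x in closedCube z l, oscConst n b C₀ CInf * (1 / pointScale x l) := by
        refine setIntegral_mono_on ?_ (hint1.const_mul _) (measurableSet_closedCube z l) ?_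
        · exact ((h.integrableOn z hl).sub
            (integrableOn_const (volume_closedCube_lt_top z hl).ne)).abs
        · intro x hx
          rw [mul_one_div, le_div_iff₀ (by linarith [one_le_pointScale x hl])]
          exact h.abs_sub_refExp_mul_le hn hl hx
    _ = oscConst n b C₀ CInf * ∫ x in closedCube z l, 1 / pointScale x l := integral_const_mul _ _
    _ ≤ oscConst n b C₀ CInf * ((10 + 8 * n : ℝ) / cubeScale z l * l ^ n) := by
        gcongr
        · exact h.oscConst_pos.le
        · exact integral_inv_pointScale_le hn z hl
    _ = _ := by ring

end LHExponent

/-! ### Exchanging the variable exponent for its reference value. -/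

/-- If |τ| ≤ mD, the exchange costs exp(|P - q| |τ|) ≤ exp(mc). If τ > mD, the left side is itself
below the tail. Only a lower bound for τ is needed, and P and q may swap roles. -/
theorem exp_neg_mul_le_of_abs_sub_mul_le {a c m D P q τ : ℝ} (ha : 0 < a) (hm : 0 ≤ m)
    (hD : 0 ≤ D) (hq : a ≤ q) (h : |P - q| * D ≤ c) (hτ : -(m * D) ≤ τ) :
    Real.exp (-(q * τ)) ≤ Real.exp (m * c) * Real.exp (-(P * τ)) + Real.exp (-(m * a * D)) := by
  rcases le_total τ (m * D) with h1 | h1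
  · have h2 : |τ| ≤ m * D := abs_le.2 ⟨hτ, h1⟩
    have h3 : (P - q) * τ ≤ m * c := by
      calc (P - q) * τ ≤ |P - q| * |τ| := by rw [← abs_mul]; exact le_abs_self _
        _ ≤ |P - q| * (m * D) := by gcongr
        _ = m * (|P - q| * D) := by ring
        _ ≤ m * c := by gcongr
    rw [← Real.exp_add]
    have : Real.exp (-(q * τ)) ≤ Real.exp (m * c + -(P * τ)) := Real.exp_le_exp.2 (by linarith)
    linarith [Real.exp_pos (-(m * a * D))]
  · have : Real.exp (-(q * τ)) ≤ Real.exp (-(m * a * D)) := by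
      refine Real.exp_le_exp.2 (neg_le_neg ?_)
      have h0 : 0 ≤ m * D := by positivity
      nlinarith
    have h0 : 0 ≤ Real.exp (m * c) * Real.exp (-(P * τ)) := by positivity
    linarith

section Modular

variable {a b pInf C₀ CInf : ℝ} {p : EuclideanSpace ℝ (Fin n) → ℝ}

theorem exp_neg_mul_pointScale_le {r : ℝ} (hr : 0 ≤ r) (x : EuclideanSpace ℝ (Fin n)) {l : ℝ}
    (hl : 0 < l) :
    Real.exp (-(r * pointScale x l)) ≤ Real.exp (-(r * Real.log (Real.exp 1 + ‖x‖))) := by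
  refine Real.exp_le_exp.2 (neg_le_neg (mul_le_mul_of_nonneg_left ?_ hr))
  refine Real.log_le_log (by positivity) ?_
  have : 0 < 1 / l := by positivity
  linarith

/-- The exchange is integrated against a general measure: Lebesgue measure gives the norm of an
indicator, and the density `exp (p f)` gives the mass of the weight. -/
theorem LHExponent.exp_refExp_mul_measure_le (h : LHExponent a b pInf C₀ CInf p) (hn : 0 < n)
    (μ : Measure (EuclideanSpace ℝ (Fin n))) {m τ : ℝ} {M : ℝ≥0∞} (hm : 0 ≤ m)
    (hM : ∫⁻ x, ENNReal.ofReal (Real.exp (-(m * a * Real.log (Real.exp 1 + ‖x‖)))) ∂μ ≤ M)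
    {z : EuclideanSpace ℝ (Fin n)} {l : ℝ} (hl : 0 < l)
    (hτ : ∀ x ∈ closedCube z l, -(m * pointScale x l) ≤ τ) :
    ENNReal.ofReal (Real.exp (-(refExp p pInf z l * τ))) * μ (closedCube z l) ≤
      ENNReal.ofReal (Real.exp (m * oscConst n b C₀ CInf)) *
        ∫⁻ x in closedCube z l, ENNReal.ofReal (Real.exp (-(p x * τ))) ∂μ + M := by
  have hmeas : Measurable fun x => ENNReal.ofReal (Real.exp (-(p x * τ))) :=
    (Real.measurable_exp.comp (h.meas.mul_const τ).neg).ennreal_ofReal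
  calc _ = ∫⁻ x in closedCube z l,
        ENNReal.ofReal (Real.exp (-(refExp p pInf z l * τ))) ∂μ := by
        rw [setLIntegral_const]
    _ ≤ ∫⁻ x in closedCube z l, (ENNReal.ofReal (Real.exp (m * oscConst n b C₀ CInf)) *
          ENNReal.ofReal (Real.exp (-(p x * τ))) +
          ENNReal.ofReal (Real.exp (-(m * a * Real.log (Real.exp 1 + ‖x‖))))) ∂μ := by
        refine setLIntegral_mono' (measurableSet_closedCube z l) fun x hx => ?_
        rw [← ENNReal.ofReal_mul (Real.exp_pos _).le,
          ← ENNReal.ofReal_add (by positivity) (by positivity)]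
        refine ENNReal.ofReal_le_ofReal ?_
        have hD := one_le_pointScale x hl
        refine (exp_neg_mul_le_of_abs_sub_mul_le h.a_pos hm (by linarith) (h.a_le_refExp z l)
          (h.abs_sub_refExp_mul_le hn hl hx) (hτ x hx)).trans ?_
        linarith [exp_neg_mul_pointScale_le (mul_nonneg hm h.a_pos.le) x hl]
    _ ≤ _ := by
        rw [lintegral_add_left (hmeas.const_mul _), lintegral_const_mul _ hmeas]
        gcongr
        exact (setLIntegral_le_lintegral _ _).trans hM

theorem LHExponent.lintegral_exp_neg_le (h : LHExponent a b pInf C₀ CInf p) (hn : 0 < n)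
    (μ : Measure (EuclideanSpace ℝ (Fin n))) {m τ : ℝ} {M : ℝ≥0∞} (hm : 0 ≤ m)
    (hM : ∫⁻ x, ENNReal.ofReal (Real.exp (-(m * a * Real.log (Real.exp 1 + ‖x‖)))) ∂μ ≤ M)
    {z : EuclideanSpace ℝ (Fin n)} {l : ℝ} (hl : 0 < l)
    (hτ : ∀ x ∈ closedCube z l, -(m * pointScale x l) ≤ τ) :
    ∫⁻ x in closedCube z l, ENNReal.ofReal (Real.exp (-(p x * τ))) ∂μ ≤
      ENNReal.ofReal (Real.exp (m * oscConst n b C₀ CInf)) *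
        (ENNReal.ofReal (Real.exp (-(refExp p pInf z l * τ))) * μ (closedCube z l)) + M := by
  calc _ ≤ ∫⁻ x in closedCube z l, (ENNReal.ofReal (Real.exp (m * oscConst n b C₀ CInf)) *
          ENNReal.ofReal (Real.exp (-(refExp p pInf z l * τ))) +
          ENNReal.ofReal (Real.exp (-(m * a * Real.log (Real.exp 1 + ‖x‖))))) ∂μ := by
        refine setLIntegral_mono' (measurableSet_closedCube z l) fun x hx => ?_
        rw [← ENNReal.ofReal_mul (Real.exp_pos _).le,
          ← ENNReal.ofReal_add (by positivity) (by positivity)]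
        refine ENNReal.ofReal_le_ofReal ?_
        have hD := one_le_pointScale x hl
        refine (exp_neg_mul_le_of_abs_sub_mul_le h.a_pos hm (by linarith) (h.a_le x)
          (abs_sub_comm (p x) _ ▸ h.abs_sub_refExp_mul_le hn hl hx) (hτ x hx)).trans ?_
        linarith [exp_neg_mul_pointScale_le (mul_nonneg hm h.a_pos.le) x hl]
    _ ≤ _ := by
        rw [lintegral_add_left measurable_const, setLIntegral_const, mul_assoc]
        gcongr
        exact (setLIntegral_le_lintegral _ _).trans hM

end Modular

end VariableWeight

/-! ### Tails of measures of polynomial growth. -/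

namespace VariableWeight

variable {n : ℕ}

/-- The decay exponent that beats growth of order `B` along dyadic cubes. -/
noncomputable def tailExp (B : ℝ) : ℝ := (B + Real.log 2) / Real.log 2

theorem tailExp_pos {B : ℝ} (hB : 0 ≤ B) : 0 < tailExp B := by
  have := Real.log_pos one_lt_two
  unfold tailExp; positivity

theorem le_tailExp {B : ℝ} (hB : 0 ≤ B) : B ≤ tailExp B := by
  have := Real.log_pos one_lt_two
  unfold tailExp
  rw [le_div_iff₀ this]
  nlinarith [Real.log_two_lt_d9]

/-- The least j with |x| ≤ e 2^j works: minimality gives (j - 1) log 2 ≤ log(e + |x|). -/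
theorem exists_mem_dyadic_exp_le {B : ℝ} (hB : 0 ≤ B) (x : EuclideanSpace ℝ (Fin n)) :
    ∃ j : ℕ, x ∈ closedCube 0 (2 * Real.exp 1 * 2 ^ j) ∧
      Real.exp (-(tailExp B * Real.log (Real.exp 1 + ‖x‖))) ≤
        Real.exp ((B + Real.log 2) * (1 - j)) := by
  have hlog := Real.log_pos one_lt_two
  have he := Real.exp_pos 1
  have hex : ∃ j : ℕ, ‖x‖ ≤ Real.exp 1 * 2 ^ j := by
    obtain ⟨j, hj⟩ := pow_unbounded_of_one_lt (‖x‖ / Real.exp 1) one_lt_two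
    exact ⟨j, by rw [div_lt_iff₀ he] at hj; linarith⟩
  classical
  refine ⟨Nat.find hex, ?_, Real.exp_le_exp.2 ?_⟩
  · have := mem_closedCube_zero_of_norm_le (Nat.find_spec hex)
    rwa [mul_assoc]
  · have h1 : 1 ≤ Real.log (Real.exp 1 + ‖x‖) :=
      one_le_log_of_exp_le (by linarith [norm_nonneg x])
    have h2 : ((Nat.find hex : ℕ) : ℝ) - 1 ≤ Real.log (Real.exp 1 + ‖x‖) / Real.log 2 := by
      rw [le_div_iff₀ hlog]
      rcases hk : Nat.find hex with _ | k
      · simp; nlinarith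
      · have h3 := Nat.find_min hex (m := k) (by omega)
        push Not at h3
        have h4 : (2 : ℝ) ^ k ≤ Real.exp 1 + ‖x‖ := by
          have : (1 : ℝ) ≤ Real.exp 1 := Real.one_le_exp (by norm_num)
          have h5 : (0 : ℝ) < 2 ^ k := by positivity
          nlinarith
        have h5 := Real.log_le_log (by positivity) h4
        rw [Real.log_pow] at h5
        push_cast
        linarith
    have h3 : tailExp B * Real.log (Real.exp 1 + ‖x‖) =
      (B + Real.log 2) * (Real.log (Real.exp 1 + ‖x‖) / Real.log 2) := by
        unfold tailExp; ring
    rw [h3]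
    nlinarith

/-- The surplus log 2 in `tailExp` leaves a geometric series: exp((B + log 2)(1 - j)) exp(B(j + 1))
= 2 exp(2B) 2^(-j). -/
theorem lintegral_exp_neg_tailExp_le (μ : Measure (EuclideanSpace ℝ (Fin n))) {B : ℝ}
    (hB : 0 ≤ B)
    (hμ : ∀ j : ℕ, μ (closedCube 0 (2 * Real.exp 1 * 2 ^ j)) ≤
      ENNReal.ofReal (Real.exp (B * (j + 1)))) :
    ∫⁻ x, ENNReal.ofReal (Real.exp (-(tailExp B * Real.log (Real.exp 1 + ‖x‖)))) ∂μ ≤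
      ENNReal.ofReal (4 * Real.exp (2 * B)) := by
  set Q : ℕ → Set (EuclideanSpace ℝ (Fin n)) := fun j => closedCube 0 (2 * Real.exp 1 * 2 ^ j)
  have hQ : ∀ j, MeasurableSet (Q j) := fun j => measurableSet_closedCube _ _
  set c : ℕ → ℝ≥0∞ := fun j => ENNReal.ofReal (Real.exp ((B + Real.log 2) * (1 - j)))
  calc _ ≤ ∫⁻ x, ∑' j, (Q j).indicator (fun _ => c j) x ∂μ := by
        refine lintegral_mono fun x => ?_
        obtain ⟨j, hj1, hj2⟩ := exists_mem_dyadic_exp_le hB x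
        refine le_trans ?_ (ENNReal.le_tsum j)
        rw [Set.indicator_of_mem (show x ∈ Q j from hj1)]
        exact ENNReal.ofReal_le_ofReal hj2
    _ = ∑' j, c j * μ (Q j) := by
        rw [lintegral_tsum fun j => (measurable_const.indicator (hQ j)).aemeasurable]
        refine tsum_congr fun j => ?_
        rw [lintegral_indicator_const (hQ j)]
    _ ≤ ∑' j : ℕ, ENNReal.ofReal (2 * Real.exp (2 * B) * (1 / 2) ^ j) := by
        refine ENNReal.tsum_le_tsum fun j => ?_
        refine (mul_le_mul_right (hμ j) _).trans (le_of_eq ?_)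
        rw [← ENNReal.ofReal_mul (Real.exp_pos _).le, ← Real.exp_add]
        congr 1
        have h1 : (1 / 2 : ℝ) ^ j = Real.exp (-(j * Real.log 2)) := by
          rw [Real.exp_neg, mul_comm, Real.exp_mul, Real.exp_log two_pos]
          simp
        rw [h1, show 2 * Real.exp (2 * B) = Real.exp (Real.log 2 + 2 * B) by
          rw [Real.exp_add, Real.exp_log two_pos], ← Real.exp_add]
        congr 1
        ring
    _ = _ := by
        rw [← ENNReal.ofReal_tsum_of_nonneg (fun j => by positivity)
          (summable_geometric_two.mul_left _), tsum_mul_left, tsum_geometric_two]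
        congr 1; ring

/-! ### Doubling and logarithmic growth of cube functionals. -/

/-- The integral over E is at least minus the integral over Q of the negative part, which equals
that of the positive part minus the integral of g. -/
theorem le_setIntegral_of_subset {g : EuclideanSpace ℝ (Fin n) → ℝ}
    {E Q : Set (EuclideanSpace ℝ (Fin n))} {u v : ℝ} (hg : IntegrableOn g Q volume)
    (hEQ : E ⊆ Q) (h1 : -u ≤ ∫ x in Q, g x) (h2 : ∫ x in Q, max (g x) 0 ≤ v) :
    -(u + v) ≤ ∫ x in E, g x := by
  have hp : IntegrableOn (fun x => max (g x) 0) Q volume := Integrable.pos_part hg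
  have hm : IntegrableOn (fun x => max (-g x) 0) Q volume := Integrable.neg_part hg
  have h3 : ∫ x in Q, max (-g x) 0 = (∫ x in Q, max (g x) 0) - ∫ x in Q, g x := by
    rw [← integral_sub hp hg]
    congr 1; ext x
    rcases le_total (g x) 0 with h | h
    · rw [max_eq_left (by linarith), max_eq_right h]; ring
    · rw [max_eq_right (by linarith), max_eq_left h]; ring
  have h4 : ∫ x in E, max (-g x) 0 ≤ ∫ x in Q, max (-g x) 0 :=
    setIntegral_mono_set hm (Filter.Eventually.of_forall fun x => le_max_right _ _)
      hEQ.eventuallyLE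
  have h5 : -∫ x in E, max (-g x) 0 ≤ ∫ x in E, g x := by
    rw [← integral_neg]
    refine integral_mono (hm.mono_set hEQ).neg (hg.mono_set hEQ) fun x => ?_
    have := le_max_left (-g x) 0
    linarith
  linarith

/-- Data on cubes: the averages of `h` differ from `τ - σ` by at most `κ` from below, the positive
part of the difference is bounded in mean by `C`, `τ` is monotone and normalised on `Q₀`. -/
structure CubeData (S C κ : ℝ) (h : EuclideanSpace ℝ (Fin n) → ℝ)
    (τ σ : EuclideanSpace ℝ (Fin n) → ℝ → ℝ) : Prop where
  integrableOn : ∀ z l, 0 < l → IntegrableOn h (closedCube z l) volume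
  lower : ∀ z l, 0 < l → -(κ * l ^ n) ≤ ∫ x in closedCube z l, (h x - (τ z l - σ z l))
  upper : ∀ z l, 0 < l → ∫ x in closedCube z l, max (h x - (τ z l - σ z l)) 0 ≤ C * l ^ n
  mono : ∀ z l y r, 0 < l → 0 < r → closedCube z l ⊆ closedCube y r → τ z l ≤ τ y r
  norm : τ 0 (2 * Real.exp 1) = 0
  scale : ∀ z l, 0 < l → ∀ k : ℕ,
    σ z (2 ^ k * l) - σ z l ≤ S * (1 + k + Real.log (Real.exp 1 + 1 / l))
  S_nonneg : 0 ≤ S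
  C_nonneg : 0 ≤ C
  κ_nonneg : 0 ≤ κ

/-- The growth rate of the normalised `τ`. -/
noncomputable def growthConst (n : ℕ) (S C : ℝ) : ℝ :=
  S * (6 + (5 + 2 * Real.log (3 + 2 * n))) +
    (3 + (5 + 2 * Real.log (3 + 2 * n))) * (C + 2 ^ n * (1 + C))

theorem growthConst_nonneg {S C : ℝ} (hS : 0 ≤ S) (hC : 0 ≤ C) : 0 ≤ growthConst n S C := by
  have hlog3 : 0 ≤ Real.log (3 + 2 * n) :=
    Real.log_nonneg (by have : (0 : ℝ) ≤ n := n.cast_nonneg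
                        linarith)
  unfold growthConst
  positivity

namespace CubeData

variable {S C κ : ℝ} {h : EuclideanSpace ℝ (Fin n) → ℝ} {τ σ : EuclideanSpace ℝ (Fin n) → ℝ → ℝ}

theorem integrableOn_sub (H : CubeData S C κ h τ σ) (z : EuclideanSpace ℝ (Fin n)) {l : ℝ}
    (hl : 0 < l) (c : ℝ) : IntegrableOn (fun x => h x - c) (closedCube z l) volume :=
  (H.integrableOn z l hl).sub (integrableOn_const (volume_closedCube_lt_top z hl).ne)

/-- On the small cube, h is at most τ - σ + C in mean. It cannot lie far below the value belonging
to the double cube, because the negative part there is integrable with bound κ + C; the factor 2^n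
is the ratio of volumes. -/
theorem doubling (H : CubeData S C κ h τ σ) (z : EuclideanSpace ℝ (Fin n)) {l : ℝ}
    (hl : 0 < l) :
    τ z (2 * l) - σ z (2 * l) - (C + 2 ^ n * (κ + C)) ≤ τ z l - σ z l := by
  have hsub : closedCube z l ⊆ closedCube z (2 * l) :=
    closedCube_subset_closedCube (by simp; linarith)
  have h2l : 0 < 2 * l := by positivity
  set β := τ z l - σ z l
  set β' := τ z (2 * l) - σ z (2 * l)
  have h1 := le_setIntegral_of_subset (H.integrableOn_sub z h2l β') hsub
    (H.lower z _ h2l) (H.upper z _ h2l)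
  have h2 : ∫ x in closedCube z l, (h x - β) ≤ C * l ^ n := by
    refine le_trans ?_ (H.upper z l hl)
    exact integral_mono (H.integrableOn_sub z hl β) (Integrable.pos_part (H.integrableOn_sub z hl β))
      fun x => le_max_left _ _
  have h3 : ∫ x in closedCube z l, (h x - β') =
      (∫ x in closedCube z l, (h x - β)) + (β - β') * l ^ n := by
    have : (fun x => h x - β') = fun x => (h x - β) + (β - β') := by ext x; ring
    rw [this, integral_add (H.integrableOn_sub z hl β)
      (integrableOn_const (volume_closedCube_lt_top z hl).ne), setIntegral_const,
      measureReal_closedCube z hl, smul_eq_mul]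
    ring
  have hln : 0 < l ^ n := by positivity
  rw [mul_pow] at h1
  have h4 : -((C + 2 ^ n * (κ + C)) * l ^ n) ≤ (β - β') * l ^ n := by
    nlinarith
  have h5 : -(C + 2 ^ n * (κ + C)) ≤ β - β' := by
    rw [← neg_mul] at h4
    exact le_of_mul_le_mul_right h4 hln
  linarith

theorem doubling_iterate (H : CubeData S C κ h τ σ) (z : EuclideanSpace ℝ (Fin n)) {l : ℝ}
    (hl : 0 < l) (k : ℕ) :
    τ z (2 ^ k * l) - σ z (2 ^ k * l) - k * (C + 2 ^ n * (κ + C)) ≤ τ z l - σ z l := by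
  induction k with
  | zero => simp
  | succ k ih =>
    have := H.doubling z (show 0 < 2 ^ k * l by positivity)
    rw [← mul_assoc, ← pow_succ'] at this
    push_cast
    linarith

/-- Keeping the dependence on κ linear is what later yields powers of the weight constants. -/
theorem doubling_const_le (H : CubeData S C κ h τ σ) :
    C + 2 ^ n * (κ + C) ≤ (C + 2 ^ n * (1 + C)) * (1 + κ) := by
  have h1 := H.C_nonneg
  have h2 := H.κ_nonneg
  have h3 : (0 : ℝ) < 2 ^ n := by positivity
  nlinarith [mul_nonneg h1 h2, mul_nonneg h3.le (mul_nonneg h1 h2)]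

/-- Doubling the cube until it contains `Q₀` reaches a cube where τ ≥ 0 by monotonicity; each
doubling costs a constant, and their number is controlled by the scale at any point of the cube. -/
theorem lower_growth (H : CubeData S C κ h τ σ) {z x : EuclideanSpace ℝ (Fin n)} {l : ℝ}
    (hl : 0 < l) (hx : x ∈ closedCube z l) :
    -(growthConst n S C * (1 + κ) * pointScale x l) ≤ τ z l := by
  have he := Real.exp_pos 1
  have he1 : 1 ≤ Real.exp 1 := Real.one_le_exp (by norm_num)
  have hzn := norm_nonneg z
  have hxn := norm_nonneg x
  have hil : 0 < 1 / l := by positivity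
  have hD := one_le_pointScale x hl
  obtain ⟨j, hj1, hj2⟩ := exists_nat_pow_near
    (show 1 ≤ 1 + 2 * (‖z‖ + Real.exp 1) / l by
      have : 0 ≤ 2 * (‖z‖ + Real.exp 1) / l := by positivity
      linarith) one_lt_two
  have hsub : closedCube 0 (2 * Real.exp 1) ⊆ closedCube z (2 ^ (j + 1) * l) := by
    refine closedCube_subset_closedCube ?_
    have : 2 * (‖z‖ + Real.exp 1) / l < 2 ^ (j + 1) := by linarith
    rw [div_lt_iff₀ hl] at this
    simp; linarith
  have hτ := H.mono 0 _ z _ (by positivity) (by positivity) hsub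
  rw [H.norm] at hτ
  have h1 := H.doubling_iterate z hl (j + 1)
  have h2 := H.scale z l hl (j + 1)
  have hlog3 : 0 ≤ Real.log (3 + 2 * n) :=
    Real.log_nonneg (by have : (0 : ℝ) ≤ n := n.cast_nonneg
                        linarith)
  -- Since |z| ≤ |x| + n l, the ratio |z|/l contributes only n beyond |x|/l, so no growth in l
  -- appears. This is why the bound holds with the scale at each x, as the exchange of exponents
  -- requires.
  have hk : ((j + 1 : ℕ) : ℝ) ≤ (5 + 2 * Real.log (3 + 2 * n)) * pointScale x l := by
    set v := Real.exp 1 + ‖x‖ + 1 / l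
    have hv : Real.exp 1 ≤ v := by linarith
    have hz : ‖z‖ ≤ ‖x‖ + n * l := by
      have := norm_sub_le_of_mem_closedCube hl hx
      have h3 := norm_le_insert' z x
      rw [norm_sub_rev] at h3
      linarith
    have h4 : 1 + 2 * (‖z‖ + Real.exp 1) / l ≤ (3 + 2 * n) * v ^ 2 := by
      have h5 : 2 * (‖z‖ + Real.exp 1) / l ≤ 2 * n + 2 * v ^ 2 := by
        rw [div_le_iff₀ hl]
        have h6 : (‖x‖ + Real.exp 1) ≤ v ^ 2 * l := by
          have : v ^ 2 * l = v * (v * l) := by ring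
          rw [this]
          have : 1 ≤ v * l := by
            have : 1 / l ≤ v := by linarith
            rwa [div_le_iff₀ hl] at this
          nlinarith
        nlinarith
      have h7 : 1 ≤ v ^ 2 := by nlinarith
      have : (0 : ℝ) ≤ n := n.cast_nonneg
      nlinarith
    have h5 := Real.log_le_log (by positivity) (hj1.trans h4)
    rw [Real.log_pow, Real.log_mul (by positivity) (by positivity), Real.log_pow] at h5
    have h6 : pointScale x l = Real.log v := rfl
    have h7 : (1 / 2 : ℝ) ≤ Real.log 2 := by linarith [Real.log_two_gt_d9]
    push_cast at h5 ⊢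
    have h8 : (0 : ℝ) ≤ j := j.cast_nonneg
    rw [h6] at hD ⊢
    nlinarith
  have hlog : Real.log (Real.exp 1 + 1 / l) ≤ pointScale x l :=
    Real.log_le_log (by positivity) (by linarith)
  have hΓ := H.doubling_const_le
  have hS := H.S_nonneg
  have hC := H.C_nonneg
  have hκ := H.κ_nonneg
  set k : ℝ := ((j + 1 : ℕ) : ℝ)
  set c := 5 + 2 * Real.log (3 + 2 * n) with hc
  have hc5 : 5 ≤ c := by linarith
  set Γ := C + 2 ^ n * (1 + C)
  have hΓ0 : 0 ≤ Γ := by positivity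
  have hk0 : 0 ≤ k := by positivity
  have h3 : S * (1 + k + Real.log (Real.exp 1 + 1 / l)) ≤ S * (2 + c) * pointScale x l := by
    rw [mul_assoc]
    gcongr
    linarith
  have h4 : k * (C + 2 ^ n * (κ + C)) ≤ c * pointScale x l * (Γ * (1 + κ)) := by
    gcongr
  have h5 : S * (2 + c) * pointScale x l + c * pointScale x l * (Γ * (1 + κ)) ≤
      growthConst n S C * (1 + κ) * pointScale x l := by
    have : growthConst n S C = S * (6 + c) + (3 + c) * Γ := rfl
    rw [this]
    have : 0 ≤ pointScale x l := by linarith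
    have e1 : (S * (6 + c) + (3 + c) * Γ) * (1 + κ) * pointScale x l -
      (S * (2 + c) * pointScale x l + c * pointScale x l * (Γ * (1 + κ))) =
      (S * 4 + S * (6 + c) * κ + 3 * Γ * (1 + κ)) * pointScale x l := by ring
    have : 0 ≤ (S * 4 + S * (6 + c) * κ + 3 * Γ * (1 + κ)) * pointScale x l := by positivity
    linarith
  linarith

/-- Here it is `Q₀` that is doubled, until it contains the given cube. -/
theorem upper_growth (H : CubeData S C κ h τ σ) (z : EuclideanSpace ℝ (Fin n)) {l : ℝ}
    (hl : 0 < l) :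
    τ z l ≤ growthConst n S C * (1 + κ) * Real.log (Real.exp 1 + ‖z‖ + l) := by
  have he := Real.exp_pos 1
  have he1 : 1 ≤ Real.exp 1 := Real.one_le_exp (by norm_num)
  have hzn := norm_nonneg z
  set v := Real.exp 1 + ‖z‖ + l with hv
  have hD : 1 ≤ Real.log v := one_le_log_of_exp_le (by linarith)
  obtain ⟨j, hj1, hj2⟩ := exists_nat_pow_near
    (show 1 ≤ 1 + (‖z‖ + l) by linarith) one_lt_two
  have hsub : closedCube z l ⊆ closedCube 0 (2 ^ (j + 1) * (2 * Real.exp 1)) := by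
    refine closedCube_subset_closedCube ?_
    have h5 : (0 : ℝ) < 2 ^ (j + 1) := by positivity
    simp
    nlinarith
  have hτ := H.mono z l 0 _ hl (by positivity) hsub
  have h1 := H.doubling_iterate 0 (show 0 < 2 * Real.exp 1 by positivity) (j + 1)
  have h2 := H.scale 0 _ (show 0 < 2 * Real.exp 1 by positivity) (j + 1)
  rw [H.norm] at h1
  have hlog3 : 0 ≤ Real.log (3 + 2 * n) :=
    Real.log_nonneg (by have : (0 : ℝ) ≤ n := n.cast_nonneg
                        linarith)
  have hk : ((j + 1 : ℕ) : ℝ) ≤ 3 * Real.log v := by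
    have h5 := Real.log_le_log (by positivity) (hj1.trans (show 1 + (‖z‖ + l) ≤ v by linarith))
    rw [Real.log_pow] at h5
    have h7 : (1 / 2 : ℝ) ≤ Real.log 2 := by linarith [Real.log_two_gt_d9]
    push_cast at h5 ⊢
    have h8 : (0 : ℝ) ≤ j := j.cast_nonneg
    nlinarith
  have hlog : Real.log (Real.exp 1 + 1 / (2 * Real.exp 1)) ≤ 2 * Real.log v := by
    have h3 : 1 / (2 * Real.exp 1) ≤ 1 := by
      rw [div_le_one (by positivity)]; linarith
    have h4 : Real.log (Real.exp 1 + 1 / (2 * Real.exp 1)) ≤ Real.log (Real.exp 1 * Real.exp 1) :=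
      Real.log_le_log (by positivity) (by nlinarith [Real.exp_one_gt_d9])
    rw [Real.log_mul he.ne' he.ne', Real.log_exp] at h4
    linarith
  have hΓ := H.doubling_const_le
  have hS := H.S_nonneg
  have hC := H.C_nonneg
  have hκ := H.κ_nonneg
  set k : ℝ := ((j + 1 : ℕ) : ℝ)
  set c := 5 + 2 * Real.log (3 + 2 * n) with hc
  have hc5 : 5 ≤ c := by linarith
  set Γ := C + 2 ^ n * (1 + C)
  have hΓ0 : 0 ≤ Γ := by positivity
  have hk0 : 0 ≤ k := by positivity
  have h3 : S * (1 + k + Real.log (Real.exp 1 + 1 / (2 * Real.exp 1))) ≤ S * 6 * Real.log v := by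
    rw [mul_assoc]
    gcongr
    linarith
  have h4 : k * (C + 2 ^ n * (κ + C)) ≤ 3 * Real.log v * (Γ * (1 + κ)) := by
    gcongr
  have h5 : S * 6 * Real.log v + 3 * Real.log v * (Γ * (1 + κ)) ≤
      growthConst n S C * (1 + κ) * Real.log v := by
    have : growthConst n S C = S * (6 + c) + (3 + c) * Γ := rfl
    rw [this]
    have : 0 ≤ Real.log v := by linarith
    have e1 : (S * (6 + c) + (3 + c) * Γ) * (1 + κ) * Real.log v -
      (S * 6 * Real.log v + 3 * Real.log v * (Γ * (1 + κ))) =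
      (S * c + S * (6 + c) * κ + c * Γ * (1 + κ)) * Real.log v := by ring
    have : 0 ≤ (S * c + S * (6 + c) * κ + c * Γ * (1 + κ)) * Real.log v := by positivity
    linarith
  linarith

theorem growthConst_nonneg (H : CubeData S C κ h τ σ) : 0 ≤ growthConst n S C :=
  VariableWeight.growthConst_nonneg H.S_nonneg H.C_nonneg

/-- On each cube `|τ|` is bounded by the scale of the cube. -/
theorem abs_le_cubeScale (H : CubeData S C κ h τ σ) (z : EuclideanSpace ℝ (Fin n)) {l : ℝ} (hl : 0 < l) :
    |τ z l| ≤ growthConst n S C * (1 + κ) * cubeScale z l := by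
  have hB : 0 ≤ growthConst n S C * (1 + κ) :=
    mul_nonneg H.growthConst_nonneg (by linarith [H.κ_nonneg])
  have hil : 0 < 1 / l := by positivity
  have hzn := norm_nonneg z
  have he := Real.exp_pos 1
  refine abs_le.2 ⟨?_, ?_⟩
  · refine le_trans (neg_le_neg ?_) (H.lower_growth hl (self_mem_closedCube z hl))
    exact mul_le_mul_of_nonneg_left (Real.log_le_log (by positivity) (by linarith)) hB
  · refine (H.upper_growth z hl).trans ?_
    exact mul_le_mul_of_nonneg_left (Real.log_le_log (by positivity) (by linarith)) hB

theorem upper_growth_dyadic (H : CubeData S C κ h τ σ) (j : ℕ) :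
    τ 0 (2 * Real.exp 1 * 2 ^ j) ≤ 4 * (growthConst n S C * (1 + κ)) * (j + 1) := by
  have hB : 0 ≤ growthConst n S C * (1 + κ) :=
    mul_nonneg H.growthConst_nonneg (by linarith [H.κ_nonneg])
  have he := Real.exp_pos 1
  refine (H.upper_growth 0 (by positivity)).trans ?_
  have h1 : Real.log (Real.exp 1 + ‖(0 : EuclideanSpace ℝ (Fin n))‖ + 2 * Real.exp 1 * 2 ^ j) ≤
      4 * (j + 1) := by
    rw [norm_zero, add_zero]
    have h2 : Real.exp 1 + 2 * Real.exp 1 * 2 ^ j ≤ Real.exp 1 * (2 ^ 2 * 2 ^ j) := by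
      have : (1 : ℝ) ≤ 2 ^ j := one_le_pow₀ one_le_two
      nlinarith
    refine (Real.log_le_log (by positivity) h2).trans ?_
    rw [Real.log_mul he.ne' (by positivity), Real.log_exp, ← pow_add, Real.log_pow]
    push_cast
    nlinarith [Real.log_two_lt_d9, Real.log_two_gt_d9, show (0 : ℝ) ≤ j from j.cast_nonneg]
  nlinarith

end CubeData

end VariableWeight

/-! ### Norms of indicators of cubes. -/

namespace VariableWeight

variable {n : ℕ}

/-- The modular of `exp (h - τ)` on the cube with centre `z` and length `l`. -/
noncomputable def cubeModular (p h : EuclideanSpace ℝ (Fin n) → ℝ)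
    (z : EuclideanSpace ℝ (Fin n)) (l τ : ℝ) : ℝ≥0∞ :=
  ∫⁻ x in closedCube z l, ENNReal.ofReal (Real.exp (p x * (h x - τ)))

/-- The constant of the comparison of Lebesgue modulars. -/
noncomputable def lebesgueModularConst (n : ℕ) (a b C₀ CInf : ℝ) : ℝ :=
  Real.exp (tailExp (2 * n) / a * oscConst n b C₀ CInf) + 4 * Real.exp (2 * (2 * n))

/-- The constant in `|q log ‖1_Q‖ - log |Q|| ≤ C`. -/
noncomputable def cubeNormConst (n : ℕ) (a b C₀ CInf : ℝ) : ℝ :=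
  b / a * Real.log (lebesgueModularConst n a b C₀ CInf)

/-- The constant of the mean oscillation of the exponent. -/
noncomputable def meanOscConst (n : ℕ) (b C₀ CInf : ℝ) : ℝ :=
  oscConst n b C₀ CInf * (10 + 8 * n : ℝ)

/-- The constant in `⨍_Q |p log ‖1_Q‖ - log |Q|| ≤ C`. -/
noncomputable def meanNormConst (n : ℕ) (a b C₀ CInf : ℝ) : ℝ :=
  (cubeNormConst n a b C₀ CInf + n) / a * meanOscConst n b C₀ CInf + cubeNormConst n a b C₀ CInf

variable {a b pInf C₀ CInf : ℝ} {p : EuclideanSpace ℝ (Fin n) → ℝ}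

theorem volume_dyadic_le (j : ℕ) :
    (volume : Measure (EuclideanSpace ℝ (Fin n))) (closedCube 0 (2 * Real.exp 1 * 2 ^ j)) ≤
      ENNReal.ofReal (Real.exp (2 * n * (j + 1))) := by
  rw [volume_closedCube _ (by positivity)]
  refine ENNReal.ofReal_le_ofReal ?_
  have h1 : 2 * Real.exp 1 * 2 ^ j ≤ Real.exp (2 * (j + 1)) := by
    have h2 : (2 : ℝ) ≤ Real.exp 1 := by linarith [Real.exp_one_gt_d9]
    have h3 : Real.exp (2 * (j + 1)) = Real.exp 1 * Real.exp 1 * Real.exp 1 ^ j * Real.exp 1 ^ j := by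
      rw [← Real.exp_nat_mul, ← Real.exp_add, ← Real.exp_add, ← Real.exp_add]
      congr 1; ring
    have h4 : (2 : ℝ) ^ j ≤ Real.exp 1 ^ j := by gcongr
    have h5 : (1 : ℝ) ≤ Real.exp 1 ^ j := one_le_pow₀ (by linarith)
    rw [h3]
    calc 2 * Real.exp 1 * 2 ^ j ≤ Real.exp 1 * Real.exp 1 * Real.exp 1 ^ j * 1 := by
          rw [mul_one]; gcongr
      _ ≤ _ := by gcongr
  calc (2 * Real.exp 1 * 2 ^ j) ^ n ≤ Real.exp (2 * (j + 1)) ^ n := by gcongr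
    _ = _ := by rw [← Real.exp_nat_mul]; congr 1; ring

theorem one_le_lebesgueModularConst : 1 ≤ lebesgueModularConst n a b C₀ CInf := by
  unfold lebesgueModularConst
  have : (1 : ℝ) ≤ Real.exp (2 * (2 * n)) := Real.one_le_exp (by positivity)
  linarith [Real.exp_pos (tailExp (2 * n) / a * oscConst n b C₀ CInf)]

theorem LHExponent.cubeNormConst_nonneg (h : LHExponent a b pInf C₀ CInf p) :
    0 ≤ cubeNormConst n a b C₀ CInf :=
  mul_nonneg (div_nonneg h.b_pos.le h.a_pos.le) (Real.log_nonneg one_le_lebesgueModularConst)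

theorem LHExponent.meanOscConst_nonneg (h : LHExponent a b pInf C₀ CInf p) :
    0 ≤ meanOscConst n b C₀ CInf :=
  mul_nonneg h.oscConst_pos.le (by positivity)

theorem LHExponent.meanNormConst_nonneg (h : LHExponent a b pInf C₀ CInf p) :
    0 ≤ meanNormConst n a b C₀ CInf := by
  have h1 := h.cubeNormConst_nonneg
  have h2 := h.meanOscConst_nonneg
  have h3 := h.a_pos
  unfold meanNormConst; positivity

theorem exp_mul_log_natCast {l : ℝ} (hl : 0 < l) : Real.exp (n * Real.log l) = l ^ n := by
  rw [Real.exp_nat_mul, Real.exp_log hl]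

/-- The norm of `1_Q` is |Q|^(1/q) up to a constant. The lower bound exchanges exponents at σ
itself; the upper bound does so at log |Q| / q and then uses how the modular decreases. -/
theorem LHExponent.abs_refExp_mul_sub_le (h : LHExponent a b pInf C₀ CInf p) (hn : 0 < n)
    {z : EuclideanSpace ℝ (Fin n)} {l σ : ℝ} (hl : 0 < l)
    (hσ : cubeModular p 0 z l σ = 1) :
    |refExp p pInf z l * σ - n * Real.log l| ≤ cubeNormConst n a b C₀ CInf := by
  have ha := h.a_pos
  have hb := h.b_pos
  have hn1 : (1 : ℝ) ≤ n := by exact_mod_cast hn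
  set q := refExp p pInf z l
  have hqa : a ≤ q := h.a_le_refExp z l
  have hqb : q ≤ b := h.refExp_le_b z l
  set M₁ := lebesgueModularConst n a b C₀ CInf with hM₁
  have hM1 : 1 ≤ M₁ := one_le_lebesgueModularConst
  have hlogM : 0 ≤ Real.log M₁ := Real.log_nonneg hM1
  have h2n : (0 : ℝ) ≤ 2 * n := by positivity
  set m := tailExp (2 * n) / a with hm
  have hm0 : 0 ≤ m := div_nonneg (tailExp_pos h2n).le ha.le
  have hma : m * a = tailExp (2 * n) := by rw [hm]; field_simp
  have hnm : n / a ≤ m := by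
    rw [hm]; gcongr; linarith [le_tailExp h2n]
  have hM := lintegral_exp_neg_tailExp_le (volume : Measure (EuclideanSpace ℝ (Fin n))) h2n
    volume_dyadic_le
  rw [← hma] at hM
  have hσ' : ∫⁻ x in closedCube z l, ENNReal.ofReal (Real.exp (-(p x * σ))) = 1 := by
    rw [← hσ]; unfold cubeModular
    simp
  have hDlog : ∀ x : EuclideanSpace ℝ (Fin n), -Real.log l ≤ pointScale x l := fun x => by
    rw [← Real.log_inv]
    refine Real.log_le_log (by positivity) ?_
    rw [inv_eq_one_div]
    linarith [norm_nonneg x, Real.exp_pos 1]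
  -- Either alternative gives the lower bound required for the exchange: a negative y is at least (n
  -- log l)/a, and -log l is at most the scale.
  have key : ∀ y, (0 ≤ y ∨ n * Real.log l ≤ a * y) → ∀ x ∈ closedCube z l,
      -(m * pointScale x l) ≤ y := by
    intro y hy x _
    have hD := one_le_pointScale x hl
    rcases hy with hy | hy
    · have : 0 ≤ m * pointScale x l := by positivity
      linarith
    · have h1 : n / a * pointScale x l ≤ m * pointScale x l := by gcongr
      have h2 : n / a * -Real.log l ≤ n / a * pointScale x l := by gcongr; exact hDlog x
      have h3 : n * Real.log l / a ≤ y := by rw [div_le_iff₀ ha]; linarith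
      have h4 : n / a * -Real.log l = -(n * Real.log l / a) := by ring
      linarith
  have hln : 0 < l ^ n := by positivity
  refine abs_le.2 ⟨?_, ?_⟩
  -- If σ ≤ 0, the modular is at least exp(-aσ)|Q|, and it equals 1.
  · have hσlow : 0 ≤ σ ∨ n * Real.log l ≤ a * σ := by
      rcases le_total 0 σ with h0 | h0
      · exact Or.inl h0
      · refine Or.inr ?_
        have h1 : ENNReal.ofReal (Real.exp (-(a * σ))) * ENNReal.ofReal (l ^ n) ≤ 1 := by
          rw [← hσ', ← volume_closedCube z hl, ← setLIntegral_const]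
          refine lintegral_mono fun x => ENNReal.ofReal_le_ofReal (Real.exp_le_exp.2 ?_)
          nlinarith [h.a_le x]
        rw [← ENNReal.ofReal_mul (Real.exp_pos _).le, ENNReal.ofReal_le_one,
          ← exp_mul_log_natCast hl, ← Real.exp_add, Real.exp_le_one_iff] at h1
        linarith
    have h1 := h.exp_refExp_mul_measure_le hn volume hm0 hM hl (key σ hσlow)
    rw [hσ', mul_one, volume_closedCube z hl, ← ENNReal.ofReal_mul (Real.exp_pos _).le,
      ← ENNReal.ofReal_add (by positivity) (by positivity),
      ENNReal.ofReal_le_ofReal_iff (by positivity), ← exp_mul_log_natCast hl, ← Real.exp_add] at h1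
    have h2 := Real.log_le_log (Real.exp_pos _) h1
    rw [Real.log_exp] at h2
    have h3 : Real.log M₁ ≤ cubeNormConst n a b C₀ CInf := by
      unfold cubeNormConst
      refine le_mul_of_one_le_left hlogM ?_
      rw [one_le_div ha]; linarith
    have h4 : -(q * σ) + n * Real.log l ≤ Real.log M₁ := h2
    linarith
  · by_contra! hcon
    -- At this value the modular is at most `M₁`. Exceeding it by more than (log M₁)/a would make
    -- the modular smaller than 1.
    set τ := n * Real.log l / q with hτ
    have hq0 : 0 < q := by linarith
    have hqτ : q * τ = n * Real.log l := by rw [hτ]; field_simp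
    have hτlow : 0 ≤ τ ∨ n * Real.log l ≤ a * τ := by
      rcases le_total 0 τ with h0 | h0
      · exact Or.inl h0
      · exact Or.inr (by nlinarith)
    have h1 := h.lintegral_exp_neg_le hn volume hm0 hM hl (key τ hτlow)
    have h5 : ENNReal.ofReal (Real.exp (-(refExp p pInf z l * τ))) * volume (closedCube z l) = 1 := by
      rw [volume_closedCube z hl, ← ENNReal.ofReal_mul (Real.exp_pos _).le,
        ← exp_mul_log_natCast hl, ← Real.exp_add, show refExp p pInf z l * τ = _ from hqτ]
      simp
    rw [h5, mul_one, ← ENNReal.ofReal_add (by positivity) (by positivity)] at h1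
    have h6 : b / a * Real.log M₁ < q * (σ - τ) := by
      have : b / a * Real.log M₁ = cubeNormConst n a b C₀ CInf := rfl
      rw [this]; linarith
    have h7 : Real.log M₁ < a * (σ - τ) := by
      have h8 : 0 < σ - τ := by
        by_contra! h9
        have : 0 ≤ b / a * Real.log M₁ := by positivity
        nlinarith
      have h9 : b / a * Real.log M₁ < b * (σ - τ) := by nlinarith
      rw [div_mul_eq_mul_div, div_lt_iff₀ ha] at h9
      nlinarith
    have hστ : 0 < σ - τ := by nlinarith
    have h8 : (1 : ℝ≥0∞) ≤ ENNReal.ofReal (Real.exp (-(a * (σ - τ)))) * ENNReal.ofReal M₁ := by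
      calc 1 = ∫⁻ x in closedCube z l, ENNReal.ofReal (Real.exp (-(p x * σ))) := hσ'.symm
        _ ≤ ∫⁻ x in closedCube z l, ENNReal.ofReal (Real.exp (-(a * (σ - τ)))) *
            ENNReal.ofReal (Real.exp (-(p x * τ))) := by
            refine lintegral_mono fun x => ?_
            rw [← ENNReal.ofReal_mul (Real.exp_pos _).le, ← Real.exp_add]
            refine ENNReal.ofReal_le_ofReal (Real.exp_le_exp.2 ?_)
            nlinarith [h.a_le x]
        _ ≤ _ := by
            rw [lintegral_const_mul' _ _ ENNReal.ofReal_ne_top]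
            gcongr
            exact h1
    rw [← ENNReal.ofReal_mul (Real.exp_pos _).le, ENNReal.one_le_ofReal,
      ← Real.exp_log (show 0 < M₁ by linarith), ← Real.exp_add, Real.one_le_exp_iff] at h8
    linarith

theorem abs_log_le_cubeScale (z : EuclideanSpace ℝ (Fin n)) {l : ℝ} (hl : 0 < l) :
    |Real.log l| ≤ cubeScale z l := by
  have hil : 0 < 1 / l := by positivity
  have hzn := norm_nonneg z
  have he := Real.exp_pos 1
  refine abs_le'.2 ⟨Real.log_le_log hl (by linarith), ?_⟩
  rw [← Real.log_inv, inv_eq_one_div]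
  exact Real.log_le_log hil (by linarith)

theorem LHExponent.abs_logNorm_le (h : LHExponent a b pInf C₀ CInf p) (hn : 0 < n)
    {z : EuclideanSpace ℝ (Fin n)} {l σ : ℝ} (hl : 0 < l)
    (hσ : cubeModular p 0 z l σ = 1) :
    |σ| ≤ (cubeNormConst n a b C₀ CInf + n) / a * cubeScale z l := by
  have h1 := h.abs_refExp_mul_sub_le hn hl hσ
  have h2 := abs_log_le_cubeScale z hl
  have h3 := one_le_cubeScale z hl
  have h4 := h.cubeNormConst_nonneg
  have ha := h.a_pos
  have hq := h.a_le_refExp z l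
  rw [div_mul_eq_mul_div, le_div_iff₀ ha]
  calc |σ| * a ≤ |σ| * refExp p pInf z l := by gcongr
    _ = |refExp p pInf z l * σ| := by rw [abs_mul, abs_of_pos (ha.trans_le hq), mul_comm]
    _ ≤ |refExp p pInf z l * σ - n * Real.log l| + |n * Real.log l| := by
        have := abs_add_le (refExp p pInf z l * σ - n * Real.log l) (n * Real.log l)
        simpa using this
    _ ≤ cubeNormConst n a b C₀ CInf * cubeScale z l + n * cubeScale z l := by
        refine add_le_add (h1.trans (le_mul_of_one_le_right h4 h3)) ?_
        rw [abs_mul, Nat.abs_cast]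
        gcongr
    _ = _ := by ring

/-- The growth of |σ| like `cubeScale` cancels the mean oscillation of p, which is O(1/`cubeScale`).
-/
theorem LHExponent.integral_abs_mul_logNorm_sub_le (h : LHExponent a b pInf C₀ CInf p)
    (hn : 0 < n) {z : EuclideanSpace ℝ (Fin n)} {l σ : ℝ} (hl : 0 < l)
    (hσ : cubeModular p 0 z l σ = 1) :
    ∫ x in closedCube z l, |p x * σ - n * Real.log l| ≤ meanNormConst n a b C₀ CInf * l ^ n := by
  have h1 := h.abs_refExp_mul_sub_le hn hl hσ
  have h2 := h.abs_logNorm_le hn hl hσ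
  have h3 := h.integral_abs_sub_refExp_le hn z hl
  have hΛ := one_le_cubeScale z hl
  have hfin := (volume_closedCube_lt_top z hl).ne
  have hint := h.integrableOn z hl
  have i1 : IntegrableOn (fun x => |p x - refExp p pInf z l| * |σ|) (closedCube z l) volume :=
    (hint.sub (integrableOn_const hfin)).abs.mul_const _
  have i2 : IntegrableOn (fun _ : EuclideanSpace ℝ (Fin n) => cubeNormConst n a b C₀ CInf)
    (closedCube z l) volume := integrableOn_const hfin
  calc _ ≤ ∫ x in closedCube z l,
        (|p x - refExp p pInf z l| * |σ| + cubeNormConst n a b C₀ CInf) := by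
        refine integral_mono ((hint.mul_const _).sub (integrableOn_const hfin)).abs (i1.add i2) ?_
        intro x
        dsimp only
        have : p x * σ - n * Real.log l = (p x - refExp p pInf z l) * σ +
          (refExp p pInf z l * σ - n * Real.log l) := by ring
        rw [this, ← abs_mul]
        exact (abs_add_le _ _).trans (by linarith)
    _ = (∫ x in closedCube z l, |p x - refExp p pInf z l|) * |σ| +
        cubeNormConst n a b C₀ CInf * l ^ n := by
        rw [integral_add i1 i2, integral_mul_const, setIntegral_const, measureReal_closedCube z hl,
          smul_eq_mul, mul_comm (l ^ n)]
    _ ≤ (meanOscConst n b C₀ CInf / cubeScale z l * l ^ n) *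
          ((cubeNormConst n a b C₀ CInf + n) / a * cubeScale z l) +
        cubeNormConst n a b C₀ CInf * l ^ n := by
        gcongr
        · have := h.meanOscConst_nonneg; positivity
        · exact h3
    _ = _ := by
        unfold meanNormConst
        have : cubeScale z l ≠ 0 := by linarith
        field_simp

/-- If l ≥ 1, both cubes have the reference exponent `pInf` and their logarithmic norms are
subtracted directly. If l < 1, the reference exponents may differ and the two norms are bounded
separately, at the cost of log(e + 1/l). -/
theorem LHExponent.logNorm_scale (h : LHExponent a b pInf C₀ CInf p) (hn : 0 < n)
    {z : EuclideanSpace ℝ (Fin n)} {l σ σ' : ℝ} (hl : 0 < l) (k : ℕ)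
    (hσ : cubeModular p 0 z l σ = 1) (hσ' : cubeModular p 0 z (2 ^ k * l) σ' = 1) :
    σ' - σ ≤ (2 * cubeNormConst n a b C₀ CInf + n) / a *
      (1 + k + Real.log (Real.exp 1 + 1 / l)) := by
  have h1 := abs_le.1 (h.abs_refExp_mul_sub_le hn hl hσ)
  have hl' : 0 < 2 ^ k * l := by positivity
  have h2 := abs_le.1 (h.abs_refExp_mul_sub_le hn hl' hσ')
  rw [Real.log_mul (by positivity) hl.ne', Real.log_pow] at h2
  have hs := h.cubeNormConst_nonneg
  set s := cubeNormConst n a b C₀ CInf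
  have ha := h.a_pos
  have hn1 : (1 : ℝ) ≤ n := by exact_mod_cast hn
  have hk : (0 : ℝ) ≤ k := k.cast_nonneg
  have hl2 : Real.log 2 ≤ 1 := by linarith [Real.log_two_lt_d9]
  have hl20 := Real.log_pos one_lt_two
  have hil : 0 < 1 / l := by positivity
  have hlog1 : 1 ≤ Real.log (Real.exp 1 + 1 / l) := one_le_log_of_exp_le (by linarith)
  have hlog2 : -Real.log l ≤ Real.log (Real.exp 1 + 1 / l) := by
    rw [← Real.log_inv, inv_eq_one_div]
    exact Real.log_le_log hil (by linarith [Real.exp_pos 1])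
  set D := Real.log (Real.exp 1 + 1 / l)
  have hkl : k * Real.log 2 ≤ k := by nlinarith
  have hnkl : n * (k * Real.log 2) ≤ n * k := by gcongr
  have hnD : n * (-Real.log l) ≤ n * D := by gcongr
  -- Lowering the coefficient from q to a is harmless for either sign of y because u ≥ 0.
  have gen : ∀ q y u : ℝ, a ≤ q → q * y ≤ u → 0 ≤ u → a * y ≤ u := by
    intro q y u hq hqy hu
    rcases le_total 0 y with h0 | h0
    · nlinarith
    · nlinarith
  rw [div_mul_eq_mul_div, le_div_iff₀ ha, mul_comm]
  by_cases hl1 : l < 1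
  · have hlneg : Real.log l ≤ 0 := Real.log_nonpos hl.le hl1.le
    have h3 := gen (refExp p pInf z l) (-σ) (s + n * D) (h.a_le_refExp z l) (by linarith)
      (by positivity)
    have h4 := gen (refExp p pInf z (2 ^ k * l)) σ' (s + n * k) (h.a_le_refExp _ _)
      (by nlinarith) (by positivity)
    nlinarith
  · have hl1' : ¬ 2 ^ k * l < 1 := by
      have : (1 : ℝ) ≤ 2 ^ k := one_le_pow₀ one_le_two
      push Not at hl1 ⊢
      nlinarith
    have e1 : refExp p pInf z l = pInf := by unfold refExp; rw [if_neg hl1]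
    have e2 : refExp p pInf z (2 ^ k * l) = pInf := by unfold refExp; rw [if_neg hl1']
    rw [e1] at h1
    rw [e2] at h2
    have h3 := gen pInf (σ' - σ) (2 * s + n * k) h.a_le_inf (by nlinarith) (by positivity)
    nlinarith

theorem integrableOn_exp_of_lintegral_ne_top {f : EuclideanSpace ℝ (Fin n) → ℝ}
    {E : Set (EuclideanSpace ℝ (Fin n))} (hf : AEMeasurable f volume)
    (hE : ∫⁻ x in E, ENNReal.ofReal (Real.exp (f x)) ≠ ∞) :
    IntegrableOn (fun x => Real.exp (f x)) E volume := by
  refine ⟨(Real.measurable_exp.comp_aemeasurable hf.restrict).aestronglyMeasurable, ?_⟩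
  rw [hasFiniteIntegral_iff_ofReal (Filter.Eventually.of_forall fun x => (Real.exp_pos _).le)]
  exact hE.lt_top

theorem setIntegral_exp_le {f : EuclideanSpace ℝ (Fin n) → ℝ}
    {E : Set (EuclideanSpace ℝ (Fin n))} {c : ℝ} (hc : 0 ≤ c) (hf : AEMeasurable f volume)
    (hE : ∫⁻ x in E, ENNReal.ofReal (Real.exp (f x)) ≤ ENNReal.ofReal c) :
    ∫ x in E, Real.exp (f x) ≤ c := by
  rw [integral_eq_lintegral_of_nonneg_ae (Filter.Eventually.of_forall fun x => (Real.exp_pos _).le)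
    (Real.measurable_exp.comp_aemeasurable hf.restrict).aestronglyMeasurable]
  exact ENNReal.toReal_le_of_le_ofReal hc hE

/-- Apply `y + 1 ≤ exp y` to p(f - τ) + n log l: the exponential integrates to at most |Q| because
the modular is at most 1. Replacing n log l by pσ costs a bounded mean, and division by p costs 1/a.
-/
theorem LHExponent.integral_posPart_le (h : LHExponent a b pInf C₀ CInf p) (hn : 0 < n)
    {f : EuclideanSpace ℝ (Fin n) → ℝ} (hf : AEMeasurable f volume)
    {z : EuclideanSpace ℝ (Fin n)} {l σ τ : ℝ} (hl : 0 < l)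
    (hfint : IntegrableOn f (closedCube z l) volume)
    (hσ : cubeModular p 0 z l σ = 1) (hτ : cubeModular p f z l τ ≤ 1) :
    ∫ x in closedCube z l, max (f x - (τ - σ)) 0 ≤
      (1 + meanNormConst n a b C₀ CInf) / a * l ^ n := by
  have ha := h.a_pos
  have hfin := (volume_closedCube_lt_top z hl).ne
  have hg : AEMeasurable (fun x => p x * (f x - τ)) volume :=
    h.meas.aemeasurable.mul (hf.sub aemeasurable_const)
  have i1 : IntegrableOn (fun x => Real.exp (p x * (f x - τ))) (closedCube z l) volume :=
    integrableOn_exp_of_lintegral_ne_top hg (hτ.trans_lt ENNReal.one_lt_top).ne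
  have b1 : ∫ x in closedCube z l, Real.exp (p x * (f x - τ)) ≤ 1 :=
    setIntegral_exp_le zero_le_one hg (by rw [ENNReal.ofReal_one]; exact hτ)
  have i2 : IntegrableOn (fun x => |p x * σ - n * Real.log l|) (closedCube z l) volume :=
    (((h.integrableOn z hl).mul_const _).sub (integrableOn_const hfin)).abs
  have b2 := h.integral_abs_mul_logNorm_sub_le hn hl hσ
  have hln : 0 < l ^ n := by positivity
  calc ∫ x in closedCube z l, max (f x - (τ - σ)) 0
      ≤ ∫ x in closedCube z l, 1 / a * (Real.exp (p x * (f x - τ)) * l ^ n +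
        |p x * σ - n * Real.log l|) := by
        refine integral_mono (Integrable.pos_part (hfint.sub (integrableOn_const hfin)))
          (((i1.mul_const _).add i2).const_mul _) fun x => ?_
        dsimp only
        rw [one_div, inv_mul_eq_div, le_div_iff₀ ha]
        have h1 : p x * (f x - (τ - σ)) ≤
            Real.exp (p x * (f x - τ)) * l ^ n + |p x * σ - n * Real.log l| := by
          rw [← exp_mul_log_natCast hl, ← Real.exp_add]
          have h2 := Real.add_one_le_exp (p x * (f x - τ) + n * Real.log l)
          have h3 := le_abs_self (p x * σ - n * Real.log l)
          linarith
        rcases le_total (f x - (τ - σ)) 0 with h0 | h0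
        · rw [max_eq_right h0, zero_mul]; positivity
        · rw [max_eq_left h0]
          nlinarith [h.a_le x]
    _ = 1 / a * ((∫ x in closedCube z l, Real.exp (p x * (f x - τ))) * l ^ n +
        ∫ x in closedCube z l, |p x * σ - n * Real.log l|) := by
        rw [integral_const_mul, integral_add (i1.mul_const _) i2, integral_mul_const]
    _ ≤ 1 / a * (1 * l ^ n + meanNormConst n a b C₀ CInf * l ^ n) := by gcongr
    _ = _ := by ring

end VariableWeight

/-! ### Reverse Jensen inequalities for masses and for norms. -/

namespace VariableWeight

variable {n : ℕ} {a b pInf C₀ CInf : ℝ} {p : EuclideanSpace ℝ (Fin n) → ℝ}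

/-- The growth constant of `log ‖w 1_Q‖`. -/
noncomputable def normGrowth (n : ℕ) (a b C₀ CInf : ℝ) : ℝ :=
  growthConst n ((2 * cubeNormConst n a b C₀ CInf + n) / a) ((1 + meanNormConst n a b C₀ CInf) / a)

/-- The exponent in the comparison of modulars and norms, given growth of order `B`. -/
noncomputable def modularExp (n : ℕ) (a b C₀ CInf B : ℝ) : ℝ :=
  2 + tailExp B / a * oscConst n b C₀ CInf + 2 * B

theorem exp_add_four_mul_exp_le {u v : ℝ} (hu : 0 ≤ u) (hv : 0 ≤ v) :
    Real.exp u + 4 * Real.exp v ≤ Real.exp (2 + u + v) := by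
  have h1 : Real.exp u ≤ Real.exp (u + v) := Real.exp_le_exp.2 (by linarith)
  have h2 : Real.exp v ≤ Real.exp (u + v) := Real.exp_le_exp.2 (by linarith)
  have h3 : 5 ≤ Real.exp 2 := by
    have : Real.exp 2 = Real.exp 1 * Real.exp 1 := by rw [← Real.exp_add]; norm_num
    nlinarith [Real.exp_one_gt_d9]
  rw [add_assoc, Real.exp_add]
  nlinarith [Real.exp_pos (u + v)]

/-- The exponent is affine in the growth rate, hence at most linear in 1 + κ. -/
theorem LHExponent.modularExp_le (h : LHExponent a b pInf C₀ CInf p) {G κ : ℝ} (hG : 0 ≤ G)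
    (hκ : 0 ≤ κ) :
    modularExp n a b C₀ CInf (G * (1 + κ)) ≤
      (2 + (2 * G + 1) / a * oscConst n b C₀ CInf + 2 * G) * (1 + κ) := by
  have ha := h.a_pos
  have hc := h.oscConst_pos
  have h1 : tailExp (G * (1 + κ)) ≤ (2 * G + 1) * (1 + κ) := by
    unfold tailExp
    have : 0 < Real.log 2 := Real.log_pos one_lt_two
    rw [div_le_iff₀ this]
    have h7 : (1 / 2 : ℝ) ≤ Real.log 2 := by linarith [Real.log_two_gt_d9]
    have h8 : 0 ≤ G * (1 + κ) := by positivity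
    nlinarith
  unfold modularExp
  have h2 : tailExp (G * (1 + κ)) / a * oscConst n b C₀ CInf ≤
      (2 * G + 1) * (1 + κ) / a * oscConst n b C₀ CInf := by gcongr
  have h3 : (2 * G + 1) * (1 + κ) / a * oscConst n b C₀ CInf =
    (2 * G + 1) / a * oscConst n b C₀ CInf * (1 + κ) := by ring
  nlinarith

theorem LHExponent.cubeData_of_norm (h : LHExponent a b pInf C₀ CInf p) (hn : 0 < n) {κ : ℝ}
    (hκ : 0 ≤ κ) {f : EuclideanSpace ℝ (Fin n) → ℝ} (hf : AEMeasurable f volume)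
    (hfint : ∀ z l, 0 < l → IntegrableOn f (closedCube z l) volume)
    {σ τ : EuclideanSpace ℝ (Fin n) → ℝ → ℝ}
    (hσ : ∀ z l, 0 < l → cubeModular p 0 z l (σ z l) = 1)
    (hτ : ∀ z l, 0 < l → cubeModular p f z l (τ z l) ≤ 1)
    (hmono : ∀ z l y r, 0 < l → 0 < r → closedCube z l ⊆ closedCube y r → τ z l ≤ τ y r)
    (hnorm : τ 0 (2 * Real.exp 1) = 0)
    (hlow : ∀ z l, 0 < l → -(κ * l ^ n) ≤ ∫ x in closedCube z l, (f x - (τ z l - σ z l))) :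
    CubeData ((2 * cubeNormConst n a b C₀ CInf + n) / a)
      ((1 + meanNormConst n a b C₀ CInf) / a) κ f τ σ where
  integrableOn := hfint
  lower := hlow
  upper z l hl := h.integral_posPart_le hn hf hl (hfint z l hl) (hσ z l hl) (hτ z l hl)
  mono := hmono
  norm := hnorm
  scale z l hl k := h.logNorm_scale hn hl k (hσ z l hl) (hσ z _ (by positivity))
  S_nonneg := by
    have := h.a_pos; have := h.cubeNormConst_nonneg; positivity
  C_nonneg := by
    have := h.a_pos; have := h.meanNormConst_nonneg; positivity
  κ_nonneg := hκ

theorem integral_max_neg_le {f : EuclideanSpace ℝ (Fin n) → ℝ}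
    {Q : Set (EuclideanSpace ℝ (Fin n))} {u v : ℝ} (hf : IntegrableOn f Q volume)
    (h1 : -u ≤ ∫ x in Q, f x) (h2 : ∫ x in Q, max (f x) 0 ≤ v) :
    ∫ x in Q, max (-f x) 0 ≤ u + v := by
  have hp : IntegrableOn (fun x => max (f x) 0) Q volume := Integrable.pos_part hf
  have h3 : ∫ x in Q, max (-f x) 0 = (∫ x in Q, max (f x) 0) - ∫ x in Q, f x := by
    rw [← integral_sub hp hf]
    congr 1; ext x
    rcases le_total (f x) 0 with h | h
    · rw [max_eq_left (by linarith), max_eq_right h]; ring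
    · rw [max_eq_right (by linarith), max_eq_left h]; ring
  linarith

/-- A lower bound for `∫ θ h` when `h` has small negative part and `θ` is close to `q`. -/
theorem le_integral_mul {θ f : EuclideanSpace ℝ (Fin n) → ℝ} {c β q u N : ℝ}
    {z : EuclideanSpace ℝ (Fin n)} {l : ℝ} (hl : 0 < l) (hθm : Measurable θ)
    (hθ0 : ∀ x, 0 ≤ θ x) (hθ : ∀ x, θ x ≤ c)
    (hf : IntegrableOn f (closedCube z l) volume)
    (hneg : ∫ x in closedCube z l, max (-(f x - β)) 0 ≤ u * l ^ n)
    (hosc : (∫ x in closedCube z l, |θ x - q|) * |β| ≤ N * l ^ n) :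
    (q * β - c * u - N) * l ^ n ≤ ∫ x in closedCube z l, θ x * f x := by
  have hfin := (volume_closedCube_lt_top z hl).ne
  have hθi : IntegrableOn θ (closedCube z l) volume :=
    integrableOn_closedCube_of_bounded hθm.aemeasurable (C := c)
      (fun x => by rw [abs_of_nonneg (hθ0 x)]; exact hθ x) z hl
  have i0 : IntegrableOn (fun x => f x - β) (closedCube z l) volume :=
    hf.sub (integrableOn_const hfin)
  have i1 : IntegrableOn (fun x => max (-(f x - β)) 0) (closedCube z l) volume :=
    Integrable.neg_part i0
  have i2 : IntegrableOn (fun x => |θ x - q|) (closedCube z l) volume :=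
    (hθi.sub (integrableOn_const hfin)).abs
  have i3 : IntegrableOn (fun x => θ x * f x) (closedCube z l) volume := by
    refine Integrable.bdd_mul (c := c) hf hθm.aestronglyMeasurable ?_
    exact Filter.Eventually.of_forall fun x => by
      rw [Real.norm_eq_abs, abs_of_nonneg (hθ0 x)]; exact hθ x
  have i4 : IntegrableOn (fun _ : EuclideanSpace ℝ (Fin n) => q * β) (closedCube z l) volume :=
    integrableOn_const hfin
  have hc : 0 ≤ c := (hθ0 z).trans (hθ z)
  -- Split θ f = q β + θ (f - β) + (θ - q) β; the last two terms are bounded below by the hypotheses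
  -- on the negative part and on the oscillation.
  have key : ∫ x in closedCube z l, (q * β - c * max (-(f x - β)) 0 - |θ x - q| * |β|) ≤
      ∫ x in closedCube z l, θ x * f x := by
    refine integral_mono ((i4.sub (i1.const_mul c)).sub (i2.mul_const _)) i3 fun x => ?_
    dsimp only
    have h1 : -(|θ x - q| * |β|) ≤ (θ x - q) * β := by
      rw [← abs_mul]; exact neg_abs_le _
    have h2 : -(c * max (-(f x - β)) 0) ≤ θ x * (f x - β) := by
      have h3 := le_max_left (-(f x - β)) 0
      have h4 := le_max_right (-(f x - β)) 0
      have h5 : θ x * max (-(f x - β)) 0 ≤ c * max (-(f x - β)) 0 := by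
        gcongr; exact hθ x
      nlinarith [hθ0 x]
    nlinarith
  have i4' : IntegrableOn (fun x => q * β - c * max (-(f x - β)) 0) (closedCube z l) volume :=
    i4.sub (i1.const_mul c)
  rw [integral_sub i4' (i2.mul_const _), integral_sub i4 (i1.const_mul c),
    setIntegral_const, measureReal_closedCube z hl, smul_eq_mul,
    integral_const_mul, integral_mul_const] at key
  have : c * ∫ x in closedCube z l, max (-(f x - β)) 0 ≤ c * (u * l ^ n) := by gcongr
  nlinarith

/-- The logarithmic growth of τ - σ meets the reciprocal logarithmic oscillation of θ, so their
product is bounded on every cube. It is used with θ = p and with θ = 1/p. -/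
theorem CubeData.le_average_mul {S C κ : ℝ} {f : EuclideanSpace ℝ (Fin n) → ℝ}
    {τ σ : EuclideanSpace ℝ (Fin n) → ℝ → ℝ} (H : CubeData S C κ f τ σ)
    {θ : EuclideanSpace ℝ (Fin n) → ℝ} {c q N s : ℝ} (hN : 0 ≤ N)
    {z : EuclideanSpace ℝ (Fin n)} {l : ℝ} (hl : 0 < l) (hθm : Measurable θ)
    (hθ0 : ∀ x, 0 ≤ θ x) (hθ : ∀ x, θ x ≤ c)
    (hosc : ∫ x in closedCube z l, |θ x - q| ≤ N / cubeScale z l * l ^ n)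
    (hσ : |σ z l| ≤ s * cubeScale z l) :
    q * (τ z l - σ z l) - c * (κ + C) - N * (growthConst n S C * (1 + κ) + s) ≤
      (∫ x in closedCube z l, θ x * f x) / l ^ n := by
  have hln : 0 < l ^ n := by positivity
  have hΛ := one_le_cubeScale z hl
  have hneg := integral_max_neg_le (H.integrableOn_sub z hl _) (H.lower z l hl) (H.upper z l hl)
  rw [← add_mul] at hneg
  have hβ : |τ z l - σ z l| ≤ (growthConst n S C * (1 + κ) + s) * cubeScale z l := by
    have h1 := H.abs_le_cubeScale z hl
    have h3 := abs_sub (τ z l) (σ z l)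
    rw [add_mul]
    linarith
  have hosc' : (∫ x in closedCube z l, |θ x - q|) * |τ z l - σ z l| ≤
      (N * (growthConst n S C * (1 + κ) + s)) * l ^ n := by
    calc _ ≤ (N / cubeScale z l * l ^ n) *
          ((growthConst n S C * (1 + κ) + s) * cubeScale z l) := by gcongr
      _ = _ := by
          have : cubeScale z l ≠ 0 := by linarith
          field_simp
  rw [le_div_iff₀ hln]
  exact le_integral_mul hl hθm hθ0 hθ (H.integrableOn z l hl) hneg hosc'

/-- For the measure with density `exp (p f)`, the integral of exp(-pτ) is the modular, hence at most
1. After the exchange it becomes exp(-qτ) times the mass. -/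
theorem LHExponent.lintegral_exp_mul_le_exp_refExp (h : LHExponent a b pInf C₀ CInf p)
    (hn : 0 < n) {S C κ : ℝ} {f : EuclideanSpace ℝ (Fin n) → ℝ} (hf : AEMeasurable f volume)
    {τ σ : EuclideanSpace ℝ (Fin n) → ℝ → ℝ} (H : CubeData S C κ f τ σ)
    (hτ : ∀ z l, 0 < l → cubeModular p f z l (τ z l) ≤ 1)
    (z : EuclideanSpace ℝ (Fin n)) {l : ℝ} (hl : 0 < l) :
    ∫⁻ x in closedCube z l, ENNReal.ofReal (Real.exp (p x * f x)) ≤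
      ENNReal.ofReal (Real.exp (modularExp n a b C₀ CInf (4 * b * growthConst n S C * (1 + κ)) +
        refExp p pInf z l * τ z l)) := by
  have ha := h.a_pos
  have hb := h.b_pos
  have hG : 0 ≤ growthConst n S C := H.growthConst_nonneg
  have hκ := H.κ_nonneg
  have hWm : AEMeasurable (fun x => ENNReal.ofReal (Real.exp (p x * f x))) volume :=
    (Real.measurable_exp.comp_aemeasurable (h.meas.aemeasurable.mul hf)).ennreal_ofReal
  obtain ⟨μ, hμ⟩ : ∃ μ, μ = volume.withDensity fun x => ENNReal.ofReal (Real.exp (p x * f x)) :=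
    ⟨_, rfl⟩
  have hμQ : ∀ z l, μ (closedCube z l) =
      ∫⁻ x in closedCube z l, ENNReal.ofReal (Real.exp (p x * f x)) := fun z l => by
    rw [hμ]; exact withDensity_apply _ (measurableSet_closedCube z l)
  obtain ⟨B, hB⟩ : ∃ B, B = 4 * b * growthConst n S C * (1 + κ) := ⟨_, rfl⟩
  have hB0 : 0 ≤ B := by rw [hB]; positivity
  -- The tail estimate needs polynomial growth of this very measure; it follows from modular ≤ 1 and
  -- the upper growth of τ, whose rate is multiplied by b.
  have hgrow : ∀ j : ℕ, μ (closedCube 0 (2 * Real.exp 1 * 2 ^ j)) ≤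
      ENNReal.ofReal (Real.exp (B * (j + 1))) := by
    intro j
    have hτj := H.upper_growth_dyadic j
    have hr : 0 < 2 * Real.exp 1 * 2 ^ j := by positivity
    generalize 2 * Real.exp 1 * 2 ^ j = r at hτj hr
    rw [hμQ]
    calc _ ≤ ∫⁻ x in closedCube 0 r, ENNReal.ofReal (Real.exp (B * (j + 1))) *
          ENNReal.ofReal (Real.exp (p x * (f x - τ 0 r))) := by
          refine lintegral_mono fun x => ?_
          rw [← ENNReal.ofReal_mul (Real.exp_pos _).le, ← Real.exp_add]
          refine ENNReal.ofReal_le_ofReal (Real.exp_le_exp.2 ?_)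
          have h1 : p x * τ 0 r ≤ B * (j + 1) := by
            calc p x * τ 0 r ≤ p x * (4 * (growthConst n S C * (1 + κ)) * (j + 1)) := by
                  exact mul_le_mul_of_nonneg_left hτj (ha.le.trans (h.a_le x))
              _ ≤ b * (4 * (growthConst n S C * (1 + κ)) * (j + 1)) := by gcongr; exact h.le_b x
              _ = _ := by rw [hB]; ring
          linarith
      _ ≤ ENNReal.ofReal (Real.exp (B * (j + 1))) * 1 := by
          rw [lintegral_const_mul' _ _ ENNReal.ofReal_ne_top]
          gcongr
          exact hτ 0 r hr
      _ = _ := mul_one _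
  have hM := lintegral_exp_neg_tailExp_le μ hB0 hgrow
  obtain ⟨m, hm⟩ : ∃ m, m = tailExp B / a := ⟨_, rfl⟩
  have hm0 : 0 ≤ m := by rw [hm]; exact div_nonneg (tailExp_pos hB0).le ha.le
  have hma : m * a = tailExp B := by rw [hm]; field_simp
  rw [← hma] at hM
  have hGm : growthConst n S C * (1 + κ) ≤ m := by
    rw [hm, le_div_iff₀ ha]
    have hab : a ≤ b := (h.a_le z).trans (h.le_b z)
    have h0 : 0 ≤ growthConst n S C * (1 + κ) := by positivity
    have h1 := le_tailExp hB0
    have h2 : B = 4 * (growthConst n S C * (1 + κ) * b) := by rw [hB]; ring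
    have h3 : growthConst n S C * (1 + κ) * a ≤ growthConst n S C * (1 + κ) * b := by gcongr
    have h4 : 0 ≤ growthConst n S C * (1 + κ) * b := by positivity
    linarith
  have hτlow : ∀ x ∈ closedCube z l, -(m * pointScale x l) ≤ τ z l := fun x hx => by
    refine le_trans (neg_le_neg ?_) (H.lower_growth hl hx)
    have := one_le_pointScale x hl
    exact mul_le_mul_of_nonneg_right hGm (by linarith)
  have hcore := h.exp_refExp_mul_measure_le hn μ hm0 hM hl hτlow
  generalize refExp p pInf z l = q at *
  have hmod : ∫⁻ x in closedCube z l, ENNReal.ofReal (Real.exp (-(p x * τ z l))) ∂μ ≤ 1 := by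
    have hmeas : Measurable fun x => ENNReal.ofReal (Real.exp (-(p x * τ z l))) :=
      (Real.measurable_exp.comp (h.meas.mul_const _).neg).ennreal_ofReal
    rw [hμ, restrict_withDensity (measurableSet_closedCube z l),
      lintegral_withDensity_eq_lintegral_mul₀ hWm.restrict hmeas.aemeasurable]
    refine le_trans (le_of_eq ?_) (hτ z l hl)
    refine lintegral_congr fun x => ?_
    simp only [Pi.mul_apply]
    rw [← ENNReal.ofReal_mul (Real.exp_pos _).le, ← Real.exp_add]
    congr 2; ring
  have hbd : ENNReal.ofReal (Real.exp (-(q * τ z l))) * μ (closedCube z l) ≤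
      ENNReal.ofReal (Real.exp (modularExp n a b C₀ CInf B)) := by
    refine hcore.trans ?_
    calc _ ≤ ENNReal.ofReal (Real.exp (m * oscConst n b C₀ CInf)) * 1 +
          ENNReal.ofReal (4 * Real.exp (2 * B)) := by gcongr
      _ ≤ _ := by
          rw [mul_one, ← ENNReal.ofReal_add (Real.exp_pos _).le (by positivity)]
          refine ENNReal.ofReal_le_ofReal ?_
          unfold modularExp
          rw [← hm]
          exact exp_add_four_mul_exp_le (mul_nonneg hm0 h.oscConst_pos.le) (by positivity)
  rw [← hμQ, ← hB]
  calc μ (closedCube z l) = ENNReal.ofReal (Real.exp (q * τ z l)) *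
        (ENNReal.ofReal (Real.exp (-(q * τ z l))) * μ (closedCube z l)) := by
        rw [← mul_assoc, ← ENNReal.ofReal_mul (Real.exp_pos _).le, ← Real.exp_add]
        simp
    _ ≤ ENNReal.ofReal (Real.exp (q * τ z l)) *
        ENNReal.ofReal (Real.exp (modularExp n a b C₀ CInf B)) := by gcongr
    _ = _ := by
        rw [← ENNReal.ofReal_mul (Real.exp_pos _).le, ← Real.exp_add, add_comm]

/-- The exponent in the bound of `⨍_Q w ^ p` by `exp ⨍_Q log (w ^ p)`. -/
noncomputable def directExp (n : ℕ) (a b C₀ CInf : ℝ) : ℝ :=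
  (2 + (2 * (4 * b * normGrowth n a b C₀ CInf) + 1) / a * oscConst n b C₀ CInf +
    2 * (4 * b * normGrowth n a b C₀ CInf)) +
  b * (1 + (1 + meanNormConst n a b C₀ CInf) / a) +
  (normGrowth n a b C₀ CInf + (cubeNormConst n a b C₀ CInf + n) / a) * meanOscConst n b C₀ CInf +
  cubeNormConst n a b C₀ CInf

/-- Three bounds add up: log mass ≤ qτ + O(1 + κ), mean of p f ≥ q(τ - σ) - O(1 + κ), and qσ ≤ log
|Q| + O(1). -/
theorem LHExponent.lintegral_exp_mul_le (h : LHExponent a b pInf C₀ CInf p) (hn : 0 < n) {κ : ℝ}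
    (hκ : 0 ≤ κ) {f : EuclideanSpace ℝ (Fin n) → ℝ} (hf : AEMeasurable f volume)
    (hfint : ∀ z l, 0 < l → IntegrableOn f (closedCube z l) volume)
    {σ τ : EuclideanSpace ℝ (Fin n) → ℝ → ℝ}
    (hσ : ∀ z l, 0 < l → cubeModular p 0 z l (σ z l) = 1)
    (hτ : ∀ z l, 0 < l → cubeModular p f z l (τ z l) ≤ 1)
    (hmono : ∀ z l y r, 0 < l → 0 < r → closedCube z l ⊆ closedCube y r → τ z l ≤ τ y r)
    (hnorm : τ 0 (2 * Real.exp 1) = 0)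
    (hlow : ∀ z l, 0 < l → -(κ * l ^ n) ≤ ∫ x in closedCube z l, (f x - (τ z l - σ z l)))
    (z : EuclideanSpace ℝ (Fin n)) {l : ℝ} (hl : 0 < l) :
    ∫⁻ x in closedCube z l, ENNReal.ofReal (Real.exp (p x * f x)) ≤
      ENNReal.ofReal (l ^ n * Real.exp ((∫ x in closedCube z l, p x * f x) / l ^ n +
        directExp n a b C₀ CInf * (1 + κ))) := by
  have H := h.cubeData_of_norm hn hκ hf hfint hσ hτ hmono hnorm hlow
  have ha := h.a_pos
  have hb := h.b_pos
  have hF : 0 ≤ meanOscConst n b C₀ CInf := h.meanOscConst_nonneg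
  have hs : 0 ≤ cubeNormConst n a b C₀ CInf := h.cubeNormConst_nonneg
  have hG := H.growthConst_nonneg
  have hC₂ := H.C_nonneg
  refine (h.lintegral_exp_mul_le_exp_refExp hn hf H hτ z hl).trans (ENNReal.ofReal_le_ofReal ?_)
  have hlow' := H.le_average_mul hF hl h.meas (fun x => ha.le.trans (h.a_le x)) h.le_b
    (h.integral_abs_sub_refExp_le hn z hl) (h.abs_logNorm_le hn hl (hσ z l hl))
  have hS := (abs_le.1 (h.abs_refExp_mul_sub_le hn hl (hσ z l hl))).2
  have hexp : ∀ X, l ^ n * Real.exp X = Real.exp (n * Real.log l + X) := fun X => by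
    rw [Real.exp_add, exp_mul_log_natCast hl]
  rw [hexp]
  refine Real.exp_le_exp.2 ?_
  have hJle : modularExp n a b C₀ CInf (4 * b * growthConst n
      ((2 * cubeNormConst n a b C₀ CInf + n) / a) ((1 + meanNormConst n a b C₀ CInf) / a) *
        (1 + κ)) ≤ _ := h.modularExp_le (by positivity) hκ
  unfold directExp
  have hGe : growthConst n ((2 * cubeNormConst n a b C₀ CInf + n) / a)
    ((1 + meanNormConst n a b C₀ CInf) / a) = normGrowth n a b C₀ CInf := rfl
  rw [hGe] at hJle hlow' hG ⊢
  generalize normGrowth n a b C₀ CInf = G at *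
  generalize meanOscConst n b C₀ CInf = F at *
  generalize (1 + meanNormConst n a b C₀ CInf) / a = C₂ at *
  generalize cubeNormConst n a b C₀ CInf = s at *
  generalize refExp p pInf z l = q at *
  have hX : b * (κ + C₂) ≤ b * (1 + C₂) * (1 + κ) := by
    rw [mul_assoc]; gcongr; nlinarith
  have hY : F * (G * (1 + κ) + (s + n) / a) ≤ (G + (s + n) / a) * F * (1 + κ) := by
    have : 0 ≤ (s + n) / a * F * κ := by positivity
    nlinarith
  have hZ : s ≤ s * (1 + κ) := by nlinarith
  linarith

/-- The exponent in the bound of `‖w 1_Q‖` by `‖1_Q‖ exp ⨍_Q log w`. -/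
noncomputable def converseExp (n : ℕ) (a b C₀ CInf : ℝ) : ℝ :=
  (2 + (2 * (4 * growthConst n n 1) + 1) / a * oscConst n b C₀ CInf +
    2 * (4 * growthConst n n 1)) / a +
  1 / a + (growthConst n n 1 + n) * (meanOscConst n b C₀ CInf / a ^ 2) +
  cubeNormConst n a b C₀ CInf / a

/-- The positive part of y is at most exp y, and exp(f - β) has total mass at most |Q| by the choice
of β. -/
theorem integral_posPart_le_of_mass {f : EuclideanSpace ℝ (Fin n) → ℝ}
    (hf : AEMeasurable f volume) {z : EuclideanSpace ℝ (Fin n)} {l τ : ℝ} (hl : 0 < l)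
    (hfint : IntegrableOn f (closedCube z l) volume)
    (hτ : ∫⁻ x in closedCube z l, ENNReal.ofReal (Real.exp (f x)) = ENNReal.ofReal (Real.exp τ)) :
    ∫ x in closedCube z l, max (f x - (τ - n * Real.log l)) 0 ≤ 1 * l ^ n := by
  have hint : IntegrableOn (fun x => Real.exp (f x)) (closedCube z l) volume :=
    integrableOn_exp_of_lintegral_ne_top hf (by rw [hτ]; exact ENNReal.ofReal_ne_top)
  have hle : ∫ x in closedCube z l, Real.exp (f x) ≤ Real.exp τ :=
    setIntegral_exp_le (Real.exp_pos _).le hf hτ.le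
  set β := τ - n * Real.log l with hβ
  calc ∫ x in closedCube z l, max (f x - β) 0
      ≤ ∫ x in closedCube z l, Real.exp (f x) * Real.exp (-β) := by
        refine integral_mono (Integrable.pos_part (hfint.sub
          (integrableOn_const (volume_closedCube_lt_top z hl).ne))) (hint.mul_const _) fun x => ?_
        dsimp only
        rw [← Real.exp_add]
        refine max_le ?_ (Real.exp_pos _).le
        linarith [Real.add_one_le_exp (f x + -β)]
    _ = (∫ x in closedCube z l, Real.exp (f x)) * Real.exp (-β) := integral_mul_const _ _
    _ ≤ Real.exp τ * Real.exp (-β) := by gcongr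
    _ = 1 * l ^ n := by
        rw [← Real.exp_add, ← exp_mul_log_natCast hl, one_mul, hβ]
        congr 1; ring

theorem cubeData_of_mass {κ : ℝ}
    (hκ : 0 ≤ κ) {f : EuclideanSpace ℝ (Fin n) → ℝ} (hf : AEMeasurable f volume)
    (hfint : ∀ z l, 0 < l → IntegrableOn f (closedCube z l) volume)
    {τ : EuclideanSpace ℝ (Fin n) → ℝ → ℝ}
    (hτ : ∀ z l, 0 < l → ∫⁻ x in closedCube z l, ENNReal.ofReal (Real.exp (f x)) =
      ENNReal.ofReal (Real.exp (τ z l)))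
    (hnorm : τ 0 (2 * Real.exp 1) = 0)
    (hlow : ∀ z l, 0 < l →
      -(κ * l ^ n) ≤ ∫ x in closedCube z l, (f x - (τ z l - n * Real.log l))) :
    CubeData n 1 κ f τ (fun _ l => n * Real.log l) where
  integrableOn := hfint
  lower := hlow
  upper z l hl := integral_posPart_le_of_mass hf hl (hfint z l hl) (hτ z l hl)
  mono z l y r hl hr hsub := by
    have h1 : ENNReal.ofReal (Real.exp (τ z l)) ≤ ENNReal.ofReal (Real.exp (τ y r)) := by
      rw [← hτ z l hl, ← hτ y r hr]
      exact lintegral_mono_set hsub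
    rwa [ENNReal.ofReal_le_ofReal_iff (Real.exp_pos _).le, Real.exp_le_exp] at h1
  norm := hnorm
  scale z l hl k := by
    rw [Real.log_mul (by positivity) hl.ne', Real.log_pow]
    have hil : 0 < 1 / l := by positivity
    have hlog1 : 1 ≤ Real.log (Real.exp 1 + 1 / l) := one_le_log_of_exp_le (by linarith)
    have hl2 : Real.log 2 ≤ 1 := by linarith [Real.log_two_lt_d9]
    have hk : (0 : ℝ) ≤ k := k.cast_nonneg
    have hn0 : (0 : ℝ) ≤ n := n.cast_nonneg
    rw [← mul_sub]
    gcongr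
    nlinarith
  S_nonneg := n.cast_nonneg
  C_nonneg := zero_le_one
  κ_nonneg := hκ

/-- The expected logarithmic norm is τ/q. The exchange in the opposite direction, with mass exp τ,
cancels exp(-q · τ/q) and leaves a bounded modular. -/
theorem LHExponent.lintegral_exp_sub_refExp_le (h : LHExponent a b pInf C₀ CInf p)
    (hn : 0 < n) {S C κ : ℝ} {f : EuclideanSpace ℝ (Fin n) → ℝ} (hf : AEMeasurable f volume)
    {τ σ : EuclideanSpace ℝ (Fin n) → ℝ → ℝ} (H : CubeData S C κ f τ σ)
    (hτ : ∀ z l, 0 < l → ∫⁻ x in closedCube z l, ENNReal.ofReal (Real.exp (f x)) =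
      ENNReal.ofReal (Real.exp (τ z l)))
    (z : EuclideanSpace ℝ (Fin n)) {l : ℝ} (hl : 0 < l) :
    ∫⁻ x in closedCube z l,
        ENNReal.ofReal (Real.exp (f x - p x * (τ z l / refExp p pInf z l))) ≤
      ENNReal.ofReal (Real.exp (modularExp n a b C₀ CInf (4 * growthConst n S C * (1 + κ)))) := by
  have ha := h.a_pos
  have hG : 0 ≤ growthConst n S C := H.growthConst_nonneg
  have hκ := H.κ_nonneg
  have hWm : AEMeasurable (fun x => ENNReal.ofReal (Real.exp (f x))) volume :=
    (Real.measurable_exp.comp_aemeasurable hf).ennreal_ofReal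
  obtain ⟨μ, hμ⟩ : ∃ μ, μ = volume.withDensity fun x => ENNReal.ofReal (Real.exp (f x)) :=
    ⟨_, rfl⟩
  have hμQ : ∀ z l, 0 < l → μ (closedCube z l) = ENNReal.ofReal (Real.exp (τ z l)) :=
    fun z l hl => by
      rw [← hτ z l hl, hμ]; exact withDensity_apply _ (measurableSet_closedCube z l)
  obtain ⟨B, hB⟩ : ∃ B, B = 4 * growthConst n S C * (1 + κ) := ⟨_, rfl⟩
  have hB0 : 0 ≤ B := by rw [hB]; positivity
  have hgrow : ∀ j : ℕ, μ (closedCube 0 (2 * Real.exp 1 * 2 ^ j)) ≤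
      ENNReal.ofReal (Real.exp (B * (j + 1))) := by
    intro j
    have hτj := H.upper_growth_dyadic j
    rw [hμQ _ _ (by positivity)]
    refine ENNReal.ofReal_le_ofReal (Real.exp_le_exp.2 (hτj.trans (le_of_eq ?_)))
    rw [hB]; ring
  have hM := lintegral_exp_neg_tailExp_le μ hB0 hgrow
  obtain ⟨m, hm⟩ : ∃ m, m = tailExp B / a := ⟨_, rfl⟩
  have hm0 : 0 ≤ m := by rw [hm]; exact div_nonneg (tailExp_pos hB0).le ha.le
  have hma : m * a = tailExp B := by rw [hm]; field_simp
  rw [← hma] at hM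
  have hqa : a ≤ refExp p pInf z l := h.a_le_refExp z l
  have hq0 : 0 < refExp p pInf z l := ha.trans_le hqa
  have hτlow : ∀ x ∈ closedCube z l,
      -(m * pointScale x l) ≤ τ z l / refExp p pInf z l := fun x hx => by
    have h1 := H.lower_growth hl hx
    have hD := one_le_pointScale x hl
    have h2 : growthConst n S C * (1 + κ) ≤ m * refExp p pInf z l := by
      have h3 : growthConst n S C * (1 + κ) ≤ m * a := by
        have h0 : 0 ≤ growthConst n S C * (1 + κ) := by positivity
        have h1 := le_tailExp hB0
        rw [hma]
        linarith
      exact h3.trans (by gcongr)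
    rw [le_div_iff₀ hq0]
    have h3 : growthConst n S C * (1 + κ) * pointScale x l ≤
      m * refExp p pInf z l * pointScale x l := by gcongr
    linarith
  have hcore := h.lintegral_exp_neg_le hn μ hm0 hM hl hτlow
  generalize refExp p pInf z l = q at *
  rw [hμQ z l hl, ← ENNReal.ofReal_mul (Real.exp_pos _).le, ← Real.exp_add,
    mul_div_cancel₀ _ hq0.ne', neg_add_cancel, Real.exp_zero, ENNReal.ofReal_one, mul_one,
    ← ENNReal.ofReal_add (Real.exp_pos _).le (by positivity)] at hcore
  have hmeas : Measurable fun x => ENNReal.ofReal (Real.exp (-(p x * (τ z l / q)))) :=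
    (Real.measurable_exp.comp (h.meas.mul_const _).neg).ennreal_ofReal
  rw [hμ, restrict_withDensity (measurableSet_closedCube z l),
    lintegral_withDensity_eq_lintegral_mul₀ hWm.restrict hmeas.aemeasurable] at hcore
  refine le_trans (le_of_eq ?_) (hcore.trans (ENNReal.ofReal_le_ofReal ?_))
  · refine lintegral_congr fun x => ?_
    simp only [Pi.mul_apply]
    rw [← ENNReal.ofReal_mul (Real.exp_pos _).le, ← Real.exp_add, sub_eq_add_neg]
  · unfold modularExp
    rw [← hB, ← hm]
    exact exp_add_four_mul_exp_le (mul_nonneg hm0 h.oscConst_pos.le) (by positivity)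

theorem LHExponent.integral_abs_one_div_sub_le (h : LHExponent a b pInf C₀ CInf p) (hn : 0 < n)
    (z : EuclideanSpace ℝ (Fin n)) {l : ℝ} (hl : 0 < l) :
    ∫ x in closedCube z l, |1 / p x - 1 / refExp p pInf z l| ≤
      meanOscConst n b C₀ CInf / a ^ 2 / cubeScale z l * l ^ n := by
  have ha := h.a_pos
  have h1 := h.integral_abs_sub_refExp_le hn z hl
  have hqa : a ≤ refExp p pInf z l := h.a_le_refExp z l
  have hq0 : 0 < refExp p pInf z l := ha.trans_le hqa
  generalize refExp p pInf z l = q at *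
  have hinv : ∀ x, |1 / p x - 1 / q| ≤ 1 / a ^ 2 * |p x - q| := by
    intro x
    have hp0 := ha.trans_le (h.a_le x)
    rw [div_sub_div _ _ hp0.ne' hq0.ne', abs_div, abs_of_pos (mul_pos hp0 hq0), one_mul, mul_one,
      abs_sub_comm, div_eq_inv_mul, one_div]
    gcongr
    rw [pow_two]
    exact mul_le_mul (h.a_le x) hqa ha.le hp0.le
  have i1 : IntegrableOn (fun x => |p x - q|) (closedCube z l) volume :=
    ((h.integrableOn z hl).sub (integrableOn_const (volume_closedCube_lt_top z hl).ne)).abs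
  have i2 : IntegrableOn (fun x => |1 / p x - 1 / q|) (closedCube z l) volume := by
    refine Integrable.mono' (i1.const_mul (1 / a ^ 2)) ?_ (Filter.Eventually.of_forall fun x => ?_)
    · exact ((h.meas.const_div 1).sub_const _).abs.aestronglyMeasurable
    · rw [Real.norm_eq_abs, abs_abs]; exact hinv x
  refine (integral_mono i2 (i1.const_mul (1 / a ^ 2)) hinv).trans ?_
  rw [integral_const_mul]
  calc _ ≤ 1 / a ^ 2 * (oscConst n b C₀ CInf * (10 + 8 * n) / cubeScale z l * l ^ n) := by gcongr
    _ = _ := by unfold meanOscConst; ring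

/-- The modular is at most exp J at τ/q; adding J/a brings it down to 1. The mean of f/p is at least
(τ - n log l)/q up to O(1 + κ), and (n log l)/q is at most σ + O(1), so the stated level is high
enough. -/
theorem LHExponent.cubeModular_div_le_one (h : LHExponent a b pInf C₀ CInf p) (hn : 0 < n) {κ : ℝ}
    (hκ : 0 ≤ κ) {f : EuclideanSpace ℝ (Fin n) → ℝ} (hf : AEMeasurable f volume)
    (hfint : ∀ z l, 0 < l → IntegrableOn f (closedCube z l) volume)
    {σ τ : EuclideanSpace ℝ (Fin n) → ℝ → ℝ}
    (hσ : ∀ z l, 0 < l → cubeModular p 0 z l (σ z l) = 1)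
    (hτ : ∀ z l, 0 < l → ∫⁻ x in closedCube z l, ENNReal.ofReal (Real.exp (f x)) =
      ENNReal.ofReal (Real.exp (τ z l)))
    (hnorm : τ 0 (2 * Real.exp 1) = 0)
    (hlow : ∀ z l, 0 < l →
      -(κ * l ^ n) ≤ ∫ x in closedCube z l, (f x - (τ z l - n * Real.log l)))
    (z : EuclideanSpace ℝ (Fin n)) {l : ℝ} (hl : 0 < l) :
    cubeModular p (fun x => f x / p x) z l (σ z l + (∫ x in closedCube z l, f x / p x) / l ^ n +
      converseExp n a b C₀ CInf * (1 + κ)) ≤ 1 := by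
  have H := cubeData_of_mass hκ hf hfint hτ hnorm hlow
  have ha := h.a_pos
  have hF : 0 ≤ meanOscConst n b C₀ CInf := h.meanOscConst_nonneg
  have hs : 0 ≤ cubeNormConst n a b C₀ CInf := h.cubeNormConst_nonneg
  have hG := H.growthConst_nonneg
  have hqa : a ≤ refExp p pInf z l := h.a_le_refExp z l
  have hq0 : 0 < refExp p pInf z l := ha.trans_le hqa
  have hmass := h.lintegral_exp_sub_refExp_le hn hf H hτ z hl
  have hσlog : |(n : ℝ) * Real.log l| ≤ n * cubeScale z l := by
    rw [abs_mul, Nat.abs_cast]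
    gcongr
    exact abs_log_le_cubeScale z hl
  have hlow' := H.le_average_mul (c := 1 / a) (by positivity) hl (h.meas.const_div 1)
    (fun x => (one_div_pos.2 (ha.trans_le (h.a_le x))).le)
    (fun x => one_div_le_one_div_of_le ha (h.a_le x))
    (h.integral_abs_one_div_sub_le hn z hl) hσlog
  have hfp : ∫ x in closedCube z l, f x / p x = ∫ x in closedCube z l, 1 / p x * f x := by
    congr 1; ext x; rw [one_div, div_eq_inv_mul]
  rw [← hfp] at hlow'
  have hS := (abs_le.1 (h.abs_refExp_mul_sub_le hn hl (hσ z l hl))).1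
  have hJle : modularExp n a b C₀ CInf (4 * growthConst n n 1 * (1 + κ)) ≤ _ :=
    h.modularExp_le (by positivity) hκ
  have hJ0 : 0 ≤ modularExp n a b C₀ CInf (4 * growthConst n n 1 * (1 + κ)) := by
    have h1 : 0 ≤ 4 * growthConst n n 1 * (1 + κ) := by positivity
    have h2 := (tailExp_pos h1).le
    have h3 := h.oscConst_pos
    unfold modularExp; positivity
  have hT : τ z l / refExp p pInf z l +
      modularExp n a b C₀ CInf (4 * growthConst n n 1 * (1 + κ)) / a ≤
      σ z l + (∫ x in closedCube z l, f x / p x) / l ^ n +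
        converseExp n a b C₀ CInf * (1 + κ) := by
    unfold converseExp
    generalize modularExp n a b C₀ CInf (4 * growthConst n n 1 * (1 + κ)) = J at *
    generalize growthConst n n 1 = G at *
    generalize meanOscConst n b C₀ CInf = F at *
    generalize cubeNormConst n a b C₀ CInf = s at *
    generalize refExp p pInf z l = q at *
    have hS' : n * Real.log l / q ≤ σ z l + s / a := by
      have h1 : n * Real.log l / q ≤ σ z l + s / q := by
        rw [← sub_le_iff_le_add, ← sub_div, div_le_iff₀ hq0]; linarith
      have h2 : s / q ≤ s / a := by gcongr
      linarith
    have hβq : 1 / q * (τ z l - n * Real.log l) = τ z l / q - n * Real.log l / q := by ring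
    have h1 : J / a ≤ (2 + (2 * (4 * G) + 1) / a * oscConst n b C₀ CInf + 2 * (4 * G)) / a *
        (1 + κ) := by
      rw [div_mul_eq_mul_div]; gcongr
    have h2 : F / a ^ 2 * (G * (1 + κ) + n) ≤ (G + n) * (F / a ^ 2) * (1 + κ) := by
      have : 0 ≤ n * (F / a ^ 2) * κ := by positivity
      nlinarith
    have h3 : s / a ≤ s / a * (1 + κ) := by
      have : 0 ≤ s / a := by positivity
      nlinarith
    rw [hβq] at hlow'
    have h5 : 1 / a * (κ + 1) = 1 / a * (1 + κ) := by ring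
    linarith
  generalize modularExp n a b C₀ CInf (4 * growthConst n n 1 * (1 + κ)) = J at *
  generalize σ z l + (∫ x in closedCube z l, f x / p x) / l ^ n +
        converseExp n a b C₀ CInf * (1 + κ) = T at *
  generalize τ z l / refExp p pInf z l = v at *
  unfold cubeModular
  calc _ ≤ ∫⁻ x in closedCube z l, ENNReal.ofReal (Real.exp (-J)) *
        ENNReal.ofReal (Real.exp (f x - p x * v)) := by
        refine lintegral_mono fun x => ?_
        rw [← ENNReal.ofReal_mul (Real.exp_pos _).le, ← Real.exp_add]
        refine ENNReal.ofReal_le_ofReal (Real.exp_le_exp.2 ?_)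
        have hp0 := ha.trans_le (h.a_le x)
        rw [mul_sub, mul_div_cancel₀ _ hp0.ne']
        have h1 : p x * (v + J / a) ≤ p x * T := by gcongr
        have h2 : J ≤ p x * (J / a) := by
          rw [mul_div_assoc', le_div_iff₀ ha, mul_comm]
          gcongr; exact h.a_le x
        linarith
    _ ≤ ENNReal.ofReal (Real.exp (-J)) * ENNReal.ofReal (Real.exp J) := by
        rw [lintegral_const_mul' _ _ ENNReal.ofReal_ne_top]
        gcongr
    _ = 1 := by
        rw [← ENNReal.ofReal_mul (Real.exp_pos _).le, ← Real.exp_add]; simp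

end VariableWeight

/-! ### From norms and weight constants to modulars on closed cubes. -/

namespace VariableWeight

variable {n : ℕ} {a b pInf C₀ CInf : ℝ} {p : EuclideanSpace ℝ (Fin n) → ℝ}

section Congr

variable {Q Q' : Set (EuclideanSpace ℝ (Fin n))}

theorem wMass_congr_set (W : EuclideanSpace ℝ (Fin n) → ℝ) (h : Q =ᵐ[volume] Q') :
    wMass W Q = wMass W Q' := setLIntegral_congr h

theorem expAvgLogInv_congr_set (w : EuclideanSpace ℝ (Fin n) → ℝ) (h : Q =ᵐ[volume] Q') :
    expAvgLogInv w Q = expAvgLogInv w Q' := by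
  unfold expAvgLogInv
  have hiff := integrableOn_congr_set_ae (f := fun y => Real.log (w y)⁻¹) h
  rw [setAverage_congr h]
  by_cases hi : IntegrableOn (fun y => Real.log (w y)⁻¹) Q volume
  · rw [if_pos hi, if_pos (hiff.1 hi)]
  · rw [if_neg hi, if_neg fun hi' => hi (hiff.2 hi')]

theorem varNorm_indicator_congr_set (p w : EuclideanSpace ℝ (Fin n) → ℝ)
    (h : Q =ᵐ[volume] Q') : varNorm p (Q.indicator w) = varNorm p (Q'.indicator w) := by
  have key : ∀ t : ℝ, modular p (fun x => Q.indicator w x / t) =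
      modular p (fun x => Q'.indicator w x / t) := fun t => by
    refine lintegral_congr_ae ?_
    filter_upwards [indicator_ae_eq_of_ae_eq_set (f := w) h] with x hx
    rw [hx]
  unfold varNorm
  simp only [key]

theorem apInftyConst_le {p w : EuclideanSpace ℝ (Fin n) → ℝ} {c : ℝ≥0∞}
    (h : ∀ z l, 0 < l → varNorm p ((closedCube z l).indicator w) /
      varNorm p ((closedCube z l).indicator (fun _ => 1)) *
        expAvgLogInv w (closedCube z l) ≤ c) : apInftyConst p w ≤ c := by
  refine iSup₂_le fun Q hQ => ?_
  obtain ⟨z, l, hl, hQ'⟩ := hQ.exists_ae_eq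
  rw [varNorm_indicator_congr_set p w hQ', varNorm_indicator_congr_set p _ hQ',
    expAvgLogInv_congr_set w hQ']
  exact h z l hl

theorem aInftyConst_le {W : EuclideanSpace ℝ (Fin n) → ℝ} {c : ℝ≥0∞}
    (h : ∀ z l, 0 < l → wMass W (closedCube z l) / volume (closedCube z l) *
        expAvgLogInv W (closedCube z l) ≤ c) : aInftyConst W ≤ c := by
  refine iSup₂_le fun Q hQ => ?_
  obtain ⟨z, l, hl, hQ'⟩ := hQ.exists_ae_eq
  rw [wMass_congr_set W hQ', expAvgLogInv_congr_set W hQ', measure_congr hQ']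
  exact h z l hl

end Congr

theorem expAvgLogInv_closedCube {w : EuclideanSpace ℝ (Fin n) → ℝ}
    {z : EuclideanSpace ℝ (Fin n)} {l : ℝ} (hl : 0 < l)
    (h : IntegrableOn (fun y => Real.log (w y)) (closedCube z l) volume) :
    expAvgLogInv w (closedCube z l) =
      ENNReal.ofReal (Real.exp (-((∫ y in closedCube z l, Real.log (w y)) / l ^ n))) := by
  unfold expAvgLogInv
  have h' : IntegrableOn (fun y => Real.log (w y)⁻¹) (closedCube z l) volume := by
    simp only [Real.log_inv]; exact h.neg
  rw [if_pos h', setAverage_eq, measureReal_closedCube z hl]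
  simp only [Real.log_inv]
  rw [integral_neg, smul_eq_mul]
  congr 2
  rw [div_eq_inv_mul]; ring

theorem expAvgLogInv_pos (w : EuclideanSpace ℝ (Fin n) → ℝ)
    (Q : Set (EuclideanSpace ℝ (Fin n))) : 0 < expAvgLogInv w Q := by
  unfold expAvgLogInv
  split_ifs
  · exact ENNReal.ofReal_pos.2 (Real.exp_pos _)
  · exact ENNReal.zero_lt_top

theorem integrableOn_log_of_expAvgLogInv_ne_top {w : EuclideanSpace ℝ (Fin n) → ℝ}
    {Q : Set (EuclideanSpace ℝ (Fin n))} (h : expAvgLogInv w Q ≠ ∞) :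
    IntegrableOn (fun y => Real.log (w y)) Q volume := by
  unfold expAvgLogInv at h
  split_ifs at h with h'
  · simp only [Real.log_inv] at h'
    simpa using h'.neg
  · exact absurd rfl h

theorem IsWeight.ae_rpow_eq {w : EuclideanSpace ℝ (Fin n) → ℝ} (hw : IsWeight w)
    (p : EuclideanSpace ℝ (Fin n) → ℝ) :
    ∀ᵐ x, w x ^ p x = Real.exp (p x * Real.log (w x)) := by
  filter_upwards [hw.2.2] with x hx
  rw [Real.rpow_def_of_pos hx, mul_comm]

theorem IsWeight.aemeasurable_log {w : EuclideanSpace ℝ (Fin n) → ℝ} (hw : IsWeight w) :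
    AEMeasurable (fun x => Real.log (w x)) volume :=
  Real.measurable_log.comp_aemeasurable hw.1

theorem IsWeight.rpow {w p : EuclideanSpace ℝ (Fin n) → ℝ} (hw : IsWeight w)
    (hp : AEMeasurable p volume) : IsWeight (fun x => w x ^ p x) := by
  refine ⟨hw.1.pow hp, fun x => Real.rpow_nonneg (hw.2.1 x) _, ?_⟩
  filter_upwards [hw.2.2] with x hx
  exact Real.rpow_pos_of_pos hx _

theorem modular_indicator_div {w : EuclideanSpace ℝ (Fin n) → ℝ} (hw : IsWeight w)
    (hp : ∀ x, 0 < p x) (z : EuclideanSpace ℝ (Fin n)) (l : ℝ) {t : ℝ} (ht : 0 < t) :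
    modular p (fun x => (closedCube z l).indicator w x / t) =
      cubeModular p (fun x => Real.log (w x)) z l (Real.log t) := by
  have h1 : (fun x => ENNReal.ofReal (|(closedCube z l).indicator w x / t| ^ p x)) =
      (closedCube z l).indicator fun x => ENNReal.ofReal (|w x / t| ^ p x) := by
    ext x
    by_cases hx : x ∈ closedCube z l
    · simp [hx]
    · simp [hx, Real.zero_rpow (hp x).ne']
  unfold modular cubeModular
  rw [h1, lintegral_indicator (measurableSet_closedCube z l)]
  refine lintegral_congr_ae (ae_restrict_of_ae ?_)
  filter_upwards [hw.2.2] with x hx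
  rw [abs_of_pos (div_pos hx ht), Real.rpow_def_of_pos (div_pos hx ht),
    Real.log_div hx.ne' ht.ne', mul_comm]

theorem varNorm_le_of_cubeModular_le_one {w : EuclideanSpace ℝ (Fin n) → ℝ} (hw : IsWeight w)
    (hp : ∀ x, 0 < p x) {z : EuclideanSpace ℝ (Fin n)} {l τ : ℝ}
    (h : cubeModular p (fun x => Real.log (w x)) z l τ ≤ 1) :
    varNorm p ((closedCube z l).indicator w) ≤ ENNReal.ofReal (Real.exp τ) := by
  unfold varNorm
  refine iInf_le_of_le (Real.exp τ) (iInf_le_of_le (Real.exp_pos τ) (iInf_le_of_le ?_ le_rfl))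
  rw [modular_indicator_div hw hp z l (Real.exp_pos τ), Real.log_exp]
  exact h

theorem LHExponent.pos (h : LHExponent a b pInf C₀ CInf p) (x : EuclideanSpace ℝ (Fin n)) :
    0 < p x := h.a_pos.trans_le (h.a_le x)

theorem LHExponent.cubeModular_sub_le (h : LHExponent a b pInf C₀ CInf p)
    (f : EuclideanSpace ℝ (Fin n) → ℝ) (z : EuclideanSpace ℝ (Fin n)) (l τ : ℝ) {η : ℝ}
    (hη : 0 ≤ η) :
    cubeModular p f z l (τ - η) ≤ ENNReal.ofReal (Real.exp (b * η)) * cubeModular p f z l τ := by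
  unfold cubeModular
  rw [← lintegral_const_mul' _ _ ENNReal.ofReal_ne_top]
  refine lintegral_mono fun x => ?_
  rw [← ENNReal.ofReal_mul (Real.exp_pos _).le, ← Real.exp_add]
  refine ENNReal.ofReal_le_ofReal (Real.exp_le_exp.2 ?_)
  nlinarith [h.le_b x]

theorem LHExponent.cubeModular_le_sub (h : LHExponent a b pInf C₀ CInf p)
    (f : EuclideanSpace ℝ (Fin n) → ℝ) (z : EuclideanSpace ℝ (Fin n)) (l τ : ℝ) {η : ℝ}
    (hη : 0 ≤ η) :
    ENNReal.ofReal (Real.exp (a * η)) * cubeModular p f z l τ ≤ cubeModular p f z l (τ - η) := by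
  unfold cubeModular
  rw [← lintegral_const_mul' _ _ ENNReal.ofReal_ne_top]
  refine lintegral_mono fun x => ?_
  rw [← ENNReal.ofReal_mul (Real.exp_pos _).le, ← Real.exp_add]
  refine ENNReal.ofReal_le_ofReal (Real.exp_le_exp.2 ?_)
  nlinarith [h.a_le x]

theorem lintegral_exp_pos {f : EuclideanSpace ℝ (Fin n) → ℝ} (hf : AEMeasurable f volume)
    (z : EuclideanSpace ℝ (Fin n)) {l : ℝ} (hl : 0 < l) :
    0 < ∫⁻ x in closedCube z l, ENNReal.ofReal (Real.exp (f x)) := by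
  rw [pos_iff_ne_zero]
  intro h0
  have hm : AEMeasurable (fun x => ENNReal.ofReal (Real.exp (f x)))
    (volume.restrict (closedCube z l)) :=
    (Real.measurable_exp.comp_aemeasurable hf).ennreal_ofReal.restrict
  rw [lintegral_eq_zero_iff' hm] at h0
  have h1 : ∀ᵐ x ∂(volume.restrict (closedCube z l)), False := by
    filter_upwards [h0] with x hx
    have h2 : ENNReal.ofReal (Real.exp (f x)) = 0 := hx
    rw [ENNReal.ofReal_eq_zero] at h2
    linarith [Real.exp_pos (f x)]
  have h2 : volume.restrict (closedCube z l) Set.univ = 0 := by simpa [ae_iff] using h1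
  rw [Measure.restrict_apply_univ, volume_closedCube z hl, ENNReal.ofReal_eq_zero] at h2
  linarith [pow_pos hl n]

/-- Lowering the level by η multiplies the modular by a factor between exp(aη) and exp(bη). The
lower factor bounds the admissible levels from below; the upper one shows that the infimum is
attained and that the modular there cannot be less than 1. -/
theorem LHExponent.exists_varNorm_eq (h : LHExponent a b pInf C₀ CInf p)
    {w : EuclideanSpace ℝ (Fin n) → ℝ} (hw : IsWeight w)
    (z : EuclideanSpace ℝ (Fin n)) {l : ℝ} (hl : 0 < l)
    (hfin : varNorm p ((closedCube z l).indicator w) ≠ ∞) :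
    ∃ τ : ℝ, varNorm p ((closedCube z l).indicator w) = ENNReal.ofReal (Real.exp τ) ∧
      cubeModular p (fun x => Real.log (w x)) z l τ = 1 := by
  have ha := h.a_pos
  have hb := h.b_pos
  set c := cubeModular p (fun x => Real.log (w x)) z l with hc
  set T := {τ : ℝ | c τ ≤ 1} with hT
  have hcpos : ∀ τ, 0 < c τ := fun τ =>
    lintegral_exp_pos (h.meas.aemeasurable.mul (hw.aemeasurable_log.sub aemeasurable_const)) z hl
  have hne : T.Nonempty := by
    by_contra hemp
    refine hfin ?_
    unfold varNorm
    simp only [iInf_eq_top]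
    intro t ht hmod
    rw [modular_indicator_div hw h.pos z l ht] at hmod
    exact absurd ⟨Real.log t, hmod⟩ hemp
  have hbdd : BddBelow T := by
    obtain ⟨τ₀, hτ₀⟩ := hne
    have h0 : (c τ₀).toReal ≠ 0 :=
      (ENNReal.toReal_pos (hcpos τ₀).ne' (hτ₀.trans_lt ENNReal.one_lt_top).ne).ne'
    have h0' : 0 < (c τ₀).toReal := lt_of_le_of_ne ENNReal.toReal_nonneg h0.symm
    refine ⟨min τ₀ (τ₀ + Real.log (c τ₀).toReal / a), fun τ hτ => ?_⟩
    rcases le_total τ₀ τ with h1 | h1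
    · exact (min_le_left _ _).trans h1
    refine (min_le_right _ _).trans ?_
    have h2 := h.cubeModular_le_sub (fun x => Real.log (w x)) z l τ₀ (sub_nonneg.2 h1)
    rw [sub_sub_cancel] at h2
    have h3 : ENNReal.ofReal (Real.exp (a * (τ₀ - τ)) * (c τ₀).toReal) ≤ 1 := by
      rw [ENNReal.ofReal_mul (Real.exp_pos _).le,
        ENNReal.ofReal_toReal (hτ₀.trans_lt ENNReal.one_lt_top).ne]
      exact h2.trans hτ
    rw [ENNReal.ofReal_le_one, ← Real.exp_log h0', ← Real.exp_add,
      Real.exp_le_one_iff] at h3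
    have : Real.log (c τ₀).toReal / a ≤ τ - τ₀ := by
      rw [div_le_iff₀ ha]; linarith
    linarith
  set τ := sInf T with hτdef
  have hle : c τ ≤ 1 := by
    have h1 : ∀ ε > 0, c τ ≤ ENNReal.ofReal (Real.exp (b * ε)) := by
      intro ε hε
      obtain ⟨τ', hτ', hlt⟩ := exists_lt_of_csInf_lt hne (show sInf T < τ + ε by linarith)
      have h2 : τ ≤ τ' := csInf_le hbdd hτ'
      have h3 := h.cubeModular_sub_le (fun x => Real.log (w x)) z l τ' (sub_nonneg.2 h2)
      rw [sub_sub_cancel] at h3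
      calc c τ ≤ ENNReal.ofReal (Real.exp (b * (τ' - τ))) * c τ' := h3
        _ ≤ ENNReal.ofReal (Real.exp (b * ε)) * 1 := by
            gcongr
            · linarith
            · exact hτ'
        _ = _ := mul_one _
    have h2 : Filter.Tendsto (fun ε : ℝ => ENNReal.ofReal (Real.exp (b * ε)))
        (nhdsWithin 0 (Set.Ioi 0)) (nhds 1) := by
      have : Filter.Tendsto (fun ε : ℝ => ENNReal.ofReal (Real.exp (b * ε)))
          (nhds 0) (nhds (ENNReal.ofReal (Real.exp (b * 0)))) :=
        (ENNReal.continuous_ofReal.comp (by fun_prop)).tendsto 0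
      simp only [mul_zero, Real.exp_zero, ENNReal.ofReal_one] at this
      exact this.mono_left nhdsWithin_le_nhds
    exact ge_of_tendsto h2 (Filter.eventually_of_mem self_mem_nhdsWithin h1)
  have heq : c τ = 1 := by
    refine le_antisymm hle ?_
    by_contra! hlt
    have hfin' : c τ ≠ ∞ := (hlt.trans ENNReal.one_lt_top).ne
    have h0 : 0 < (c τ).toReal := ENNReal.toReal_pos (hcpos τ).ne' hfin'
    have h1 : (c τ).toReal < 1 := by
      rw [← ENNReal.toReal_one]
      exact (ENNReal.toReal_lt_toReal hfin' ENNReal.one_ne_top).2 hlt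
    have hlog := Real.log_neg h0 h1
    have hε : 0 < -Real.log (c τ).toReal / b := div_pos (by linarith) hb
    have h3 := h.cubeModular_sub_le (fun x => Real.log (w x)) z l τ hε.le
    have h4 : τ - -Real.log (c τ).toReal / b ∈ T := by
      refine h3.trans ?_
      rw [mul_div_cancel₀ _ hb.ne', Real.exp_neg, Real.exp_log h0]
      change _ * c τ ≤ 1
      nth_rewrite 2 [← ENNReal.ofReal_toReal hfin']
      rw [← ENNReal.ofReal_mul (by positivity), inv_mul_cancel₀ h0.ne', ENNReal.ofReal_one]
    have := csInf_le hbdd h4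
    linarith
  refine ⟨τ, le_antisymm (varNorm_le_of_cubeModular_le_one hw h.pos hle) ?_, heq⟩
  unfold varNorm
  refine le_iInf fun t => le_iInf fun ht => le_iInf fun hmod => ?_
  rw [modular_indicator_div hw h.pos z l ht] at hmod
  refine ENNReal.ofReal_le_ofReal ?_
  rw [← Real.exp_log ht]
  exact Real.exp_le_exp.2 (csInf_le hbdd hmod)

theorem isWeight_one : IsWeight (fun _ : EuclideanSpace ℝ (Fin n) => (1 : ℝ)) :=
  ⟨aemeasurable_const, fun _ => zero_le_one, Filter.Eventually.of_forall fun _ => zero_lt_one⟩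

theorem LHExponent.exists_varNorm_one_eq (h : LHExponent a b pInf C₀ CInf p)
    (z : EuclideanSpace ℝ (Fin n)) {l : ℝ} (hl : 0 < l) :
    ∃ σ : ℝ, varNorm p ((closedCube z l).indicator (fun _ => 1)) = ENNReal.ofReal (Real.exp σ) ∧
      cubeModular p 0 z l σ = 1 := by
  have h1 : (fun _ : EuclideanSpace ℝ (Fin n) => Real.log 1) = 0 := by ext; simp
  have hfin : varNorm p ((closedCube z l).indicator (fun _ => (1 : ℝ))) ≠ ∞ := by
    refine ne_top_of_le_ne_top ENNReal.ofReal_ne_top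
      (varNorm_le_of_cubeModular_le_one isWeight_one h.pos
        (τ := max 0 (n * Real.log l / a)) ?_)
    rw [h1]
    set τ := max 0 (n * Real.log l / a)
    have hτ0 : 0 ≤ τ := le_max_left _ _
    have hτ1 : n * Real.log l ≤ a * τ := by
      have := le_max_right 0 (n * Real.log l / a)
      rw [div_le_iff₀ h.a_pos] at this
      linarith
    unfold cubeModular
    calc _ ≤ ∫⁻ x in closedCube z l, ENNReal.ofReal (Real.exp (-(a * τ))) := by
          refine lintegral_mono fun x => ENNReal.ofReal_le_ofReal (Real.exp_le_exp.2 ?_)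
          simp only [Pi.zero_apply]
          nlinarith [h.a_le x]
      _ ≤ 1 := by
          rw [setLIntegral_const, volume_closedCube z hl, ← ENNReal.ofReal_mul (Real.exp_pos _).le,
            ← exp_mul_log_natCast hl, ← Real.exp_add, ENNReal.ofReal_le_one, Real.exp_le_one_iff]
          linarith
  obtain ⟨σ, h2, h3⟩ := h.exists_varNorm_eq isWeight_one z hl hfin
  rw [h1] at h3
  exact ⟨σ, h2, h3⟩

end VariableWeight

/-! ### The two weight classes in logarithmic form. -/

namespace VariableWeight

variable {n : ℕ} {a b pInf C₀ CInf : ℝ} {p : EuclideanSpace ℝ (Fin n) → ℝ}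

theorem LHExponent.converseExp_pos (h : LHExponent a b pInf C₀ CInf p) :
    0 < converseExp n a b C₀ CInf := by
  have h1 := h.oscConst_pos
  have h2 := h.meanOscConst_nonneg
  have h3 := h.cubeNormConst_nonneg
  have h4 : 0 ≤ growthConst n n 1 := growthConst_nonneg n.cast_nonneg zero_le_one
  have h5 := h.a_pos
  unfold converseExp
  positivity

theorem LHExponent.directExp_pos (h : LHExponent a b pInf C₀ CInf p) :
    0 < directExp n a b C₀ CInf := by
  have h1 := h.oscConst_pos
  have h2 := h.meanOscConst_nonneg
  have h3 := h.cubeNormConst_nonneg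
  have h5 := h.a_pos
  have h6 := h.b_pos
  have h7 := h.meanNormConst_nonneg
  have h4 : 0 ≤ normGrowth n a b C₀ CInf :=
    growthConst_nonneg (by positivity) (by positivity)
  unfold directExp
  positivity

theorem setIntegral_closedCube_sub_const {f : EuclideanSpace ℝ (Fin n) → ℝ}
    {z : EuclideanSpace ℝ (Fin n)} {l : ℝ} (hl : 0 < l)
    (hf : IntegrableOn f (closedCube z l) volume) (c : ℝ) :
    ∫ x in closedCube z l, (f x - c) = (∫ x in closedCube z l, f x) - c * l ^ n := by
  rw [integral_sub hf (integrableOn_const (volume_closedCube_lt_top z hl).ne), setIntegral_const,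
    measureReal_closedCube z hl, smul_eq_mul, mul_comm]

theorem integral_le_integral_max {f : EuclideanSpace ℝ (Fin n) → ℝ}
    {Q : Set (EuclideanSpace ℝ (Fin n))} (hf : IntegrableOn f Q volume) :
    ∫ x in Q, f x ≤ ∫ x in Q, max (f x) 0 :=
  integral_mono hf (Integrable.pos_part hf) fun _ => le_max_left _ _

theorem ofReal_exp_div_ofReal_exp (u v : ℝ) :
    ENNReal.ofReal (Real.exp u) / ENNReal.ofReal (Real.exp v) =
      ENNReal.ofReal (Real.exp (u - v)) := by
  rw [← ENNReal.ofReal_div_of_pos (Real.exp_pos _), Real.exp_sub]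

theorem ofReal_exp_mul_ofReal_exp (u v : ℝ) :
    ENNReal.ofReal (Real.exp u) * ENNReal.ofReal (Real.exp v) =
      ENNReal.ofReal (Real.exp (u + v)) := by
  rw [← ENNReal.ofReal_mul (Real.exp_pos _).le, Real.exp_add]

theorem volume_closedCube_eq_exp (z : EuclideanSpace ℝ (Fin n)) {l : ℝ} (hl : 0 < l) :
    volume (closedCube z l) = ENNReal.ofReal (Real.exp (n * Real.log l)) := by
  rw [volume_closedCube z hl, exp_mul_log_natCast hl]

theorem cubeModular_sub_const (p f : EuclideanSpace ℝ (Fin n) → ℝ)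
    (z : EuclideanSpace ℝ (Fin n)) (l τ c : ℝ) :
    cubeModular p (fun x => f x - c) z l (τ - c) = cubeModular p f z l τ := by
  unfold cubeModular
  simp only [sub_sub_sub_cancel_right]

/-- The norms and the means of `log w` on cubes for a weight of class `𝒜_{p(·),∞}`. -/
theorem LHExponent.exists_logNorm (h : LHExponent a b pInf C₀ CInf p)
    {w : EuclideanSpace ℝ (Fin n) → ℝ} (hw : IsApInfty p w) :
    0 < (apInftyConst p w).toReal ∧ ∃ τ σ : EuclideanSpace ℝ (Fin n) → ℝ → ℝ,
      ∀ z l, 0 < l →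
        varNorm p ((closedCube z l).indicator w) = ENNReal.ofReal (Real.exp (τ z l)) ∧
        cubeModular p (fun x => Real.log (w x)) z l (τ z l) = 1 ∧
        cubeModular p 0 z l (σ z l) = 1 ∧
        IntegrableOn (fun x => Real.log (w x)) (closedCube z l) volume ∧
        τ z l - σ z l - (∫ x in closedCube z l, Real.log (w x)) / l ^ n ≤
          Real.log (apInftyConst p w).toReal := by
  have key : ∀ z l, 0 < l → ∃ τ σ : ℝ,
      varNorm p ((closedCube z l).indicator w) = ENNReal.ofReal (Real.exp τ) ∧
      cubeModular p (fun x => Real.log (w x)) z l τ = 1 ∧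
      cubeModular p 0 z l σ = 1 ∧
      IntegrableOn (fun x => Real.log (w x)) (closedCube z l) volume ∧
      Real.exp (τ - σ - (∫ x in closedCube z l, Real.log (w x)) / l ^ n) ≤
        (apInftyConst p w).toReal := by
    intro z l hl
    have hterm : varNorm p ((closedCube z l).indicator w) /
        varNorm p ((closedCube z l).indicator (fun _ => 1)) *
          expAvgLogInv w (closedCube z l) ≤ apInftyConst p w :=
      le_iSup₂_of_le (closedCube z l) (isCube_closedCube z hl) le_rfl
    have hpos := expAvgLogInv_pos w (closedCube z l)
    have hfin := (hterm.trans_lt hw.2).ne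
    obtain ⟨σ, hσ1, hσ2⟩ := h.exists_varNorm_one_eq z hl
    -- No factor of a finite product can be infinite when the others are nonzero; this gives
    -- finiteness of the norm here, and integrability of `log w` below through the convention that
    -- the last factor is ∞ otherwise.
    have hnorm : varNorm p ((closedCube z l).indicator w) ≠ ∞ := by
      intro htop
      rw [htop, hσ1, ENNReal.top_div_of_ne_top ENNReal.ofReal_ne_top,
        ENNReal.top_mul hpos.ne'] at hfin
      exact hfin rfl
    obtain ⟨τ, hτ1, hτ2⟩ := h.exists_varNorm_eq hw.1 z hl hnorm
    rw [hτ1, hσ1, ofReal_exp_div_ofReal_exp] at hterm hfin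
    have hexp : expAvgLogInv w (closedCube z l) ≠ ∞ := by
      intro htop
      rw [htop, ENNReal.mul_top (ENNReal.ofReal_pos.2 (Real.exp_pos _)).ne'] at hfin
      exact hfin rfl
    have hint := integrableOn_log_of_expAvgLogInv_ne_top hexp
    refine ⟨τ, σ, hτ1, hτ2, hσ2, hint, ?_⟩
    rw [expAvgLogInv_closedCube hl hint, ofReal_exp_mul_ofReal_exp, ← sub_eq_add_neg] at hterm
    rwa [← ENNReal.ofReal_le_iff_le_toReal hw.2.ne]
  have hK : 0 < (apInftyConst p w).toReal := by
    obtain ⟨τ, σ, _, _, _, _, hle⟩ := key 0 1 one_pos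
    exact (Real.exp_pos _).trans_le hle
  refine ⟨hK, ?_⟩
  choose! τ σ hτσ using key
  refine ⟨τ, σ, fun z l hl => ?_⟩
  obtain ⟨h1, h2, h3, h4, h5⟩ := hτσ z l hl
  exact ⟨h1, h2, h3, h4, (Real.le_log_iff_exp_le hK).2 h5⟩

theorem LHExponent.lintegral_exp_mul_le_of_isApInfty (h : LHExponent a b pInf C₀ CInf p)
    (hn : 0 < n) {w : EuclideanSpace ℝ (Fin n) → ℝ} (hw : IsApInfty p w) :
    0 < (apInftyConst p w).toReal ∧ ∃ lam J : ℝ,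
      varNorm p ((unitScaleCube n).indicator w) = ENNReal.ofReal (Real.exp lam) ∧
      0 ≤ J ∧ J ≤ directExp n a b C₀ CInf * (1 + (1 + meanNormConst n a b C₀ CInf) / a) +
        directExp n a b C₀ CInf * Real.log (apInftyConst p w).toReal ∧
      ∀ z l, 0 < l →
        IntegrableOn (fun x => Real.log (w x)) (closedCube z l) volume ∧
        ∫⁻ x in closedCube z l, ENNReal.ofReal (Real.exp (p x * (Real.log (w x) - lam))) ≤
          ENNReal.ofReal (l ^ n * Real.exp
            ((∫ x in closedCube z l, p x * (Real.log (w x) - lam)) / l ^ n + J)) := by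
  obtain ⟨hK, τ, σ, H⟩ := h.exists_logNorm hw
  have ha := h.a_pos
  have hb := h.b_pos
  refine ⟨hK, τ 0 (2 * Real.exp 1),
    directExp n a b C₀ CInf * (1 + max (Real.log (apInftyConst p w).toReal) 0),
    (H 0 _ (by positivity)).1, ?_, ?_, fun z l hl => ⟨(H z l hl).2.2.2.1, ?_⟩⟩
  all_goals
    generalize hKdef : Real.log (apInftyConst p w).toReal = k at *
    have hC₂ : 0 ≤ (1 + meanNormConst n a b C₀ CInf) / a := by
      have := h.meanNormConst_nonneg; positivity
    have hκ : 0 ≤ max k 0 := le_max_right _ _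
    -- The constant of a weight cannot be too small: on a unit cube the mean of `log w` is at most τ
    -- - σ plus the constant on the left. Hence the nonnegative κ = `max k 0` is at most an additive
    -- constant plus `k`, which keeps `J` affine in `k`.
    have hk : -((1 + meanNormConst n a b C₀ CInf) / a) ≤ k := by
      obtain ⟨h1, h2, h3, h4, h5⟩ := H 0 1 one_pos
      have h6 := h.integral_posPart_le hn hw.1.aemeasurable_log one_pos h4 h3 h2.le
      have h7 := (integral_le_integral_max (h4.sub (integrableOn_const
        (volume_closedCube_lt_top _ one_pos).ne))).trans h6
      have h8 := setIntegral_closedCube_sub_const one_pos h4 (τ 0 1 - σ 0 1)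
      simp only [one_pow, div_one, mul_one, Pi.sub_apply] at h5 h7 h8
      rw [h8] at h7
      linarith
    have hlow : ∀ z l, 0 < l → -(max k 0 * l ^ n) ≤
        ∫ x in closedCube z l, ((fun x => Real.log (w x) - τ 0 (2 * Real.exp 1)) x -
          ((fun z l => τ z l - τ 0 (2 * Real.exp 1)) z l - σ z l)) := by
      intro z l hl
      obtain ⟨h1, h2, h3, h4, h5⟩ := H z l hl
      have hln : 0 < l ^ n := by positivity
      have h6 := setIntegral_closedCube_sub_const hl h4 (τ z l - σ z l)
      have h7 : ∀ x, (fun x => Real.log (w x) - τ 0 (2 * Real.exp 1)) x -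
          ((fun z l => τ z l - τ 0 (2 * Real.exp 1)) z l - σ z l) =
          Real.log (w x) - (τ z l - σ z l) := fun x => by ring
      simp only [h7]
      rw [h6]
      have h8 : (τ z l - σ z l - max k 0) * l ^ n ≤ ∫ x in closedCube z l, Real.log (w x) := by
        rw [← le_div_iff₀ hln]
        linarith [le_max_left k 0]
      linarith
    have hA := h.directExp_pos.le
  · positivity
  · rw [← mul_add]
    refine mul_le_mul_of_nonneg_left ?_ hA
    have : max k 0 ≤ (1 + meanNormConst n a b C₀ CInf) / a + k :=
      max_le (by linarith) (by linarith)
    linarith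
  · refine h.lintegral_exp_mul_le hn hκ (σ := σ)
      (f := fun x => Real.log (w x) - τ 0 (2 * Real.exp 1))
      (τ := fun z l => τ z l - τ 0 (2 * Real.exp 1))
      (hw.1.aemeasurable_log.sub aemeasurable_const)
      (fun z l hl => (H z l hl).2.2.2.1.sub (integrableOn_const (volume_closedCube_lt_top z hl).ne))
      (fun z l hl => (H z l hl).2.2.1) (fun z l hl => ?_) (fun z l y r hl hr hsub => ?_)
      (sub_self _) hlow z hl
    · rw [cubeModular_sub_const p (fun x => Real.log (w x))]
      exact (H z l hl).2.1.le
    · refine sub_le_sub_right ?_ _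
      have h1 : cubeModular p (fun x => Real.log (w x)) z l (τ y r) ≤ 1 := by
        rw [← (H y r hr).2.1]
        exact lintegral_mono_set hsub
      have h2 := varNorm_le_of_cubeModular_le_one hw.1 h.pos h1
      rwa [(H z l hl).1, ENNReal.ofReal_le_ofReal_iff (Real.exp_pos _).le, Real.exp_le_exp] at h2

/-- The masses and the means of `log W` on cubes for a weight of class `A_∞`. -/
theorem exists_logMass {W : EuclideanSpace ℝ (Fin n) → ℝ} (hW : IsAInfty W) :
    0 < (aInftyConst W).toReal ∧ ∃ τ : EuclideanSpace ℝ (Fin n) → ℝ → ℝ,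
      ∀ z l, 0 < l →
        wMass W (closedCube z l) = ENNReal.ofReal (Real.exp (τ z l)) ∧
        ∫⁻ x in closedCube z l, ENNReal.ofReal (Real.exp (Real.log (W x))) =
          ENNReal.ofReal (Real.exp (τ z l)) ∧
        IntegrableOn (fun x => Real.log (W x)) (closedCube z l) volume ∧
        τ z l - n * Real.log l - (∫ x in closedCube z l, Real.log (W x)) / l ^ n ≤
          Real.log (aInftyConst W).toReal := by
  have key : ∀ z l, 0 < l → ∃ τ : ℝ,
      wMass W (closedCube z l) = ENNReal.ofReal (Real.exp τ) ∧
      ∫⁻ x in closedCube z l, ENNReal.ofReal (Real.exp (Real.log (W x))) =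
          ENNReal.ofReal (Real.exp τ) ∧
      IntegrableOn (fun x => Real.log (W x)) (closedCube z l) volume ∧
      Real.exp (τ - n * Real.log l - (∫ x in closedCube z l, Real.log (W x)) / l ^ n) ≤
          (aInftyConst W).toReal := by
    intro z l hl
    have hterm : wMass W (closedCube z l) / volume (closedCube z l) *
          expAvgLogInv W (closedCube z l) ≤ aInftyConst W :=
      le_iSup₂_of_le (closedCube z l) (isCube_closedCube z hl) le_rfl
    have hpos := expAvgLogInv_pos W (closedCube z l)
    have hfin := (hterm.trans_lt hW.2).ne
    have hmass : wMass W (closedCube z l) =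
        ∫⁻ x in closedCube z l, ENNReal.ofReal (Real.exp (Real.log (W x))) := by
      refine lintegral_congr_ae (ae_restrict_of_ae ?_)
      filter_upwards [hW.1.2.2] with x hx
      rw [Real.exp_log hx]
    have hmpos : 0 < wMass W (closedCube z l) := by
      rw [hmass]; exact lintegral_exp_pos hW.1.aemeasurable_log z hl
    rw [volume_closedCube_eq_exp z hl] at hterm hfin
    have hmfin : wMass W (closedCube z l) ≠ ∞ := by
      intro htop
      rw [htop, ENNReal.top_div_of_ne_top ENNReal.ofReal_ne_top,
        ENNReal.top_mul hpos.ne'] at hfin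
      exact hfin rfl
    obtain ⟨τ, hτ⟩ : ∃ τ : ℝ, wMass W (closedCube z l) = ENNReal.ofReal (Real.exp τ) :=
      ⟨Real.log (wMass W (closedCube z l)).toReal, by
        rw [Real.exp_log (ENNReal.toReal_pos hmpos.ne' hmfin), ENNReal.ofReal_toReal hmfin]⟩
    rw [hτ, ofReal_exp_div_ofReal_exp] at hterm hfin
    have hexp : expAvgLogInv W (closedCube z l) ≠ ∞ := by
      intro htop
      rw [htop, ENNReal.mul_top (ENNReal.ofReal_pos.2 (Real.exp_pos _)).ne'] at hfin
      exact hfin rfl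
    have hint := integrableOn_log_of_expAvgLogInv_ne_top hexp
    refine ⟨τ, hτ, hmass ▸ hτ, hint, ?_⟩
    rw [expAvgLogInv_closedCube hl hint, ofReal_exp_mul_ofReal_exp, ← sub_eq_add_neg] at hterm
    rwa [← ENNReal.ofReal_le_iff_le_toReal hW.2.ne]
  have hK : 0 < (aInftyConst W).toReal := by
    obtain ⟨τ, _, _, _, hle⟩ := key 0 1 one_pos
    exact (Real.exp_pos _).trans_le hle
  refine ⟨hK, ?_⟩
  choose! τ hτ using key
  refine ⟨τ, fun z l hl => ?_⟩
  obtain ⟨h1, h2, h3, h4⟩ := hτ z l hl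
  exact ⟨h1, h2, h3, (Real.le_log_iff_exp_le hK).2 h4⟩

theorem LHExponent.cubeModular_div_le_one_of_isAInfty (h : LHExponent a b pInf C₀ CInf p)
    (hn : 0 < n) {W : EuclideanSpace ℝ (Fin n) → ℝ} (hW : IsAInfty W) :
    0 < (aInftyConst W).toReal ∧ ∃ lam : ℝ,
      wMass W (unitScaleCube n) = ENNReal.ofReal (Real.exp lam) ∧
      ∀ z l, 0 < l →
        IntegrableOn (fun x => Real.log (W x)) (closedCube z l) volume ∧
        ∀ σ, cubeModular p 0 z l σ = 1 →
        cubeModular p (fun x => (Real.log (W x) - lam) / p x) z l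
          (σ + (∫ x in closedCube z l, (Real.log (W x) - lam) / p x) / l ^ n +
            converseExp n a b C₀ CInf * (2 + Real.log (aInftyConst W).toReal)) ≤ 1 := by
  obtain ⟨hK, τ, H⟩ := exists_logMass hW
  have ha := h.a_pos
  refine ⟨hK, τ 0 (2 * Real.exp 1), (H 0 _ (by positivity)).1,
    fun z l hl => ⟨(H z l hl).2.2.1, fun σ₀ hσ₀ => ?_⟩⟩
  generalize hKdef : Real.log (aInftyConst W).toReal = k at *
  set lam := τ 0 (2 * Real.exp 1) with hlam
  have hσ : ∀ z l, 0 < l → ∃ σ, cubeModular p 0 z l σ = 1 := fun z l hl =>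
    let ⟨σ, hσ⟩ := h.exists_varNorm_one_eq z hl
    ⟨σ, hσ.2⟩
  choose! σ hσ' using hσ
  have hκ : 0 ≤ max k 0 := le_max_right _ _
  have hf : AEMeasurable (fun x => Real.log (W x) - lam) volume :=
    hW.1.aemeasurable_log.sub aemeasurable_const
  have hfint : ∀ z l, 0 < l →
      IntegrableOn (fun x => Real.log (W x) - lam) (closedCube z l) volume := fun z l hl =>
    (H z l hl).2.2.1.sub (integrableOn_const (volume_closedCube_lt_top z hl).ne)
  have hτ : ∀ z l, 0 < l →
      ∫⁻ x in closedCube z l, ENNReal.ofReal (Real.exp (Real.log (W x) - lam)) =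
      ENNReal.ofReal (Real.exp ((fun z l => τ z l - lam) z l)) := by
    intro z l hl
    have h1 := (H z l hl).2.1
    dsimp only
    rw [sub_eq_add_neg (τ z l), ← ofReal_exp_mul_ofReal_exp, ← h1,
      ← lintegral_mul_const' _ _ ENNReal.ofReal_ne_top]
    simp only [ofReal_exp_mul_ofReal_exp, ← sub_eq_add_neg]
  have hlowk : ∀ z l, 0 < l → -(k * l ^ n) ≤
      ∫ x in closedCube z l, (Real.log (W x) - lam -
        ((fun z l => τ z l - lam) z l - n * Real.log l)) := by
    intro z l hl
    obtain ⟨h1, h2, h4, h5⟩ := H z l hl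
    have hln : 0 < l ^ n := by positivity
    have h6 := setIntegral_closedCube_sub_const hl h4 (τ z l - n * Real.log l)
    have h7 : ∀ x, Real.log (W x) - lam -
        ((fun z l => τ z l - lam) z l - n * Real.log l) =
        Real.log (W x) - (τ z l - n * Real.log l) := fun x => by ring
    simp only [h7]
    rw [h6]
    have h8 : (τ z l - n * Real.log l - k) * l ^ n ≤ ∫ x in closedCube z l, Real.log (W x) := by
      rw [← le_div_iff₀ hln]
      linarith
    linarith
  have hlow : ∀ z l, 0 < l → -(max k 0 * l ^ n) ≤
      ∫ x in closedCube z l, (Real.log (W x) - lam -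
        ((fun z l => τ z l - lam) z l - n * Real.log l)) := by
    intro z l hl
    refine le_trans (neg_le_neg ?_) (hlowk z l hl)
    gcongr
    exact le_max_left _ _
  -- As for norms, comparing the upper and the lower estimate on one unit cube bounds the logarithm
  -- of the constant from below.
  have hk : -1 ≤ k := by
    have H' := cubeData_of_mass hκ hf hfint hτ (sub_self _) hlow
    have h1 := integral_le_integral_max (H'.integrableOn_sub 0 one_pos
      ((fun z l => τ z l - lam) 0 1 - n * Real.log 1))
    have h2 := H'.upper 0 1 one_pos
    have h3 := hlowk 0 1 one_pos
    simp only [one_pow, mul_one] at h2 h3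
    linarith
  have hmax : max k 0 ≤ 1 + k := max_le (by linarith) (by linarith)
  have hmain := h.cubeModular_div_le_one hn hκ hf hfint
    -- The claim is for an arbitrary admissible σ₀ on one cube, so the chosen family is altered
    -- there.
    (σ := fun y r => if y = z ∧ r = l then σ₀ else σ y r)
    (fun y r hr => by
      by_cases hyr : y = z ∧ r = l
      · rw [if_pos hyr, hyr.1, hyr.2]; exact hσ₀
      · rw [if_neg hyr]; exact hσ' y r hr) hτ (sub_self _) hlow z hl
  rw [if_pos ⟨rfl, rfl⟩] at hmain
  refine le_trans ?_ hmain
  unfold cubeModular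
  refine lintegral_mono fun x => ENNReal.ofReal_le_ofReal (Real.exp_le_exp.2 ?_)
  refine mul_le_mul_of_nonneg_left (sub_le_sub_left ?_ _) (h.pos x).le
  have hA := h.converseExp_pos.le
  have := mul_le_mul_of_nonneg_left (show 1 + max k 0 ≤ 2 + k by linarith) hA
  linarith

end VariableWeight

/-! ### Parameters of the exponent and removal of the normalisation. -/

namespace VariableWeight

variable {n : ℕ} {a b pInf C₀ CInf : ℝ} {p : EuclideanSpace ℝ (Fin n) → ℝ}

theorem LogHolderAtInftyWith.abs_sub_le (h : LogHolderAtInftyWith pInf CInf p) (hC : 0 < CInf)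
    (x : EuclideanSpace ℝ (Fin n)) : |p x - pInf| ≤ CInf := by
  refine (h x).trans (div_le_self hC.le ?_)
  exact one_le_log_of_exp_le (by linarith [norm_nonneg x])

/-- Both bounds are expressed through `pInf` and `CInf`, so that every constant built on them
depends on the parameters alone; the minimum with 1 avoids a separate proof that `pInf` ≥ 1. -/
theorem HasParameters.lhExponent {pm pp : ℝ} (h : HasParameters pm pp pInf C₀ CInf p) :
    LHExponent (min 1 pInf) (pInf + CInf) pInf C₀ CInf p := by
  obtain ⟨⟨hm, h1⟩, -, -, hC₀, hloc, hpInf, hCInf, hinf⟩ := h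
  exact {
    meas := hm
    a_pos := lt_min one_pos hpInf
    a_le := fun x => (min_le_left _ _).trans (h1 x)
    le_b := fun x => by linarith [(abs_le.1 (hinf.abs_sub_le hCInf x)).2]
    a_le_inf := min_le_right _ _
    inf_le_b := by linarith
    C₀_pos := hC₀
    CInf_pos := hCInf
    loc := hloc
    atInf := hinf }

/-- A set of full measure is dense, so some y with p(y) ≥ m lies within exp(-2 C₀/m) of x, where the
local condition allows a change of at most m/2. -/
theorem LocalLogHolderWith.half_le (h : LocalLogHolderWith C₀ p) (hC₀ : 0 < C₀) {m : ℝ}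
    (hm : 0 < m) (hae : ∀ᵐ x, m ≤ p x) (x : EuclideanSpace ℝ (Fin n)) : m / 2 ≤ p x := by
  have hdense : Dense {y | m ≤ p y} := Measure.dense_of_ae hae
  obtain ⟨y, hy, hxy⟩ := Metric.dense_iff.1 hdense x (min (1 / 4) (Real.exp (-(2 * C₀ / m))))
    (lt_min (by norm_num) (Real.exp_pos _))
  rw [Metric.mem_ball, dist_eq_norm, norm_sub_rev, lt_min_iff] at hy
  have hxy' : m ≤ p y := hxy
  rcases eq_or_ne x y with rfl | hne
  · linarith
  have hr : 0 < ‖x - y‖ := norm_pos_iff.2 (sub_ne_zero.2 hne)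
  have h1 := h x y (by linarith [hy.1])
  have h2 : Real.log ‖x - y‖ < -(2 * C₀ / m) := by
    rw [Real.log_lt_iff_lt_exp hr]; exact hy.2
  have h3 : 0 < 2 * C₀ / m := by positivity
  have h4 : |p x - p y| ≤ m / 2 := by
    refine h1.trans ?_
    rw [← div_neg, div_le_iff₀ (by linarith)]
    have : m / 2 * (2 * C₀ / m) = C₀ := by field_simp
    nlinarith
  linarith [(abs_le.1 h4).1]

theorem ae_pMinus_le (hb : ∀ x, |p x| ≤ b) : ∀ᵐ x, pMinus p ≤ p x :=
  ae_essInf_le ⟨-b, Filter.eventually_map.2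
    (Filter.Eventually.of_forall fun x => (abs_le.1 (hb x)).1)⟩

theorem ae_le_pPlus (hb : ∀ x, |p x| ≤ b) : ∀ᵐ x, p x ≤ pPlus p :=
  ae_le_essSup ⟨b, Filter.eventually_map.2
    (Filter.Eventually.of_forall fun x => (abs_le.1 (hb x)).2)⟩

theorem LHExponent.abs_le_b (h : LHExponent a b pInf C₀ CInf p)
    (x : EuclideanSpace ℝ (Fin n)) : |p x| ≤ b := by
  rw [abs_of_pos (h.pos x)]; exact h.le_b x

theorem exists_lhExponent (hp : IsExponentP0 p) (h : IsLogHolder p) :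
    ∃ a b pInf C₀ CInf, LHExponent a b pInf C₀ CInf p := by
  obtain ⟨hm, -, hpm⟩ := hp
  obtain ⟨⟨C₀, hC₀, hloc⟩, pInf, CInf, hpInf, hCInf, hinf⟩ := h
  have hbd : ∀ x, |p x| ≤ pInf + CInf := fun x => by
    have h1 := abs_le.1 (hinf.abs_sub_le hCInf x)
    have h2 := abs_sub_abs_le_abs_sub (p x) pInf
    rw [abs_of_pos hpInf] at h2
    linarith [hinf.abs_sub_le hCInf x]
  exact ⟨min (pMinus p / 2) pInf, pInf + CInf, pInf, C₀, CInf, {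
    meas := hm
    a_pos := lt_min (by linarith) hpInf
    a_le := fun x => (min_le_left _ _).trans (hloc.half_le hC₀ hpm (ae_pMinus_le hbd) x)
    le_b := fun x => (le_abs_self _).trans (hbd x)
    a_le_inf := min_le_right _ _
    inf_le_b := by linarith
    C₀_pos := hC₀
    CInf_pos := hCInf
    loc := hloc
    atInf := hinf }⟩

theorem LHExponent.integrableOn_mul (h : LHExponent a b pInf C₀ CInf p)
    {f : EuclideanSpace ℝ (Fin n) → ℝ} {Q : Set (EuclideanSpace ℝ (Fin n))}
    (hf : IntegrableOn f Q volume) : IntegrableOn (fun x => p x * f x) Q volume :=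
  Integrable.bdd_mul (c := b) hf h.meas.aestronglyMeasurable
    (Filter.Eventually.of_forall fun x => h.abs_le_b x)

theorem LHExponent.integrableOn_div (h : LHExponent a b pInf C₀ CInf p)
    {f : EuclideanSpace ℝ (Fin n) → ℝ} {Q : Set (EuclideanSpace ℝ (Fin n))}
    (hf : IntegrableOn f Q volume) : IntegrableOn (fun x => f x / p x) Q volume := by
  simp only [div_eq_inv_mul]
  refine Integrable.bdd_mul (c := a⁻¹) hf h.meas.inv.aestronglyMeasurable
    (Filter.Eventually.of_forall fun x => ?_)
  rw [Real.norm_eq_abs, abs_of_pos (inv_pos.2 (h.pos x))]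
  exact inv_anti₀ h.a_pos (h.a_le x)

/-- Subtracting `lam` from `log w` normalises the weight on `Q₀`; undoing this multiplies the
density by exp(p `lam`). -/
theorem wMass_rpow_le {w : EuclideanSpace ℝ (Fin n) → ℝ} (hw : IsWeight w) {lam c : ℝ}
    (hc : ∀ᵐ x, p x * lam ≤ c) (E : Set (EuclideanSpace ℝ (Fin n))) :
    wMass (fun x => w x ^ p x) E ≤ ENNReal.ofReal (Real.exp c) *
      ∫⁻ x in E, ENNReal.ofReal (Real.exp (p x * (Real.log (w x) - lam))) := by
  unfold wMass
  rw [← lintegral_const_mul' _ _ ENNReal.ofReal_ne_top]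
  refine lintegral_mono_ae (ae_restrict_of_ae ?_)
  filter_upwards [hw.ae_rpow_eq p, hc] with x hx hcx
  rw [hx, ofReal_exp_mul_ofReal_exp]
  exact ENNReal.ofReal_le_ofReal (Real.exp_le_exp.2 (by linarith))

theorem le_wMass_rpow {w : EuclideanSpace ℝ (Fin n) → ℝ} (hw : IsWeight w) {lam c : ℝ}
    (hc : ∀ᵐ x, c ≤ p x * lam) (E : Set (EuclideanSpace ℝ (Fin n))) :
    ∫⁻ x in E, ENNReal.ofReal (Real.exp (p x * (Real.log (w x) - lam))) ≤
      ENNReal.ofReal (Real.exp (-c)) * wMass (fun x => w x ^ p x) E := by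
  unfold wMass
  rw [← lintegral_const_mul' _ _ ENNReal.ofReal_ne_top]
  refine lintegral_mono_ae (ae_restrict_of_ae ?_)
  filter_upwards [hw.ae_rpow_eq p, hc] with x hx hcx
  rw [hx, ofReal_exp_mul_ofReal_exp]
  exact ENNReal.ofReal_le_ofReal (Real.exp_le_exp.2 (by linarith))

theorem LHExponent.isAInfty_rpow (h : LHExponent a b pInf C₀ CInf p) (hn : 0 < n)
    {w : EuclideanSpace ℝ (Fin n) → ℝ} (hw : IsApInfty p w) :
    IsAInfty (fun x => w x ^ p x) := by
  obtain ⟨-, lam, J, -, -, -, H⟩ := h.lintegral_exp_mul_le_of_isApInfty hn hw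
  refine ⟨hw.1.rpow h.meas.aemeasurable, ?_⟩
  refine (aInftyConst_le (c := ENNReal.ofReal (Real.exp (2 * (b * |lam|) + J)))
    fun z l hl => ?_).trans_lt ENNReal.ofReal_lt_top
  obtain ⟨hint, hle⟩ := H z l hl
  have hln : 0 < l ^ n := by positivity
  have habs : ∀ x, |p x * lam| ≤ b * |lam| := fun x => by
    rw [abs_mul]; gcongr; exact h.abs_le_b x
  have hmass := wMass_rpow_le hw.1 (p := p) (lam := lam) (c := b * |lam|)
    (Filter.Eventually.of_forall fun x => (abs_le.1 (habs x)).2) (closedCube z l)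
  have hlog : ∀ᵐ x, Real.log (w x ^ p x) = p x * Real.log (w x) := by
    filter_upwards [hw.1.2.2] with x hx
    exact Real.log_rpow hx _
  have hint1 := h.integrableOn_mul hint
  have hint2 : IntegrableOn (fun x => Real.log (w x ^ p x)) (closedCube z l) volume :=
    hint1.congr (ae_restrict_of_ae (hlog.mono fun _ hx => hx.symm))
  have hI : ∫ x in closedCube z l, p x * (Real.log (w x) - lam) ≤
      (∫ x in closedCube z l, Real.log (w x ^ p x)) + b * |lam| * l ^ n := by
    rw [integral_congr_ae (ae_restrict_of_ae hlog)]
    have h1 := setIntegral_closedCube_sub_const hl hint1 (-(b * |lam|))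
    rw [neg_mul, sub_neg_eq_add] at h1
    rw [← h1]
    refine integral_mono (h.integrableOn_mul
      (hint.sub (integrableOn_const (volume_closedCube_lt_top z hl).ne)))
      (hint1.sub (integrableOn_const (volume_closedCube_lt_top z hl).ne)) fun x => ?_
    dsimp only
    linarith [(abs_le.1 (habs x)).1]
  have hI' : (∫ x in closedCube z l, p x * (Real.log (w x) - lam)) / l ^ n ≤
      (∫ x in closedCube z l, Real.log (w x ^ p x)) / l ^ n + b * |lam| := by
    rw [div_add' _ _ _ hln.ne']
    gcongr
  rw [expAvgLogInv_closedCube hl hint2, volume_closedCube_eq_exp z hl]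
  have hmass2 : wMass (fun x => w x ^ p x) (closedCube z l) ≤
      ENNReal.ofReal (Real.exp (b * |lam| + (n * Real.log l +
        ((∫ x in closedCube z l, p x * (Real.log (w x) - lam)) / l ^ n + J)))) := by
    refine hmass.trans ?_
    rw [← ofReal_exp_mul_ofReal_exp]
    gcongr
    rwa [Real.exp_add, exp_mul_log_natCast hl]
  calc _ ≤ ENNReal.ofReal (Real.exp (b * |lam| + (n * Real.log l +
        ((∫ x in closedCube z l, p x * (Real.log (w x) - lam)) / l ^ n + J)))) /
        ENNReal.ofReal (Real.exp (n * Real.log l)) *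
        ENNReal.ofReal (Real.exp (-((∫ x in closedCube z l, Real.log (w x ^ p x)) / l ^ n))) := by
        gcongr
    _ ≤ _ := by
        rw [ofReal_exp_div_ofReal_exp, ofReal_exp_mul_ofReal_exp]
        exact ENNReal.ofReal_le_ofReal (Real.exp_le_exp.2 (by linarith))

/-- A function whose exponential satisfies a reverse Jensen inequality on a cube has comparable
mass on subsets of at least half the measure. -/
theorem lintegral_exp_le_mul_of_subset {g : EuclideanSpace ℝ (Fin n) → ℝ}
    (hg : AEMeasurable g volume) {z : EuclideanSpace ℝ (Fin n)} {l J : ℝ} (hl : 0 < l)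
    (hJ : 0 ≤ J) (hint : IntegrableOn g (closedCube z l) volume)
    (hle : ∫⁻ x in closedCube z l, ENNReal.ofReal (Real.exp (g x)) ≤
      ENNReal.ofReal (l ^ n * Real.exp ((∫ x in closedCube z l, g x) / l ^ n + J)))
    {E : Set (EuclideanSpace ℝ (Fin n))} (hE : E ⊆ closedCube z l)
    (hvol : l ^ n / 2 ≤ volume.real E) :
    ∫⁻ x in closedCube z l, ENNReal.ofReal (Real.exp (g x)) ≤
      ENNReal.ofReal (2 * Real.exp (2 * (J + 1))) *
        ∫⁻ x in E, ENNReal.ofReal (Real.exp (g x)) := by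
  have hln : 0 < l ^ n := by positivity
  have hpos := lintegral_exp_pos hg z hl
  have hfin := (hle.trans_lt ENNReal.ofReal_lt_top).ne
  obtain ⟨μ, hμ⟩ : ∃ μ : ℝ, ∫⁻ x in closedCube z l, ENNReal.ofReal (Real.exp (g x)) =
      ENNReal.ofReal (Real.exp μ) :=
    ⟨Real.log (∫⁻ x in closedCube z l, ENNReal.ofReal (Real.exp (g x))).toReal, by
      rw [Real.exp_log (ENNReal.toReal_pos hpos.ne' hfin), ENNReal.ofReal_toReal hfin]⟩
  have hEfin : volume E ≠ ∞ := ((measure_mono hE).trans_lt (volume_closedCube_lt_top z hl)).ne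
  have hexpint : IntegrableOn (fun x => Real.exp (g x)) E volume :=
    (integrableOn_exp_of_lintegral_ne_top hg hfin).mono_set hE
  have hupper := integral_posPart_le_of_mass hg hl hint hμ
  rw [hμ] at hle ⊢
  set β := μ - n * Real.log l with hβ
  have hgβ : IntegrableOn (fun x => g x - β) (closedCube z l) volume :=
    hint.sub (integrableOn_const (volume_closedCube_lt_top z hl).ne)
  have hlower : -(J * l ^ n) ≤ ∫ x in closedCube z l, (g x - β) := by
    rw [setIntegral_closedCube_sub_const hl hint]
    rw [ENNReal.ofReal_le_ofReal_iff (by positivity)] at hle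
    nth_rewrite 1 [← exp_mul_log_natCast hl] at hle
    rw [← Real.exp_add, Real.exp_le_exp] at hle
    have h1 : (β - J) * l ^ n ≤ ∫ x in closedCube z l, g x := by
      rw [← le_div_iff₀ hln]; linarith
    linarith
  have hEint := le_setIntegral_of_subset hgβ hE hlower hupper
  -- A lower bound for the mean of g - β over E: its integral is at least -(J + 1)|Q|, and |Q| ≤
  -- 2|E|. Jensen's inequality is then applied through the tangent line of the exponential at β +
  -- y₀.
  set y₀ := -(2 * (J + 1)) with hy₀
  have hconst : ∀ c : ℝ, IntegrableOn (fun _ : EuclideanSpace ℝ (Fin n) => c) E volume :=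
    fun c => integrableOn_const hEfin
  have hjensen : Real.exp (β + y₀) * volume.real E ≤ ∫ x in E, Real.exp (g x) := by
    have h1 : ∫ x in E, Real.exp (β + y₀) * ((g x - β) + (1 - y₀)) ≤ ∫ x in E, Real.exp (g x) := by
      refine integral_mono (((hgβ.mono_set hE).add (hconst _)).const_mul _) hexpint fun x => ?_
      dsimp only
      have h2 : Real.exp (g x) = Real.exp (β + y₀) * Real.exp (g x - β - y₀) := by
        rw [← Real.exp_add]; congr 1; ring
      rw [h2]
      gcongr
      linarith [Real.add_one_le_exp (g x - β - y₀)]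
    refine le_trans ?_ h1
    rw [integral_const_mul, integral_add (hgβ.mono_set hE) (hconst _), setIntegral_const,
      smul_eq_mul]
    gcongr
    have h3 : (J + 1) * (l ^ n) ≤ (J + 1) * (2 * volume.real E) := by
      gcongr
      linarith
    nlinarith
  have hfinal : Real.exp μ ≤ 2 * Real.exp (2 * (J + 1)) * ∫ x in E, Real.exp (g x) := by
    have h1 : Real.exp (β + y₀) * (l ^ n / 2) ≤ ∫ x in E, Real.exp (g x) :=
      le_trans (by gcongr) hjensen
    have h2 : Real.exp (β + y₀) * (l ^ n / 2) * (2 * Real.exp (2 * (J + 1))) = Real.exp μ := by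
      rw [← exp_mul_log_natCast hl]
      have : Real.exp (β + y₀) * (Real.exp (n * Real.log l) / 2) * (2 * Real.exp (2 * (J + 1))) =
        Real.exp (β + y₀) * Real.exp (n * Real.log l) * Real.exp (2 * (J + 1)) := by ring
      rw [this, ← Real.exp_add, ← Real.exp_add]
      congr 1
      rw [hβ, hy₀]; ring
    rw [← h2, mul_comm (2 * Real.exp (2 * (J + 1)))]
    gcongr
  calc ENNReal.ofReal (Real.exp μ)
      ≤ ENNReal.ofReal (2 * Real.exp (2 * (J + 1)) * ∫ x in E, Real.exp (g x)) :=
        ENNReal.ofReal_le_ofReal hfinal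
    _ = _ := by
        rw [ENNReal.ofReal_mul (by positivity), ofReal_integral_eq_lintegral_ofReal hexpint
          (Filter.Eventually.of_forall fun x => (Real.exp_pos _).le)]

theorem mul_mem_Icc_of_mem_Icc {u v y lam : ℝ} (h1 : u ≤ y) (h2 : y ≤ v) :
    min (u * lam) (v * lam) ≤ y * lam ∧ y * lam ≤ max (u * lam) (v * lam) := by
  rcases le_total 0 lam with h | h
  · exact ⟨(min_le_left _ _).trans (by gcongr), le_trans (by gcongr) (le_max_right _ _)⟩
  · exact ⟨(min_le_right _ _).trans (mul_le_mul_of_nonpos_right h2 h),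
      (mul_le_mul_of_nonpos_right h1 h).trans (le_max_left _ _)⟩

theorem max_mul_sub_min_mul {u v lam : ℝ} (h : u ≤ v) :
    max (u * lam) (v * lam) - min (u * lam) (v * lam) = |lam| * (v - u) := by
  rw [max_sub_min_eq_abs, ← sub_mul, abs_mul, abs_of_nonneg (sub_nonneg.2 h), mul_comm]

/-- The sign of `lam` decides which of the two powers is the large one, hence the maximum in the
normalisation factors. -/
theorem ofReal_exp_abs_mul_le_max (lam d : ℝ) :
    ENNReal.ofReal (Real.exp (|lam| * d)) ≤
      max (ENNReal.ofReal (Real.exp lam) ^ (-d)) (ENNReal.ofReal (Real.exp lam) ^ d) := by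
  rw [ENNReal.ofReal_rpow_of_pos (Real.exp_pos _), ENNReal.ofReal_rpow_of_pos (Real.exp_pos _),
    ← Real.exp_mul, ← Real.exp_mul]
  rcases abs_cases lam with ⟨h, -⟩ | ⟨h, -⟩
  · rw [h]; exact le_max_right _ _
  · rw [h, neg_mul, ← mul_neg]; exact le_max_left _ _

/-- The normalisation is undone on both sides, so only the oscillation |`lam`|(v - u) of p `lam` is
lost. The numbers u and v bound p almost everywhere and may be sharper than a and b. -/
theorem LHExponent.wMass_le_mul_of_subset (h : LHExponent a b pInf C₀ CInf p) (hn : 0 < n)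
    {w : EuclideanSpace ℝ (Fin n) → ℝ} (hw : IsApInfty p w) {u v : ℝ} (huv : u ≤ v)
    (hp : ∀ᵐ x, u ≤ p x ∧ p x ≤ v) :
    0 < (apInftyConst p w).toReal ∧ ∃ lam J : ℝ,
      varNorm p ((unitScaleCube n).indicator w) = ENNReal.ofReal (Real.exp lam) ∧
      J ≤ directExp n a b C₀ CInf * (1 + (1 + meanNormConst n a b C₀ CInf) / a) +
        directExp n a b C₀ CInf * Real.log (apInftyConst p w).toReal ∧
      ∀ z l, 0 < l → wMass (fun x => w x ^ p x) (closedCube z l) < ∞ ∧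
        ∀ E ⊆ closedCube z l, l ^ n / 2 ≤ volume.real E →
          wMass (fun x => w x ^ p x) (closedCube z l) ≤
            ENNReal.ofReal (2 * Real.exp (2 * (J + 1) + |lam| * (v - u))) *
              wMass (fun x => w x ^ p x) E := by
  obtain ⟨hK, lam, J, hlam, hJ0, hJ, H⟩ := h.lintegral_exp_mul_le_of_isApInfty hn hw
  have hup : ∀ᵐ x, p x * lam ≤ max (u * lam) (v * lam) :=
    hp.mono fun x hx => (mul_mem_Icc_of_mem_Icc hx.1 hx.2).2
  have hlo : ∀ᵐ x, min (u * lam) (v * lam) ≤ p x * lam :=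
    hp.mono fun x hx => (mul_mem_Icc_of_mem_Icc hx.1 hx.2).1
  refine ⟨hK, lam, J, hlam, hJ, fun z l hl => ?_⟩
  obtain ⟨hint, hle⟩ := H z l hl
  refine ⟨(wMass_rpow_le hw.1 hup _).trans_lt
    (ENNReal.mul_lt_top ENNReal.ofReal_lt_top (hle.trans_lt ENNReal.ofReal_lt_top)),
    fun E hE hvol => ?_⟩
  have hgm : AEMeasurable (fun x => p x * (Real.log (w x) - lam)) volume :=
    h.meas.aemeasurable.mul (hw.1.aemeasurable_log.sub aemeasurable_const)
  have hgi : IntegrableOn (fun x => p x * (Real.log (w x) - lam)) (closedCube z l) volume :=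
    h.integrableOn_mul (hint.sub (integrableOn_const (volume_closedCube_lt_top z hl).ne))
  calc _ ≤ _ := wMass_rpow_le hw.1 hup _
    _ ≤ ENNReal.ofReal (Real.exp (max (u * lam) (v * lam))) *
        (ENNReal.ofReal (2 * Real.exp (2 * (J + 1))) *
          (ENNReal.ofReal (Real.exp (-min (u * lam) (v * lam))) *
            wMass (fun x => w x ^ p x) E)) := by
        gcongr
        refine (lintegral_exp_le_mul_of_subset hgm hl hJ0 hgi hle hE hvol).trans ?_
        gcongr
        exact le_wMass_rpow hw.1 hlo E
    _ = _ := by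
        rw [← mul_assoc, ← mul_assoc, ← ENNReal.ofReal_mul (by positivity),
          ← ENNReal.ofReal_mul (by positivity)]
        congr 2
        rw [← max_mul_sub_min_mul huv]
        have : Real.exp (max (u * lam) (v * lam)) * (2 * Real.exp (2 * (J + 1))) *
          Real.exp (-min (u * lam) (v * lam)) = 2 * (Real.exp (2 * (J + 1)) *
          Real.exp (max (u * lam) (v * lam)) * Real.exp (-min (u * lam) (v * lam))) := by ring
        rw [this, ← Real.exp_add, ← Real.exp_add]
        congr 2; ring

/-- Here the normalisation divides W by exp `lam`, which shifts log w by `lam`/p; its oscillation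
enters once through the norm and the mean together. -/
theorem LHExponent.apInftyConst_le (h : LHExponent a b pInf C₀ CInf p) (hn : 0 < n)
    {W : EuclideanSpace ℝ (Fin n) → ℝ} (hW : IsAInfty W) {u v : ℝ} (hu : 0 < u) (huv : u ≤ v)
    (hp : ∀ᵐ x, u ≤ p x ∧ p x ≤ v) :
    0 < (aInftyConst W).toReal ∧ ∃ lam : ℝ,
      wMass W (unitScaleCube n) = ENNReal.ofReal (Real.exp lam) ∧
      apInftyConst p (fun x => W x ^ (1 / p x)) ≤
        ENNReal.ofReal (Real.exp (converseExp n a b C₀ CInf *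
          (2 + Real.log (aInftyConst W).toReal) + |lam| * (1 / u - 1 / v))) := by
  obtain ⟨hK, lam, hlam, H⟩ := h.cubeModular_div_le_one_of_isAInfty hn hW
  refine ⟨hK, lam, hlam, VariableWeight.apInftyConst_le fun z l hl => ?_⟩
  obtain ⟨hint, hmod⟩ := H z l hl
  obtain ⟨σ, hσ1, hσ2⟩ := h.exists_varNorm_one_eq z hl
  have hmod := hmod σ hσ2
  have hln : 0 < l ^ n := by positivity
  have hwW : IsWeight (fun x => W x ^ (1 / p x)) := hW.1.rpow (h.meas.const_div 1).aemeasurable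
  have hlog : ∀ᵐ x, Real.log (W x ^ (1 / p x)) = Real.log (W x) / p x := by
    filter_upwards [hW.1.2.2] with x hx
    rw [Real.log_rpow hx, one_div, div_eq_inv_mul]
  have hint1 := h.integrableOn_div hint
  have hint2 : IntegrableOn (fun x => Real.log (W x ^ (1 / p x))) (closedCube z l) volume :=
    hint1.congr (ae_restrict_of_ae (hlog.mono fun _ hx => hx.symm))
  have hp' : ∀ᵐ x, min (1 / v * lam) (1 / u * lam) ≤ lam / p x ∧
      lam / p x ≤ max (1 / v * lam) (1 / u * lam) := by
    filter_upwards [hp] with x hx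
    have hpx := h.pos x
    rw [show lam / p x = 1 / p x * lam by ring]
    exact mul_mem_Icc_of_mem_Icc (one_div_le_one_div_of_le hpx hx.2)
      (one_div_le_one_div_of_le hu hx.1)
  have hd := max_mul_sub_min_mul (lam := lam) (one_div_le_one_div_of_le hu huv)
  generalize min (1 / v * lam) (1 / u * lam) = c₀ at *
  generalize max (1 / v * lam) (1 / u * lam) = c₁ at *
  have hI : (∫ x in closedCube z l, (Real.log (W x) - lam) / p x) / l ^ n ≤
      (∫ x in closedCube z l, Real.log (W x ^ (1 / p x))) / l ^ n - c₀ := by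
    rw [div_sub' hln.ne', mul_comm]
    gcongr
    rw [← setIntegral_closedCube_sub_const hl hint2]
    refine integral_mono_ae (h.integrableOn_div
      (hint.sub (integrableOn_const (volume_closedCube_lt_top z hl).ne)))
      (hint2.sub (integrableOn_const (volume_closedCube_lt_top z hl).ne)) (ae_restrict_of_ae ?_)
    filter_upwards [hlog, hp'] with x hx hpx
    rw [hx, sub_div]
    linarith [hpx.1]
  rw [expAvgLogInv_closedCube hl hint2, hσ1]
  generalize (∫ x in closedCube z l, Real.log (W x ^ (1 / p x))) / l ^ n = m at *
  generalize (∫ x in closedCube z l, (Real.log (W x) - lam) / p x) / l ^ n = m' at *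
  generalize converseExp n a b C₀ CInf * (2 + Real.log (aInftyConst W).toReal) = A at *
  have hmod2 : cubeModular p (fun x => Real.log (W x ^ (1 / p x))) z l
      (σ + m + A + (c₁ - c₀)) ≤ 1 := by
    refine le_trans ?_ hmod
    unfold cubeModular
    refine lintegral_mono_ae (ae_restrict_of_ae ?_)
    filter_upwards [hlog, hp'] with x hx hpx
    refine ENNReal.ofReal_le_ofReal (Real.exp_le_exp.2 ?_)
    refine mul_le_mul_of_nonneg_left ?_ (h.pos x).le
    rw [hx, sub_div]
    linarith [hpx.2]
  have hnorm := varNorm_le_of_cubeModular_le_one hwW h.pos hmod2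
  calc _ ≤ ENNReal.ofReal (Real.exp (σ + m + A + (c₁ - c₀))) / ENNReal.ofReal (Real.exp σ) *
        ENNReal.ofReal (Real.exp (-m)) := by gcongr
    _ = _ := by
        rw [ofReal_exp_div_ofReal_exp, ofReal_exp_mul_ofReal_exp, ← hd]
        congr 2; ring

end VariableWeight

/-! ### Explicit constants and the theorem. -/

namespace VariableWeight

variable {n : ℕ} {a b pInf C₀ CInf : ℝ} {p : EuclideanSpace ℝ (Fin n) → ℝ}

/-- The constant factor in the comparison of `𝕎(Q)` and `𝕎(E)`. -/
noncomputable def massFactor (n : ℕ) (a b C₀ CInf : ℝ) : ℝ :=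
  4 * Real.exp (2 * (directExp n a b C₀ CInf * (1 + (1 + meanNormConst n a b C₀ CInf) / a) + 1))

theorem rpow_eq_ofReal_exp_log {c : ℝ≥0∞} (hc : c ≠ ∞) (hpos : 0 < c.toReal) (A : ℝ) :
    c ^ A = ENNReal.ofReal (Real.exp (A * Real.log c.toReal)) := by
  nth_rewrite 1 [← ENNReal.ofReal_toReal hc]
  rw [ENNReal.ofReal_rpow_of_pos hpos, Real.rpow_def_of_pos hpos, mul_comm]

theorem HasParameters.ae_mem_Icc {pm pp : ℝ} (h : HasParameters pm pp pInf C₀ CInf p) :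
    ∀ᵐ x, pm ≤ p x ∧ p x ≤ pp := by
  have hb := h.lhExponent.abs_le_b
  rw [← h.2.1, ← h.2.2.1]
  filter_upwards [ae_pMinus_le hb, ae_le_pPlus hb] with x h1 h2
  exact ⟨h1, h2⟩

theorem HasParameters.one_le {pm pp : ℝ} (h : HasParameters pm pp pInf C₀ CInf p) :
    1 ≤ pm := by
  rw [← h.2.1]
  refine le_essInf_of_ae_le 1 (Filter.Eventually.of_forall h.1.2) ?_
  exact Filter.IsBoundedUnder.isCoboundedUnder_ge ⟨pInf + CInf, Filter.eventually_map.2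
    (Filter.Eventually.of_forall h.lhExponent.le_b)⟩

theorem HasParameters.le {pm pp : ℝ} (h : HasParameters pm pp pInf C₀ CInf p) : pm ≤ pp := by
  obtain ⟨x, h1, h2⟩ := h.ae_mem_Icc.exists
  exact h1.trans h2

theorem wMass_rpow_closedCube_pos {w : EuclideanSpace ℝ (Fin n) → ℝ} (hw : IsWeight w)
    (hp : Measurable p) (z : EuclideanSpace ℝ (Fin n)) {l : ℝ} (hl : 0 < l) :
    0 < wMass (fun x => w x ^ p x) (closedCube z l) := by
  have h1 : wMass (fun x => w x ^ p x) (closedCube z l) =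
      ∫⁻ x in closedCube z l, ENNReal.ofReal (Real.exp (p x * Real.log (w x))) := by
    refine lintegral_congr_ae (ae_restrict_of_ae ?_)
    filter_upwards [hw.ae_rpow_eq p] with x hx
    rw [hx]
  rw [h1]
  exact lintegral_exp_pos (hp.aemeasurable.mul hw.aemeasurable_log) z hl

/-- The exponent δ/(δ - 1) is at least 1, and its product with 1 - 1/δ is exactly 1. -/
theorem lt_half_of_lt_two_rpow {δ α K : ℝ} (hK : 0 < K) (hδ : δ = 1 + 1 / K) (hα0 : 0 < α)
    (hα : α < (2 : ℝ) ^ (-(δ / (δ - 1)))) : α < 1 / 2 ∧ α ^ (1 - 1 / δ) < 1 / 2 := by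
  have hK1 : 0 < 1 / K := by positivity
  have hδ1 : 0 < δ - 1 := by linarith
  have hδ0 : 0 < δ := by linarith
  have hhalf : (2 : ℝ) ^ (-1 : ℝ) = 1 / 2 := by
    rw [Real.rpow_neg_one]; norm_num
  constructor
  · refine hα.trans_le ?_
    rw [← hhalf]
    refine Real.rpow_le_rpow_of_exponent_le one_le_two (neg_le_neg ?_)
    rw [one_le_div hδ1]; linarith
  · have he : 0 < 1 - 1 / δ := by
      rw [sub_pos, div_lt_one hδ0]; linarith
    refine (Real.rpow_lt_rpow hα0.le hα he).trans_le (le_of_eq ?_)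
    rw [← Real.rpow_mul two_pos.le, ← hhalf]
    congr 1
    field_simp

theorem half_le_measureReal {E : Set (EuclideanSpace ℝ (Fin n))} {α : ℝ} (hα : α < 1 / 2)
    {z : EuclideanSpace ℝ (Fin n)} {l : ℝ} (hl : 0 < l) (hE : E ⊆ closedCube z l)
    (h : ENNReal.ofReal (1 - α) * volume (closedCube z l) < volume E) :
    l ^ n / 2 ≤ volume.real E := by
  have hfin : volume E ≠ ∞ := ((measure_mono hE).trans_lt (volume_closedCube_lt_top z hl)).ne
  have hln : 0 < l ^ n := by positivity
  rw [volume_closedCube z hl, ← ENNReal.ofReal_mul (by linarith)] at h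
  have h1 := (ENNReal.ofReal_le_iff_le_toReal hfin).1 h.le
  rw [measureReal_def]
  refine le_trans ?_ h1
  nlinarith

theorem HasParameters.wMass_lt {pm pp : ℝ} (h : HasParameters pm pp pInf C₀ CInf p) (hn : 0 < n)
    {w : EuclideanSpace ℝ (Fin n) → ℝ} (hw : IsApInfty p w) {α θ : ℝ} (hα : α < 1 / 2)
    (hθ : 1 ≤ θ) {Q E : Set (EuclideanSpace ℝ (Fin n))} (hQ : IsCube Q) (hEQ : E ⊆ Q)
    (hE : ENNReal.ofReal (1 - α) * volume Q < volume E) :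
    wMass (fun x => w x ^ p x) Q <
      ENNReal.ofReal (massFactor n (min 1 pInf) (pInf + CInf) C₀ CInf * θ) *
        apInftyConst p w ^ (2 * directExp n (min 1 pInf) (pInf + CInf) C₀ CInf) *
        normFactor p w * wMass (fun x => w x ^ p x) E := by
  have hL := h.lhExponent
  obtain ⟨hK, lam, J, hlam, hJ, H⟩ := hL.wMass_le_mul_of_subset hn hw h.le h.ae_mem_Icc
  obtain ⟨z, l, hl, hQc⟩ := hQ.exists_ae_eq
  obtain ⟨hfin, hsub⟩ := H z l hl
  -- Only almost everywhere equality of Q with the closed cube is at hand, so E is first cut down to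
  -- that cube.
  have hEc : (E ∩ closedCube z l : Set _) =ᵐ[volume] E := by
    have h1 : (E ∩ closedCube z l : Set _) =ᵐ[volume] (E ∩ Q : Set _) :=
      (ae_eq_refl E).inter hQc.symm
    rwa [Set.inter_eq_left.2 hEQ] at h1
  have hmain := hsub (E ∩ closedCube z l) Set.inter_subset_right
    (half_le_measureReal hα hl Set.inter_subset_right
      (by rwa [measure_congr hEc, ← measure_congr hQc]))
  rw [wMass_congr_set _ hEc] at hmain
  rw [wMass_congr_set _ hQc]
  have hpos := wMass_rpow_closedCube_pos hw.1 hL.meas z hl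
  have hE0 : wMass (fun x => w x ^ p x) E ≠ 0 := by
    intro h0
    rw [h0, mul_zero] at hmain
    exact hpos.not_ge hmain
  have hEtop : wMass (fun x => w x ^ p x) E ≠ ∞ := by
    rw [← wMass_congr_set _ hEc]
    exact ((lintegral_mono_set Set.inter_subset_right).trans_lt hfin).ne
  refine hmain.trans_lt (ENNReal.mul_lt_mul_left hE0 hEtop ?_)
  have hnorm : ENNReal.ofReal (Real.exp (|lam| * (pp - pm))) ≤ normFactor p w := by
    unfold normFactor
    rw [hlam, h.2.1, h.2.2.1, ← neg_sub pp pm]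
    exact ofReal_exp_abs_mul_le_max _ _
  refine lt_of_lt_of_le ?_ (mul_le_mul_right hnorm _)
  unfold massFactor
  rw [rpow_eq_ofReal_exp_log hw.2.ne hK, ← ENNReal.ofReal_mul (by positivity),
    ← ENNReal.ofReal_mul (by positivity)]
  generalize directExp n (min 1 pInf) (pInf + CInf) C₀ CInf *
        (1 + (1 + meanNormConst n (min 1 pInf) (pInf + CInf) C₀ CInf) / min 1 pInf) = B at *
  generalize directExp n (min 1 pInf) (pInf + CInf) C₀ CInf = A at *
  generalize Real.log (apInftyConst p w).toReal = k at *
  rw [ENNReal.ofReal_lt_ofReal_iff (by positivity)]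
  have h1 : Real.exp (2 * (J + 1) + |lam| * (pp - pm)) ≤
      Real.exp (2 * (B + 1)) * Real.exp (2 * A * k) * Real.exp (|lam| * (pp - pm)) := by
    rw [← Real.exp_add, ← Real.exp_add]
    exact Real.exp_le_exp.2 (by linarith)
  have h2 : 0 < Real.exp (2 * (J + 1) + |lam| * (pp - pm)) := Real.exp_pos _
  have h3 : 4 * Real.exp (2 * (B + 1)) * θ * Real.exp (2 * A * k) * Real.exp (|lam| * (pp - pm)) =
    4 * θ * (Real.exp (2 * (B + 1)) * Real.exp (2 * A * k) * Real.exp (|lam| * (pp - pm))) := by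
    ring
  rw [h3]
  -- Strictness comes from the 4 in `massFactor` against the 2 in the bound for the mass.
  nlinarith

theorem HasParameters.apInftyConst_le {pm pp : ℝ} (h : HasParameters pm pp pInf C₀ CInf p)
    (hn : 0 < n) {W : EuclideanSpace ℝ (Fin n) → ℝ} (hW : IsAInfty W) :
    apInftyConst p (fun x => W x ^ (1 / p x)) ≤
      ENNReal.ofReal (Real.exp (2 * converseExp n (min 1 pInf) (pInf + CInf) C₀ CInf)) *
        massNormFactor p W * aInftyConst W ^ converseExp n (min 1 pInf) (pInf + CInf) C₀ CInf := by
  obtain ⟨hK, lam, hlam, hle⟩ := h.lhExponent.apInftyConst_le hn hW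
    (zero_lt_one.trans_le h.one_le) h.le h.ae_mem_Icc
  have hnorm : ENNReal.ofReal (Real.exp (|lam| * (1 / pm - 1 / pp))) ≤ massNormFactor p W := by
    unfold massNormFactor
    rw [hlam, h.2.1, h.2.2.1, max_comm, ← neg_sub (1 / pm) (1 / pp)]
    exact ofReal_exp_abs_mul_le_max _ _
  refine (hle.trans (le_of_eq ?_)).trans (mul_le_mul_left (mul_le_mul_right hnorm _) _)
  rw [rpow_eq_ofReal_exp_log hW.2.ne hK, ofReal_exp_mul_ofReal_exp, ofReal_exp_mul_ofReal_exp]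
  congr 2; ring

end VariableWeight

theorem theorem2p7 (n : ℕ) (hn : 0 < n) :
    -- the equivalence
    (∀ p : EuclideanSpace ℝ (Fin n) → ℝ,
      VariableWeight.IsExponentP0 p → VariableWeight.IsLogHolder p →
      ∀ w : EuclideanSpace ℝ (Fin n) → ℝ, VariableWeight.IsWeight w →
        (VariableWeight.IsApInfty p w ↔ VariableWeight.IsAInfty (fun x => w x ^ p x))) ∧
    -- the quantitative bound for the direct implication
    (∃ τ : ℝ, 0 < τ ∧ ∀ pm pp pInf C₀ CInf : ℝ,
      ∃ K C A : ℝ, 0 < K ∧ 0 < C ∧ 0 < A ∧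
        ∀ p : EuclideanSpace ℝ (Fin n) → ℝ,
        VariableWeight.HasParameters pm pp pInf C₀ CInf p →
        ∀ w : EuclideanSpace ℝ (Fin n) → ℝ, VariableWeight.IsApInfty p w →
        ∀ δ : ℝ, δ = 1 + 1 / (τ * K * (VariableWeight.apInftyConst p w).toReal) →
        ∀ α : ℝ, 0 < α → α < (2 : ℝ) ^ (-(δ / (δ - 1))) →
        ∀ Q : Set (EuclideanSpace ℝ (Fin n)), VariableWeight.IsCube Q →
        ∀ E : Set (EuclideanSpace ℝ (Fin n)), NullMeasurableSet E volume → E ⊆ Q →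
        ENNReal.ofReal (1 - α) * volume Q < volume E →
          VariableWeight.wMass (fun x => w x ^ p x) Q <
            ENNReal.ofReal (C * (1 - 2 * α ^ (1 - 1 / δ)) ^ (-pp)) *
              VariableWeight.apInftyConst p w ^ A * VariableWeight.normFactor p w *
              VariableWeight.wMass (fun x => w x ^ p x) E) ∧
    -- the quantitative bound for the converse implication
    (∀ pm pp pInf C₀ CInf : ℝ,
      ∃ C A : ℝ, 0 < C ∧ 0 < A ∧
        ∀ p : EuclideanSpace ℝ (Fin n) → ℝ,
        VariableWeight.HasParameters pm pp pInf C₀ CInf p →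
        ∀ W : EuclideanSpace ℝ (Fin n) → ℝ, VariableWeight.IsAInfty W →
          VariableWeight.apInftyConst p (fun x => W x ^ (1 / p x)) ≤
            ENNReal.ofReal C * VariableWeight.massNormFactor p W *
              VariableWeight.aInftyConst W ^ A) := by
  refine ⟨fun p hp hLH w hw => ?_, ⟨1, one_pos, fun pm pp pInf C₀ CInf => ?_⟩,
    fun pm pp pInf C₀ CInf => ?_⟩
  · obtain ⟨a, b, pInf, C₀, CInf, h⟩ := VariableWeight.exists_lhExponent hp hLH
    refine ⟨fun hAp => h.isAInfty_rpow hn hAp, fun hA => ⟨hw, ?_⟩⟩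
    -- Only finiteness matters here, so the crude pointwise bounds a and b take the place of the
    -- essential ones.
    obtain ⟨-, lam, -, hle⟩ := h.apInftyConst_le hn hA h.a_pos ((h.a_le 0).trans (h.le_b 0))
      (Filter.Eventually.of_forall fun x => ⟨h.a_le x, h.le_b x⟩)
    have hww : (fun x => (w x ^ p x) ^ (1 / p x)) = w := by
      ext x
      rw [← Real.rpow_mul (hw.2.1 x), mul_one_div_cancel (h.pos x).ne', Real.rpow_one]
    rw [hww] at hle
    exact hle.trans_lt ENNReal.ofReal_lt_top
  -- The formulas are known to be positive only for parameters of an actual exponent; otherwise the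
  -- claim is vacuous and any positive constants serve.
  · by_cases hex : ∃ p : EuclideanSpace ℝ (Fin n) → ℝ,
        VariableWeight.HasParameters pm pp pInf C₀ CInf p
    · obtain ⟨p₀, hp₀⟩ := hex
      have hA := hp₀.lhExponent.directExp_pos
      -- The dimensional constant and the factor multiplying the weight constant in δ are both 1:
      -- any positive values would do, since δ is needed only to make α < 1/2 and 2α^(1 - 1/δ) < 1.
      refine ⟨1, VariableWeight.massFactor n (min 1 pInf) (pInf + CInf) C₀ CInf, _, one_pos,
        mul_pos four_pos (Real.exp_pos _), mul_pos two_pos hA,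
        fun p hp w hw δ hδ α hα0 hα Q hQ E _ hEQ hE => ?_⟩
      have hK : 0 < (VariableWeight.apInftyConst p w).toReal :=
        (hp.lhExponent.lintegral_exp_mul_le_of_isApInfty hn hw).1
      rw [one_mul, one_mul] at hδ
      obtain ⟨h1, h2⟩ := VariableWeight.lt_half_of_lt_two_rpow hK hδ hα0 hα
      refine hp.wMass_lt hn hw h1 ?_ hQ hEQ hE
      refine Real.one_le_rpow_of_pos_of_le_one_of_nonpos (by linarith) ?_ ?_
      · linarith [Real.rpow_nonneg hα0.le (1 - 1 / δ)]
      · linarith [hp.one_le, hp.le]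
    · exact ⟨1, 1, 1, one_pos, one_pos, one_pos, fun p hp => absurd ⟨p, hp⟩ hex⟩
  · by_cases hex : ∃ p : EuclideanSpace ℝ (Fin n) → ℝ,
        VariableWeight.HasParameters pm pp pInf C₀ CInf p
    · obtain ⟨p₀, hp₀⟩ := hex
      exact ⟨_, _, Real.exp_pos _, hp₀.lhExponent.converseExp_pos,
        fun p hp W hW => hp.apInftyConst_le hn hW⟩
    · exact ⟨1, 1, one_pos, one_pos, fun p hp => absurd ⟨p, hp⟩ hex⟩
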